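/- Let $d\ge 2$ and $0\le k\le d-2$. Let $\mathcal L$ be a finite homogeneous simplicial $d$-complex (the largest simplices have dimension $d$ and every simplex is a face of a $d$-simplex) that is a manifold without boundary in the following weak sense: the link of every $m$-simplex ($0\le m\le d$) has the reduced $\mathbb F_2$-homology of the sphere $S^{d-m-1}$ (for instance, a triangulated closed manifold). Suppose the vertices of $\mathcal L$ are colored with $\{0,1,\dots,d\}$ so that adjacent vertices have different colors, and let $\mathrm{color}(\sigma)$ be the set of colors of the vertices of a simplex $\sigma$. Write $\Delta_n(\mathcal L)$ for the set of $n$-simplices, $\mathrm{St}_n(\delta)$ for the set of $n$-simplices containing $\delta$, and $\mathrm{Lk}_n(\delta)$ for the set of $n$-simplices that are disjoint from $\delta$ and are faces of a $d$-simplex containing $\delta$. The color code $CC_k(\mathcal L)$ is the stabilizer group on qubits placed on the $d$-simplices of $\mathcal L$ that is generated by $\bigotimes_{\sigma\in \mathrm{St}_d(\delta)}X(\sigma)$ for $\delta\in\Delta_{d-k-2}(\mathcal L)$ and $\bigotimes_{\sigma\in \mathrm{St}_d(\delta)}Z(\sigma)$ for $\delta\in\Delta_{k}(\mathcal L)$.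 For a cell complex $\mathcal K$, the toric code $TC_{m}(\mathcal K)$ is the stabilizer group on qubits placed on the $m$-cells that is generated by $\bigotimes X(\sigma)$ over the $m$-faces $\sigma$ of $c$, for each $(m+1)$-cell $c$, and $\bigotimes Z(\sigma)$ over the $m$-cells $\sigma$ having $c$ as a face, for each $(m-1)$-cell $c$. For a set $N\subset\{0,\dots,d-1\}$ of $d-1-k$ colors let $\mathcal L_N$ be the cell complex, described by its cells and their incidences, whose cells are the simplices of $\mathcal L$ of dimension at most $k+1$ with no vertex of color in $N$, and, for every $(d-2-k)$-simplex $\tau$ with $\mathrm{color}(\tau)=N$, one $(k+2)$-cell attached along $\mathrm{Lk}_{k+1}(\tau)$ (its proper faces are the simplices of $\mathrm{Lk}_{k+1}(\tau)$ and their faces). Then there are $\binom{d}{k+1}$ such sets $N$; each $\mathcal L_N$ is a homogeneous cell $(k+2)$-complex (there are $(k+2)$-cells and every other cell is a face of one; every $1$-cell has exactly two vertices, and exactly two cells lie strictly between a cell and any face of it of codimension two); and there is a Clifford unitary $U$ such that $$U\left[CC_k(\mathcal L)\otimes\mathcal S_1\right]U^\dagger=\bigotimes_{N} TC_{k+1}(\mathcal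 L_N)\otimes\mathcal S_2$$ as groups of operators, where $\mathcal S_1$ and $\mathcal S_2$ are the stabilizer groups of ancilla qubits, generated by the single-qubit operators $Z$. Moreover $U$ is a tensor product $U=\bigotimes_{\delta}U(\delta)$ over the vertices $\delta$ of color $d$, where $U(\delta)$ is a Clifford unitary from the qubits on the $d$-simplices in $\mathrm{St}_d(\delta)$ and the ancillas of $\mathcal S_1$ associated with $\delta$ to the qubits on the $(k+1)$-simplices in $\mathrm{St}_{k+1}(\delta)$ and the ancillas of $\mathcal S_2$ associated with $\delta$. The numbers of ancillas associated with $\delta$ are $\max(0,A_\delta)$ in $\mathcal S_1$ and $\max(0,-A_\delta)$ in $\mathcal S_2$, with $A_\delta=|\mathrm{St}_{k+1}(\delta)|-|\mathrm{St}_d(\delta)|$. -/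

import Mathlib

namespace UnfoldingColorCode

noncomputable section

open scoped Classical Matrix

/-! ## Qubits, Pauli operators, Clifford unitaries -/

/-- Computational basis states of a register of qubits indexed by `Q`; the Hilbert space of the
register is `ℂ ^ Config Q`, and operators on it are matrices indexed by `Config Q`. -/
abbrev Config (Q : Type*) : Type _ := Q → Fin 2

/-- The tensor product `⨂ q, f q` of one-qubit operators. -/
def tensorOp {Q : Type*} [Fintype Q] (f : Q → Matrix (Fin 2) (Fin 2) ℂ) :
    Matrix (Config Q) (Config Q) ℂ :=
  Matrix.of fun y x => ∏ q, f q (y q) (x q)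

theorem tensorOp_mul {Q : Type*} [Fintype Q] (f g : Q → Matrix (Fin 2) (Fin 2) ℂ) :
    tensorOp f * tensorOp g = tensorOp fun q => f q * g q := by
  ext y x
  simp only [tensorOp, Matrix.mul_apply, Matrix.of_apply]
  rw [Finset.prod_univ_sum, Fintype.piFinset_univ]
  exact Finset.sum_congr rfl fun z _ => Finset.prod_mul_distrib.symm

theorem tensorOp_one {Q : Type*} [Fintype Q] :
    tensorOp (fun _ : Q => (1 : Matrix (Fin 2) (Fin 2) ℂ)) = 1 := by
  ext y x
  simp only [tensorOp, Matrix.of_apply, Matrix.one_apply]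
  by_cases h : y = x
  · simp [h]
  · obtain ⟨q, hq⟩ := Function.ne_iff.mp h
    rw [if_neg h]
    exact Finset.prod_eq_zero (Finset.mem_univ q) (if_neg hq)

theorem tensorOp_star {Q : Type*} [Fintype Q] (f : Q → Matrix (Fin 2) (Fin 2) ℂ) :
    star (tensorOp f) = tensorOp fun q => star (f q) := by
  ext y x
  simp [tensorOp, Matrix.star_apply]

/-- A tensor product of one-qubit unitaries, as an element of the unitary group. -/
def tensorUnitary {Q : Type*} [Fintype Q] (f : Q → Matrix.unitaryGroup (Fin 2) ℂ) :
    Matrix.unitaryGroup (Config Q) ℂ :=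
  ⟨tensorOp fun q => (f q : Matrix (Fin 2) (Fin 2) ℂ), by
    rw [Matrix.mem_unitaryGroup_iff, tensorOp_star, tensorOp_mul]
    rw [← tensorOp_one]
    congr 1
    funext q
    exact Matrix.mem_unitaryGroup_iff.mp (f q).2⟩

/-- The Pauli matrix `X`. -/
def pauliX : Matrix.unitaryGroup (Fin 2) ℂ :=
  ⟨!![0, 1; 1, 0], by
    rw [Matrix.mem_unitaryGroup_iff]
    ext i j
    fin_cases i <;> fin_cases j <;> simp [Matrix.mul_apply, Matrix.star_apply]⟩

/-- The Pauli matrix `Z`. -/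
def pauliZ : Matrix.unitaryGroup (Fin 2) ℂ :=
  ⟨!![1, 0; 0, -1], by
    rw [Matrix.mem_unitaryGroup_iff]
    ext i j
    fin_cases i <;> fin_cases j <;> simp [Matrix.mul_apply, Matrix.star_apply]⟩

/-- `⨂_{q ∈ s} X(q)`. -/
def opX {Q : Type*} [Fintype Q] (s : Set Q) : Matrix.unitaryGroup (Config Q) ℂ :=
  tensorUnitary fun q => if q ∈ s then pauliX else 1

/-- `⨂_{q ∈ s} Z(q)`. -/
def opZ {Q : Type*} [Fintype Q] (s : Set Q) : Matrix.unitaryGroup (Config Q) ℂ :=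
  tensorUnitary fun q => if q ∈ s then pauliZ else 1

/-- The Pauli group of a register: generated by the one-qubit operators `X(q)`, `Z(q)` and the
phase `i`. -/
def pauliGroup (Q : Type*) [Fintype Q] : Subgroup (Matrix.unitaryGroup (Config Q) ℂ) :=
  Subgroup.closure
    ({g | ∃ q, g = opX {q}} ∪ {g | ∃ q, g = opZ {q}} ∪
      {g | (g : Matrix (Config Q) (Config Q) ℂ) = Complex.I • (1 : Matrix _ _ ℂ)})

/-- `U` is a unitary map from the Hilbert space of the register `P` to that of the register `Q`. -/
def IsUnitary {P Q : Type*} [Fintype P] [Fintype Q] (U : Matrix (Config Q) (Config P) ℂ) : Prop :=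
  Uᴴ * U = 1 ∧ U * Uᴴ = 1

/-- `U G U† = H`, an equality of sets of operators. -/
def ConjEq {P Q : Type*} [Fintype P] [Fintype Q] (U : Matrix (Config Q) (Config P) ℂ)
    (G : Subgroup (Matrix.unitaryGroup (Config P) ℂ))
    (H : Subgroup (Matrix.unitaryGroup (Config Q) ℂ)) : Prop :=
  {B : Matrix (Config Q) (Config Q) ℂ |
      ∃ g ∈ G, B = U * (g : Matrix (Config P) (Config P) ℂ) * Uᴴ} =
    {B : Matrix (Config Q) (Config Q) ℂ | ∃ h ∈ H, B = (h : Matrix (Config Q) (Config Q) ℂ)}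

/-- A Clifford unitary: conjugation by it carries the Pauli group to the Pauli group. -/
def IsClifford {P Q : Type*} [Fintype P] [Fintype Q] (U : Matrix (Config Q) (Config P) ℂ) : Prop :=
  IsUnitary U ∧ ConjEq U (pauliGroup P) (pauliGroup Q)

/-- The tensor product `⨂ δ, U δ`, where `U δ` acts from the qubits `p` of `P` with `inP δ p` to
the qubits `q` of `Q` with `inQ δ q`; the blocks are meant to partition both registers. -/
def tensorBlocks {P Q D : Type*} [Fintype D] (inP : D → P → Prop) (inQ : D → Q → Prop)
    (U : ∀ δ : D, Matrix (Config {q // inQ δ q}) (Config {p // inP δ p}) ℂ) :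
    Matrix (Config Q) (Config P) ℂ :=
  Matrix.of fun y x => ∏ δ, U δ (fun q => y q.1) (fun p => x p.1)

/-! ## Stabilizer groups with `X`-type and `Z`-type generators -/

/-- A code given by the supports of its `X`-type and of its `Z`-type stabilizer generators. -/
structure CSSCode (Q : Type*) where
  xGen : Set (Set Q)
  zGen : Set (Set Q)

/-- The stabilizer group, as a group of operators (no phases are discarded). -/
def CSSCode.group {Q : Type*} [Fintype Q] (C : CSSCode Q) :
    Subgroup (Matrix.unitaryGroup (Config Q) ℂ) :=
  Subgroup.closure ({g | ∃ s ∈ C.xGen, g = opX s} ∪ {g | ∃ s ∈ C.zGen, g = opZ s})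

/-- Tensor product of two codes on disjoint registers. -/
def CSSCode.tensor {P Q : Type*} (C : CSSCode P) (D : CSSCode Q) : CSSCode (P ⊕ Q) where
  xGen := {s | (∃ t ∈ C.xGen, s = Sum.inl '' t) ∨ ∃ t ∈ D.xGen, s = Sum.inr '' t}
  zGen := {s | (∃ t ∈ C.zGen, s = Sum.inl '' t) ∨ ∃ t ∈ D.zGen, s = Sum.inr '' t}

/-- Tensor product of a family of codes on disjoint registers. -/
def CSSCode.tensorFamily {ι : Type*} {Q : ι → Type*} (C : ∀ i, CSSCode (Q i)) :
    CSSCode (Σ i, Q i) where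
  xGen := {s | ∃ i, ∃ t ∈ (C i).xGen, s = Sigma.mk i '' t}
  zGen := {s | ∃ i, ∃ t ∈ (C i).zGen, s = Sigma.mk i '' t}

/-- Decoupled ancilla qubits, each stabilized by its own Pauli `Z`. -/
def ancillaCode (A : Type*) : CSSCode A where
  xGen := ∅
  zGen := {s | ∃ a, s = {a}}

/-! ## Simplicial complexes -/

section Simplicial

variable {V : Type*}

/-- The `n`-simplices of `L`. -/
abbrev Simplex (L : AbstractSimplicialComplex V) (n : ℕ) : Type _ :=
  {σ : Finset V // σ ∈ L.faces ∧ σ.card = n + 1}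

/-- `L` is a homogeneous simplicial `d`-complex: its largest simplices have dimension `d`, and
every simplex is a face of a `d`-simplex. -/
def IsHomogeneousComplex (L : AbstractSimplicialComplex V) (d : ℕ) : Prop :=
  (∃ τ ∈ L.faces, τ.card = d + 1) ∧ (∀ σ ∈ L.faces, σ.card ≤ d + 1) ∧
    ∀ σ ∈ L.faces, ∃ τ ∈ L.faces, τ.card = d + 1 ∧ σ ⊆ τ

/-- `col` colors the vertices so that the ends of every edge have different colors. -/
def IsColoring {d : ℕ} (L : AbstractSimplicialComplex V) (col : V → Fin (d + 1)) : Prop :=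
  ∀ u v : V, u ≠ v → ({u, v} : Finset V) ∈ L.faces → col u ≠ col v

/-- The `n`-star of a simplex. -/
def starOf (L : AbstractSimplicialComplex V) (n : ℕ) (δ : Finset V) : Set (Finset V) :=
  {σ | σ ∈ L.faces ∧ σ.card = n + 1 ∧ δ ⊆ σ}

/-- The `n`-link of a simplex of a `d`-complex: the `n`-simplices that are faces of `d`-simplices
containing `δ` and are disjoint from `δ`. -/
def linkOf (L : AbstractSimplicialComplex V) (d n : ℕ) (δ : Finset V) : Set (Finset V) :=
  {σ | σ ∈ L.faces ∧ σ.card = n + 1 ∧ (∃ τ ∈ starOf L d δ, σ ⊆ τ) ∧ Disjoint σ δ}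

/-! ### Manifolds without boundary

`j` below counts vertices, so that the empty simplex of the (augmented) link has `j = 0`. -/

/-- The simplices with `j` vertices (the empty one included) of the link of `σ`. -/
abbrev LinkFace (L : AbstractSimplicialComplex V) (σ : Finset V) (j : ℕ) : Type _ :=
  {s : Finset V // s.card = j ∧ Disjoint s σ ∧ s ∪ σ ∈ L.faces}

/-- The boundary map of the augmented mod-2 chain complex of the link of `σ`. -/
def linkBoundary [Fintype V] (L : AbstractSimplicialComplex V) (σ : Finset V) (j : ℕ) :
    (LinkFace L σ (j + 1) → ZMod 2) →ₗ[ZMod 2] (LinkFace L σ j → ZMod 2) where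
  toFun c t := ∑ s : LinkFace L σ (j + 1), if t.1 ⊆ s.1 then c s else 0
  map_add' a b := by
    funext t
    simp only [Pi.add_apply, ← Finset.sum_add_distrib]
    exact Finset.sum_congr rfl fun s _ => by split_ifs <;> simp
  map_smul' r a := by
    funext t
    simp only [Pi.smul_apply, Finset.smul_sum, RingHom.id_apply]
    exact Finset.sum_congr rfl fun s _ => by split_ifs <;> simp

/-- Mod-2 cycles of the link of `σ` on simplices with `j` vertices. -/
def linkCycles [Fintype V] (L : AbstractSimplicialComplex V) (σ : Finset V) :
    (j : ℕ) → Submodule (ZMod 2) (LinkFace L σ j → ZMod 2)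
  | 0 => ⊤
  | j + 1 => LinearMap.ker (linkBoundary L σ j)

/-- The reduced mod-2 homology of the link of `σ` in dimension `j - 1`. -/
abbrev LinkHomology [Fintype V] (L : AbstractSimplicialComplex V) (σ : Finset V) (j : ℕ) : Type _ :=
  linkCycles L σ j ⧸ (LinearMap.range (linkBoundary L σ j)).submoduleOf (linkCycles L σ j)

/-- `L` is a `d`-manifold without boundary, in the weak sense of a mod-2 homology manifold: the link
of every `m`-simplex has the reduced mod-2 homology of a sphere of dimension `d - m - 1`. This holds
for closed combinatorial manifolds, where the links are spheres, and for every triangulation of a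
closed topological manifold. -/
def IsClosedHomologyManifold [Fintype V] (L : AbstractSimplicialComplex V) (d : ℕ) : Prop :=
  ∀ σ ∈ L.faces, ∀ j : ℕ,
    Module.finrank (ZMod 2) (LinkHomology L σ j) = if j + σ.card = d + 1 then 1 else 0

/-! ## The color code -/

/-- `CC_k(L)`: qubits on `d`-simplices; `X`-generators on the stars of `(d-k-2)`-simplices,
`Z`-generators on the stars of `k`-simplices. -/
def colorCode (L : AbstractSimplicialComplex V) (d k : ℕ) : CSSCode (Simplex L d) where
  xGen := {s | ∃ δ : Simplex L (d - k - 2), s = {σ | σ.1 ∈ starOf L d δ.1}}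
  zGen := {s | ∃ δ : Simplex L k, s = {σ | σ.1 ∈ starOf L d δ.1}}

end Simplicial

/-! ## Cell complexes and the toric code -/

/-- A cell complex, described combinatorially by its cells, their dimensions, and the relation
"is a proper face of". -/
structure CellComplex (C : Type*) where
  dim : C → ℕ
  IsFace : C → C → Prop
  face_trans : ∀ a b c, IsFace a b → IsFace b c → IsFace a c
  dim_lt : ∀ a b, IsFace a b → dim a < dim b

namespace CellComplex

/-- The cells of dimension `n`. -/
abbrev CellOfDim {C : Type*} (K : CellComplex C) (n : ℕ) : Type _ := {c : C // K.dim c = n}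

/-- A homogeneous cell `n`-complex: there are `n`-cells, and every other cell is a face of one. -/
def IsHomogeneous {C : Type*} (K : CellComplex C) (n : ℕ) : Prop :=
  (∃ t, K.dim t = n) ∧ ∀ c, K.dim c = n ∨ ∃ t, K.dim t = n ∧ K.IsFace c t

/-- The incidences of a regular cell complex: a 1-cell has two vertices, and exactly two cells lie
between a cell and a face of it of codimension two. -/
def IsRegular {C : Type*} (K : CellComplex C) : Prop :=
  (∀ b, K.dim b = 1 → {c | K.IsFace c b}.ncard = 2) ∧
    ∀ a b, K.IsFace a b → K.dim b = K.dim a + 2 → {c | K.IsFace a c ∧ K.IsFace c b}.ncard = 2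

/-- `TC_k(K)`: qubits on `k`-cells; each `(k+1)`-cell gives the `X`-generator on its `k`-faces,
each `(k-1)`-cell the `Z`-generator on the `k`-cells that have it as a face. -/
def toricCode {C : Type*} (K : CellComplex C) (k : ℕ) : CSSCode (K.CellOfDim k) where
  xGen := {s | ∃ c : C, K.dim c = k + 1 ∧ s = {σ | K.IsFace σ.1 c}}
  zGen := {s | ∃ c : C, K.dim c + 1 = k ∧ s = {σ | K.IsFace c σ.1}}

end CellComplex

/-! ## The complexes `L_N` -/

section Unfolding

variable {V : Type*} {d : ℕ}

/-- The cells of `L_N`: the simplices of the `(k+1)`-skeleton of `L` without vertices of color in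
`N`, and one further cell for each `(d-2-k)`-simplex `τ` of color `N`. -/
abbrev ShrunkCell (L : AbstractSimplicialComplex V) (col : V → Fin (d + 1)) (k : ℕ)
    (N : Finset (Fin (d + 1))) : Type _ :=
  {σ : Finset V // σ ∈ L.faces ∧ σ.card ≤ k + 2 ∧ ∀ v ∈ σ, col v ∉ N} ⊕
    {τ : Simplex L (d - 2 - k) // τ.1.image col = N}

/-- The complex `L_N`; the cell of `τ` has dimension `k + 2` and is attached along the
`(k+1)`-link of `τ`, so that its faces are the simplices of that link and their faces. -/
def shrunk (L : AbstractSimplicialComplex V) (col : V → Fin (d + 1)) (k : ℕ)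
    (N : Finset (Fin (d + 1))) : CellComplex (ShrunkCell L col k N) where
  dim
    | Sum.inl σ => σ.1.card - 1
    | Sum.inr _ => k + 2
  IsFace
    | Sum.inl σ, Sum.inl σ' => σ.1 ⊂ σ'.1
    | Sum.inl σ, Sum.inr τ => ∃ ρ ∈ linkOf L d (k + 1) τ.1.1, σ.1 ⊆ ρ
    | Sum.inr _, _ => False
  face_trans := by
    rintro (a | a) (b | b) (c | c) hab hbc
    · exact hab.trans hbc
    · obtain ⟨ρ, hρ, h⟩ := hbc
      exact ⟨ρ, hρ, hab.subset.trans h⟩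
    all_goals first | exact hab.elim | exact hbc.elim
  dim_lt := by
    rintro (a | a) (b | b) hab
    · have h1 := Finset.card_lt_card hab
      have h2 := (L.isRelLowerSet_faces a.2.1).1.card_pos
      change a.1.card - 1 < b.1.card - 1
      omega
    · have h1 := a.2.2.1
      change a.1.card - 1 < k + 2
      omega
    all_goals exact hab.elim

/-- The sets `N` of `d - 1 - k` colors, the color `d` excluded. -/
abbrev ColorChoice (d k : ℕ) : Type :=
  {N : Finset (Fin (d + 1)) // Fin.last d ∉ N ∧ N.card = d - 1 - k}

/-- The vertices of color `d`. -/
abbrev LastVertex (col : V → Fin (d + 1)) : Type _ := {v : V // col v = Fin.last d}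

/-- The ancilla qubits that `δ` adds to the color code: `|star_{k+1} δ| - |star_d δ|` of them if
this number is positive, none otherwise. -/
abbrev AncillaCC (L : AbstractSimplicialComplex V) (col : V → Fin (d + 1)) (k : ℕ)
    (δ : LastVertex col) : Type :=
  Fin ((starOf L (k + 1) {δ.1}).ncard - (starOf L d {δ.1}).ncard)

/-- The ancilla qubits that `δ` adds to the toric codes: `|star_d δ| - |star_{k+1} δ|` of them if
this number is positive, none otherwise. -/
abbrev AncillaTC (L : AbstractSimplicialComplex V) (col : V → Fin (d + 1)) (k : ℕ)
    (δ : LastVertex col) : Type :=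
  Fin ((starOf L d {δ.1}).ncard - (starOf L (k + 1) {δ.1}).ncard)

/-- All qubits on the color code side. -/
abbrev QubitCC (L : AbstractSimplicialComplex V) (col : V → Fin (d + 1)) (k : ℕ) : Type _ :=
  Simplex L d ⊕ Σ δ : LastVertex col, AncillaCC L col k δ

/-- All qubits on the toric code side. -/
abbrev QubitTC (L : AbstractSimplicialComplex V) (col : V → Fin (d + 1)) (k : ℕ) : Type _ :=
  (Σ N : ColorChoice d k, (shrunk L col k N.1).CellOfDim (k + 1)) ⊕
    Σ δ : LastVertex col, AncillaTC L col k δ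

/-- The qubits on the color code side that belong to `δ`: the `d`-simplices in the star of `δ` and
the ancillas of `δ`. -/
def InBlockCC (L : AbstractSimplicialComplex V) (col : V → Fin (d + 1)) (k : ℕ)
    (δ : LastVertex col) : QubitCC L col k → Prop
  | Sum.inl σ => σ.1 ∈ starOf L d {δ.1}
  | Sum.inr a => a.1 = δ

/-- The qubits on the toric code side that belong to `δ`: the `(k+1)`-simplices in the star of `δ`
and the ancillas of `δ`. -/
def InBlockTC (L : AbstractSimplicialComplex V) (col : V → Fin (d + 1)) (k : ℕ)
    (δ : LastVertex col) : QubitTC L col k → Prop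
  | Sum.inl ⟨_, ⟨Sum.inl σ, _⟩⟩ => σ.1 ∈ starOf L (k + 1) {δ.1}
  | Sum.inl ⟨_, ⟨Sum.inr _, _⟩⟩ => False
  | Sum.inr a => a.1 = δ

/-- The color code `CC_k(L)` together with its ancillas. -/
def colorSide (L : AbstractSimplicialComplex V) (col : V → Fin (d + 1)) (k : ℕ) :
    CSSCode (QubitCC L col k) :=
  (colorCode L d k).tensor (ancillaCode _)

/-- The toric codes `TC_{k+1}(L_N)`, for all `N`, together with the ancillas. -/
def toricSide (L : AbstractSimplicialComplex V) (col : V → Fin (d + 1)) (k : ℕ) :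
    CSSCode (QubitTC L col k) :=
  (CSSCode.tensorFamily fun N : ColorChoice d k => (shrunk L col k N.1).toricCode (k + 1)).tensor
    (ancillaCode _)

instance [Fintype V] (L : AbstractSimplicialComplex V) (col : V → Fin (d + 1)) (k : ℕ) :
    Fintype (QubitCC L col k) := Fintype.ofFinite _

instance [Fintype V] (L : AbstractSimplicialComplex V) (col : V → Fin (d + 1)) (k : ℕ) :
    Fintype (QubitTC L col k) := Fintype.ofFinite _

instance [Fintype V] (L : AbstractSimplicialComplex V) (col : V → Fin (d + 1)) (k : ℕ)
    (δ : LastVertex col) : Fintype {p // InBlockCC L col k δ p} := Fintype.ofFinite _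

instance [Fintype V] (L : AbstractSimplicialComplex V) (col : V → Fin (d + 1)) (k : ℕ)
    (δ : LastVertex col) : Fintype {q // InBlockTC L col k δ q} := Fintype.ofFinite _

end Unfolding

end

end UnfoldingColorCode

namespace UnfoldingColorCode

noncomputable section

open scoped Classical Matrix

/-! ## Pauli operators labelled by vectors over `ZMod 2` -/

section Pauli

variable {P Q R : Type*} [Fintype P] [Fintype Q] [Fintype R]

/-! Up to phases, Pauli operators are pairs of vectors over `ZMod 2`, with commutation read off a
dot product, so the theorem becomes linear algebra plus one topological input. Both registers are
cut into blocks, one for each vertex δ of color d: every d-simplex contains exactly one such vertex,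
and so does every simplex carrying a toric qubit. A generator attached to a simplex that has a
vertex of color d lives in a single block and is called local here. The nonlocal generators are
indexed on both sides by the same simplices without color d: simplices τ with d-1-k vertices for X
(on the toric side τ is a (k+2)-cell of the complex of its own color set), and simplices ρ with k+1
vertices for Z.

Inside the block of δ, the restrictions of the X-generator of τ and of the Z-generator of ρ
anticommute exactly when τ ∪ ρ ∪ {δ} is a d-simplex. On the color code side
(`sum_blockCC_incl_mul_incl`) this is the parity of the number of d-simplices containing a given
set, which `card_facetsOver` computes; on the toric side (`sum_blockTC_joinVec_mul_incl`) a single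
qubit contributes. The blocks also have the same size, by the choice of the ancillas. Two registers
of equal size carrying operators with the same commutation relations are related by a Clifford
unitary, up to the operators of the block that commute with all of them: both are brought to a
common form in which these local operators are the Z on some of the qubits (`exists_standard_form`,
`exists_block_unitary`). The product of the block unitaries then matches the two groups
(`exists_tensor_unitary`), provided every operator of X type or of Z type commuting blockwise with
the nonlocal generators is itself a stabilizer.

That proviso is where the manifold hypothesis enters. The subcomplex of a link spanned by a set of
colors is acyclic below its top dimension (`exists_bd_eq`), and its top cycles are sums of links of
simplices with the complementary colors (`exists_link_combination`). Dually, a top cochain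
orthogonal to those links is a coboundary (`exists_coboundary`), which is the completeness of the
local Z-stabilizers of the toric codes. Applied repeatedly, it shows that a function on the
d-simplices at δ orthogonal to the stars of one size is a sum of stars of the complementary size
(`exists_star_combination`), which is the completeness for the color code in both types. No signs
are lost, because the Clifford unitary of a block sends each generator to a product X(a)Z(b) with
coefficient exactly 1. -/

/-- A basis state read as a vector over `ZMod 2`. -/
def toVec {Q : Type*} : Config Q ≃ (Q → ZMod 2) := Equiv.refl _

/-- The sign `(-1) ^ a`. -/
def sgn (a : ZMod 2) : ℂ := if a = 0 then 1 else -1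

@[simp] theorem sgn_zero : sgn 0 = 1 := by simp [sgn]

theorem zmod_two_cases (a : ZMod 2) : a = 0 ∨ a = 1 := by
  revert a
  decide

theorem sgn_one : sgn 1 = -1 := by simp [sgn]

theorem sgn_add (a b : ZMod 2) : sgn (a + b) = sgn a * sgn b := by
  rcases zmod_two_cases a with rfl | rfl <;> rcases zmod_two_cases b with rfl | rfl <;>
    simp [sgn_one, show (1 : ZMod 2) + 1 = 0 from rfl]

theorem sgn_sum {ι : Type*} (s : Finset ι) (f : ι → ZMod 2) :
    sgn (∑ i ∈ s, f i) = ∏ i ∈ s, sgn (f i) := by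
  induction s using Finset.induction_on with
  | empty => simp
  | insert a s ha ih => rw [Finset.sum_insert ha, Finset.prod_insert ha, sgn_add, ih]

theorem sgn_mul_self (a : ZMod 2) : sgn a * sgn a = 1 := by
  rcases zmod_two_cases a with rfl | rfl <;> simp [sgn_one]

theorem sgn_pow_four (a : ZMod 2) : sgn a ^ 4 = 1 := by
  rw [show 4 = 2 * 2 from rfl, pow_mul, pow_two (sgn a), sgn_mul_self, one_pow]

/-- The indicator vector of a set of qubits. -/
def ind (s : Set Q) : Q → ZMod 2 := fun q => if q ∈ s then 1 else 0

/-- The Pauli operator `X(a) Z(b)`. -/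
def opW (a b : Q → ZMod 2) : Matrix.unitaryGroup (Config Q) ℂ :=
  opX {q | a q ≠ 0} * opZ {q | b q ≠ 0}

/-- `opW a b` as a matrix. -/
abbrev matW (a b : Q → ZMod 2) : Matrix (Config Q) (Config Q) ℂ := (opW a b).1

theorem pauli_entry (a b : ZMod 2) (y x : Fin 2) :
    ((if a ≠ 0 then (pauliX : Matrix.unitaryGroup (Fin 2) ℂ) else 1).1 *
      (if b ≠ 0 then (pauliZ : Matrix.unitaryGroup (Fin 2) ℂ) else 1).1) y x =
      if (show ZMod 2 from y) = (show ZMod 2 from x) + a then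
        sgn (b * (show ZMod 2 from x)) else 0 := by
  rcases zmod_two_cases a with rfl | rfl <;> rcases zmod_two_cases b with rfl | rfl <;>
    fin_cases y <;> fin_cases x <;>
    simp [pauliX, pauliZ, sgn, Matrix.mul_apply] <;>
    first
      | rfl
      | exact fun h => absurd h zero_ne_one
      | exact fun h => absurd h one_ne_zero

/-- Z acts first: the basis state x goes to x + a with the sign of b · x. All later operator
identities are checked on these entries. -/
theorem matW_apply (a b : Q → ZMod 2) (y x : Config Q) :
    matW a b y x = if toVec y = toVec x + a then sgn (b ⬝ᵥ toVec x) else 0 := by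
  have h : matW a b = tensorOp fun q =>
      (if a q ≠ 0 then (pauliX : Matrix.unitaryGroup (Fin 2) ℂ) else 1).1 *
      (if b q ≠ 0 then (pauliZ : Matrix.unitaryGroup (Fin 2) ℂ) else 1).1 := by
    change tensorOp _ * tensorOp _ = _
    rw [tensorOp_mul]
    congr! 4
    · exact ite_cond_congr (by simp)
    · exact ite_cond_congr (by simp)
  rw [h]
  simp only [tensorOp, Matrix.of_apply, pauli_entry]
  by_cases hxy : toVec y = toVec x + a
  · rw [if_pos hxy, dotProduct, sgn_sum]
    refine Finset.prod_congr rfl fun q _ => ?_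
    rw [if_pos]
    · rfl
    · exact congrFun hxy q
  · rw [if_neg hxy]
    obtain ⟨q, hq⟩ := Function.ne_iff.mp hxy
    exact Finset.prod_eq_zero (Finset.mem_univ q) (if_neg hq)

theorem add_self_vec {Q : Type*} (a : Q → ZMod 2) : a + a = 0 :=
  funext fun q => CharTwo.add_self_eq_zero (a q)

theorem eq_add_iff_vec {Q : Type*} (y x a : Q → ZMod 2) : y = x + a ↔ x = y + a := by
  constructor <;> rintro rfl <;> rw [add_assoc, add_self_vec, add_zero]

theorem mul_matW_apply {Q : Type*} (U : Matrix (Config Q) (Config P) ℂ) (a b : P → ZMod 2)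
    (y : Config Q) (x : Config P) :
    (U * matW a b) y x = sgn (b ⬝ᵥ toVec x) * U y (toVec.symm (toVec x + a)) := by
  rw [Matrix.mul_apply, Finset.sum_eq_single (toVec.symm (toVec x + a))]
  · rw [matW_apply]; simp [mul_comm]
  · intro z _ hz
    rw [matW_apply, if_neg, mul_zero]
    rintro h
    exact hz (by rw [← h]; simp)
  · simp

theorem matW_mul_apply {P : Type*} (U : Matrix (Config Q) (Config P) ℂ) (a b : Q → ZMod 2)
    (y : Config Q) (x : Config P) :
    (matW a b * U) y x =
      sgn (b ⬝ᵥ (toVec y + a)) * U (toVec.symm (toVec y + a)) x := by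
  rw [Matrix.mul_apply, Finset.sum_eq_single (toVec.symm (toVec y + a))]
  · rw [matW_apply]; simp [add_assoc, add_self_vec]
  · intro z _ hz
    rw [matW_apply, if_neg, zero_mul]
    intro h
    rw [eq_add_iff_vec] at h
    exact hz (by rw [← h]; simp)
  · simp

/-- The only sign comes from moving Z(b) past X(a'). It disappears for products of pure X type or
pure Z type, and for X(a) followed on the right by a Z. -/
theorem matW_mul_matW (a b a' b' : Q → ZMod 2) :
    matW a b * matW a' b' = sgn (b ⬝ᵥ a') • matW (a + a') (b + b') := by
  ext y x
  rw [mul_matW_apply, Matrix.smul_apply, matW_apply, matW_apply]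
  simp only [Equiv.apply_symm_apply, smul_eq_mul, add_assoc, add_comm a' a]
  split_ifs
  · rw [dotProduct_add, add_dotProduct, sgn_add, sgn_add]; ring
  · simp

theorem matW_zero : matW (0 : Q → ZMod 2) 0 = 1 := by
  ext y x
  rw [matW_apply]
  simp [Matrix.one_apply]

theorem matW_split (a b : Q → ZMod 2) : matW a b = matW a 0 * matW 0 b := by
  rw [matW_mul_matW]; simp

theorem matW_zero_mul (b b' : Q → ZMod 2) : matW 0 b * matW 0 b' = matW 0 (b + b') := by
  rw [matW_mul_matW]; simp

theorem matW_mul_zero (a a' : Q → ZMod 2) : matW a 0 * matW a' 0 = matW (a + a') 0 := by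
  rw [matW_mul_matW]; simp

theorem matW_mul_right (a b b' : Q → ZMod 2) : matW a b * matW 0 b' = matW a (b + b') := by
  rw [matW_mul_matW]; simp

theorem opX_eq_opW (s : Set Q) : opX s = opW (ind s) 0 := by
  have h1 : {q | (ind s) q ≠ 0} = s := by ext q; simp [ind]
  have h2 : opZ {q : Q | (0 : Q → ZMod 2) q ≠ 0} = 1 := by
    apply Subtype.ext
    change tensorOp _ = 1
    simp [tensorOp_one]
  rw [opW, h1, h2, mul_one]

theorem opZ_eq_opW (s : Set Q) : opZ s = opW 0 (ind s) := by
  have h1 : {q | (ind s) q ≠ 0} = s := by ext q; simp [ind]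
  have h2 : opX {q : Q | (0 : Q → ZMod 2) q ≠ 0} = 1 := by
    apply Subtype.ext
    change tensorOp _ = 1
    simp [tensorOp_one]
  rw [opW, h1, h2, one_mul]

theorem opW_add_left (a a' : Q → ZMod 2) : opW (a + a') 0 = opW a 0 * opW a' 0 :=
  Subtype.ext (matW_mul_zero a a').symm

theorem opW_add_right (b b' : Q → ZMod 2) : opW 0 (b + b') = opW 0 b * opW 0 b' :=
  Subtype.ext (matW_zero_mul b b').symm

theorem opW_split (a b : Q → ZMod 2) : opW a b = opW a 0 * opW 0 b :=
  Subtype.ext (matW_split a b)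

theorem opW_zero : opW (0 : Q → ZMod 2) 0 = 1 := Subtype.ext matW_zero

/-! ### Spans and stabilizer groups -/

/-- On vectors of pure X type the labelling is a homomorphism, so linear combinations over `ZMod 2`
become products of generators with no phase to track. -/
theorem opW_left_mem_of_mem_span (H : Subgroup (Matrix.unitaryGroup (Config Q) ℂ))
    (S : Set (Q → ZMod 2)) (hS : ∀ a ∈ S, opW a 0 ∈ H) {a : Q → ZMod 2}
    (ha : a ∈ Submodule.span (ZMod 2) S) : opW a 0 ∈ H := by
  induction ha using Submodule.span_induction with
  | mem x hx => exact hS x hx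
  | zero => rw [opW_zero]; exact H.one_mem
  | add x y _ _ hx hy => rw [opW_add_left]; exact H.mul_mem hx hy
  | smul c x _ hx =>
    rcases zmod_two_cases c with rfl | rfl
    · rw [zero_smul, opW_zero]; exact H.one_mem
    · rwa [one_smul]

theorem opW_right_mem_of_mem_span (H : Subgroup (Matrix.unitaryGroup (Config Q) ℂ))
    (S : Set (Q → ZMod 2)) (hS : ∀ a ∈ S, opW 0 a ∈ H) {a : Q → ZMod 2}
    (ha : a ∈ Submodule.span (ZMod 2) S) : opW 0 a ∈ H := by
  induction ha using Submodule.span_induction with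
  | mem x hx => exact hS x hx
  | zero => rw [opW_zero]; exact H.one_mem
  | add x y _ _ hx hy => rw [opW_add_right]; exact H.mul_mem hx hy
  | smul c x _ hx =>
    rcases zmod_two_cases c with rfl | rfl
    · rw [zero_smul, opW_zero]; exact H.one_mem
    · rwa [one_smul]

theorem mem_span_ind_singleton (a : Q → ZMod 2) :
    a ∈ Submodule.span (ZMod 2) {v | ∃ q : Q, v = ind {q}} := by
  have h : a = ∑ q, a q • ind {q} := by
    funext q
    simp [ind, Finset.sum_apply]
  rw [h]
  exact Submodule.sum_mem _ fun q _ => Submodule.smul_mem _ _ (Submodule.subset_span ⟨q, rfl⟩)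

theorem phase_cases {c : ℂ} (hc : c ^ 4 = 1) : ∃ n : ℕ, c = Complex.I ^ n := by
  have h : (c - 1) * (c + 1) * ((c - Complex.I) * (c + Complex.I)) = 0 := by
    linear_combination hc + (1 - c ^ 2) * Complex.I_sq
  rcases mul_eq_zero.mp h with h | h <;> rcases mul_eq_zero.mp h with h | h
  · exact ⟨0, by rw [pow_zero]; linear_combination h⟩
  · exact ⟨2, by rw [Complex.I_sq]; linear_combination h⟩
  · exact ⟨1, by rw [pow_one]; linear_combination h⟩
  · exact ⟨3, by rw [Complex.I_pow_three]; linear_combination h⟩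

/-- Fourth roots of unity are the phases of the Pauli group; this lets Clifford properties be proved
up to such a phase. -/
theorem phase_mem_pauliGroup {c : ℂ} (hc : c ^ 4 = 1) :
    ∃ g ∈ pauliGroup Q, (g : Matrix (Config Q) (Config Q) ℂ) = c • 1 := by
  have hJ : (Complex.I • (1 : Matrix (Config Q) (Config Q) ℂ)) ∈
      Matrix.unitaryGroup (Config Q) ℂ := by
    rw [Matrix.mem_unitaryGroup_iff]
    simp [star_smul, smul_smul]
  obtain ⟨n, rfl⟩ := phase_cases hc
  refine ⟨(⟨_, hJ⟩ : Matrix.unitaryGroup (Config Q) ℂ) ^ n,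
    Subgroup.pow_mem (pauliGroup Q) (Subgroup.subset_closure (Or.inr ?_)) n, ?_⟩
  · rfl
  rw [SubmonoidClass.coe_pow, smul_pow, one_pow]

theorem opW_mem_pauliGroup (a b : Q → ZMod 2) : opW a b ∈ pauliGroup Q := by
  rw [opW_split]
  refine Subgroup.mul_mem _
    (opW_left_mem_of_mem_span _ _ ?_ (mem_span_ind_singleton a))
    (opW_right_mem_of_mem_span _ _ ?_ (mem_span_ind_singleton b))
  · rintro _ ⟨q, rfl⟩
    rw [← opX_eq_opW]
    exact Subgroup.subset_closure (Or.inl (Or.inl ⟨q, rfl⟩))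
  · rintro _ ⟨q, rfl⟩
    rw [← opZ_eq_opW]
    exact Subgroup.subset_closure (Or.inl (Or.inr ⟨q, rfl⟩))

/-! ### Conjugation by unitaries -/

/-- The relation U g = h U is compatible with products and inverses, so it need only be solved for
generators. -/
theorem exists_mul_eq_of_mem_closure (U : Matrix (Config Q) (Config P) ℂ)
    (S : Set (Matrix.unitaryGroup (Config P) ℂ)) (H : Subgroup (Matrix.unitaryGroup (Config Q) ℂ))
    (h : ∀ g ∈ S, ∃ h ∈ H, U * g.1 = h.1 * U) {g : Matrix.unitaryGroup (Config P) ℂ}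
    (hg : g ∈ Subgroup.closure S) : ∃ h ∈ H, U * g.1 = h.1 * U := by
  induction hg using Subgroup.closure_induction with
  | mem x hx => exact h x hx
  | one => exact ⟨1, H.one_mem, by simp⟩
  | mul x y _ _ hx hy =>
    obtain ⟨a, ha, hxa⟩ := hx
    obtain ⟨b, hb, hyb⟩ := hy
    refine ⟨a * b, H.mul_mem ha hb, ?_⟩
    change U * (x.1 * y.1) = (a.1 * b.1) * U
    rw [← Matrix.mul_assoc, hxa, Matrix.mul_assoc, hyb, Matrix.mul_assoc]
  | inv x _ hx =>
    obtain ⟨a, ha, hxa⟩ := hx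
    refine ⟨a⁻¹, H.inv_mem ha, ?_⟩
    have h1 : (a⁻¹).1 * a.1 = 1 := congrArg Subtype.val (inv_mul_cancel a)
    have h2 : x.1 * (x⁻¹).1 = 1 := congrArg Subtype.val (mul_inv_cancel x)
    calc U * (x⁻¹).1 = (a⁻¹).1 * (a.1 * U) * (x⁻¹).1 := by
          rw [← Matrix.mul_assoc, h1, Matrix.one_mul]
      _ = (a⁻¹).1 * U := by
          rw [← hxa, Matrix.mul_assoc, Matrix.mul_assoc, h2, Matrix.mul_one]

theorem IsUnitary.conjTranspose {U : Matrix (Config Q) (Config P) ℂ} (hU : IsUnitary U) :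
    IsUnitary Uᴴ := by
  refine ⟨?_, ?_⟩
  · rw [Matrix.conjTranspose_conjTranspose]; exact hU.2
  · rw [Matrix.conjTranspose_conjTranspose]; exact hU.1

theorem IsUnitary.mul {U : Matrix (Config Q) (Config P) ℂ} {U' : Matrix (Config R) (Config Q) ℂ}
    (hU : IsUnitary U) (hU' : IsUnitary U') : IsUnitary (U' * U) := by
  refine ⟨?_, ?_⟩
  · rw [Matrix.conjTranspose_mul, Matrix.mul_assoc, ← Matrix.mul_assoc U'ᴴ, hU'.1, Matrix.one_mul,
      hU.1]
  · rw [Matrix.conjTranspose_mul, Matrix.mul_assoc, ← Matrix.mul_assoc U, hU.2, Matrix.one_mul,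
      hU'.2]

theorem IsUnitary.mul_eq_iff {U : Matrix (Config Q) (Config P) ℂ} (hU : IsUnitary U)
    (A : Matrix (Config P) (Config P) ℂ) (B : Matrix (Config Q) (Config Q) ℂ) :
    U * A = B * U ↔ Uᴴ * B = A * Uᴴ := by
  constructor
  · intro h
    calc Uᴴ * B = Uᴴ * (B * U) * Uᴴ := by
          rw [Matrix.mul_assoc, Matrix.mul_assoc, hU.2, Matrix.mul_one]
      _ = A * Uᴴ := by rw [← h, ← Matrix.mul_assoc, hU.1, Matrix.one_mul]
  · intro h
    calc U * A = U * (A * Uᴴ) * U := by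
          rw [Matrix.mul_assoc, Matrix.mul_assoc, hU.1, Matrix.mul_one]
      _ = B * U := by rw [← h, ← Matrix.mul_assoc, hU.2, Matrix.one_mul]

/-- Each inclusion is checked on generators. The reverse one is the same argument for the adjoint,
after turning U g = h U into a relation for it. -/
theorem conjEq_closure (U : Matrix (Config Q) (Config P) ℂ) (hU : IsUnitary U)
    (S : Set (Matrix.unitaryGroup (Config P) ℂ)) (T : Set (Matrix.unitaryGroup (Config Q) ℂ))
    (hST : ∀ g ∈ S, ∃ h ∈ Subgroup.closure T, U * g.1 = h.1 * U)
    (hTS : ∀ h ∈ T, ∃ g ∈ Subgroup.closure S, U * g.1 = h.1 * U) :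
    ConjEq U (Subgroup.closure S) (Subgroup.closure T) := by
  ext B
  constructor
  · rintro ⟨g, hg, rfl⟩
    obtain ⟨h, hh, e⟩ := exists_mul_eq_of_mem_closure U S _ hST hg
    exact ⟨h, hh, by rw [e, Matrix.mul_assoc, hU.2, Matrix.mul_one]⟩
  · rintro ⟨h, hh, rfl⟩
    obtain ⟨g, hg, e⟩ := exists_mul_eq_of_mem_closure Uᴴ T (Subgroup.closure S)
      (fun h hh => by
        obtain ⟨g, hg, e⟩ := hTS h hh
        exact ⟨g, hg, (hU.mul_eq_iff _ _).mp e⟩) hh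
    refine ⟨g, hg, ?_⟩
    rw [(hU.mul_eq_iff _ _).mpr e, Matrix.mul_assoc, hU.2, Matrix.mul_one]

/-- `U` carries every Pauli operator to a Pauli operator, up to a phase. -/
def PauliCovariant (U : Matrix (Config Q) (Config P) ℂ) : Prop :=
  ∀ a b : P → ZMod 2, ∃ (c : ℂ) (e f : Q → ZMod 2), c ^ 4 = 1 ∧
    U * matW a b = c • (matW e f * U)

/-- A unitary that, together with its inverse, carries Pauli operators to Pauli operators. -/
structure IsPauliUnitary (U : Matrix (Config Q) (Config P) ℂ) : Prop where
  unitary : IsUnitary U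
  fwd : PauliCovariant U
  bwd : PauliCovariant Uᴴ

theorem PauliCovariant.mul {U : Matrix (Config Q) (Config P) ℂ}
    {U' : Matrix (Config R) (Config Q) ℂ} (hU : PauliCovariant U) (hU' : PauliCovariant U') :
    PauliCovariant (U' * U) := by
  intro a b
  obtain ⟨c, a', b', hc, e⟩ := hU a b
  obtain ⟨c', a'', b'', hc', e'⟩ := hU' a' b'
  refine ⟨c * c', a'', b'', by rw [mul_pow, hc, hc', one_mul], ?_⟩
  rw [Matrix.mul_assoc, e, Matrix.mul_smul, ← Matrix.mul_assoc, e', Matrix.smul_mul, smul_smul,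
    Matrix.mul_assoc]

theorem IsPauliUnitary.mul {U : Matrix (Config Q) (Config P) ℂ}
    {U' : Matrix (Config R) (Config Q) ℂ} (hU : IsPauliUnitary U) (hU' : IsPauliUnitary U') :
    IsPauliUnitary (U' * U) :=
  ⟨hU.unitary.mul hU'.unitary, hU.fwd.mul hU'.fwd, by
    rw [Matrix.conjTranspose_mul]; exact hU'.bwd.mul hU.bwd⟩

theorem IsPauliUnitary.conjTranspose {U : Matrix (Config Q) (Config P) ℂ}
    (hU : IsPauliUnitary U) : IsPauliUnitary Uᴴ :=
  ⟨hU.unitary.conjTranspose, hU.bwd, by rw [Matrix.conjTranspose_conjTranspose]; exact hU.fwd⟩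

theorem PauliCovariant.exists_mem {U : Matrix (Config Q) (Config P) ℂ} (hU : PauliCovariant U)
    {g : Matrix.unitaryGroup (Config P) ℂ}
    (hg : g ∈ ({g | ∃ q, g = opX {q}} ∪ {g | ∃ q, g = opZ {q}} ∪
      {g | (g : Matrix (Config P) (Config P) ℂ) = Complex.I • (1 : Matrix _ _ ℂ)} :
        Set (Matrix.unitaryGroup (Config P) ℂ))) :
    ∃ h ∈ pauliGroup Q, U * g.1 = h.1 * U := by
  have key : ∀ a b : P → ZMod 2, ∃ h ∈ pauliGroup Q, U * matW a b = h.1 * U := by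
    intro a b
    obtain ⟨c, a', b', hc, e⟩ := hU a b
    obtain ⟨g, hg, eg⟩ := phase_mem_pauliGroup (Q := Q) hc
    refine ⟨g * opW a' b', Subgroup.mul_mem _ hg (opW_mem_pauliGroup a' b'), ?_⟩
    change _ = (g.1 * matW a' b') * U
    rw [e, eg, Matrix.smul_mul, Matrix.one_mul, Matrix.smul_mul]
  rcases hg with (⟨q, rfl⟩ | ⟨q, rfl⟩) | hg
  · rw [opX_eq_opW]; exact key _ _
  · rw [opZ_eq_opW]; exact key _ _
  · obtain ⟨h, hh, eh⟩ := phase_mem_pauliGroup (Q := Q) (c := Complex.I) (by simp)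
    refine ⟨h, hh, ?_⟩
    rw [show g.1 = Complex.I • 1 from hg, eh, Matrix.mul_smul, Matrix.smul_mul, Matrix.mul_one,
      Matrix.one_mul]

theorem IsPauliUnitary.isClifford {U : Matrix (Config Q) (Config P) ℂ} (hU : IsPauliUnitary U) :
    IsClifford U := by
  refine ⟨hU.unitary, conjEq_closure U hU.unitary _ _ (fun g hg => hU.fwd.exists_mem hg) ?_⟩
  intro h hh
  obtain ⟨g, hg, e⟩ := hU.bwd.exists_mem hh
  exact ⟨g, hg, (hU.unitary.mul_eq_iff _ _).mpr e⟩

end Pauli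

/-! ## Linear permutations of the basis states and Hadamard gates -/

section Gates

variable {P Q : Type*} [Fintype P] [Fintype Q]

/-- The unitary `|x⟩ ↦ |M x⟩`. -/
def permMat {P Q : Type*} (M : (P → ZMod 2) ≃ₗ[ZMod 2] (Q → ZMod 2)) :
    Matrix (Config Q) (Config P) ℂ :=
  Matrix.of fun y x => if toVec y = M (toVec x) then 1 else 0

/-- The vector representing `b` after the change of coordinates `M`. -/
def dualVec {P Q : Type*} [Fintype P] (M : (P → ZMod 2) ≃ₗ[ZMod 2] (Q → ZMod 2)) (b : P → ZMod 2) :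
    Q → ZMod 2 :=
  fun q => b ⬝ᵥ M.symm (Pi.single q 1)

/-- Z-labels transform by the inverse transpose of the map acting on X-labels, which is what keeps
dot products, hence commutation relations, unchanged. -/
theorem dualVec_dotProduct (M : (P → ZMod 2) ≃ₗ[ZMod 2] (Q → ZMod 2)) (b : P → ZMod 2)
    (y : Q → ZMod 2) : dualVec M b ⬝ᵥ y = b ⬝ᵥ M.symm y := by
  conv_rhs => rw [← Finset.univ_sum_single y]
  rw [map_sum, dotProduct_sum, dotProduct]
  refine Finset.sum_congr rfl fun q _ => ?_
  have h : (Pi.single q (y q) : Q → ZMod 2) = y q • Pi.single q 1 := by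
    rw [← Pi.single_smul]; simp
  rw [h, map_smul, dotProduct_smul, smul_eq_mul, mul_comm, dualVec]

theorem permMat_mul_matW (M : (P → ZMod 2) ≃ₗ[ZMod 2] (Q → ZMod 2)) (a b : P → ZMod 2) :
    permMat M * matW a b = matW (M a) (dualVec M b) * permMat M := by
  ext y x
  rw [mul_matW_apply, matW_mul_apply]
  simp only [permMat, Matrix.of_apply, Equiv.apply_symm_apply, map_add]
  have h : toVec y = M (toVec x) + M a ↔ toVec y + M a = M (toVec x) := by
    rw [eq_add_iff_vec, eq_comm]
  by_cases h' : toVec y + M a = M (toVec x)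
  · rw [if_pos h', if_pos (h.mpr h'), h', dualVec_dotProduct, LinearEquiv.symm_apply_apply]
  · rw [if_neg h', if_neg (fun e => h' (h.mp e)), mul_zero, mul_zero]

theorem permMat_conjTranspose {P Q : Type*} (M : (P → ZMod 2) ≃ₗ[ZMod 2] (Q → ZMod 2)) :
    (permMat M)ᴴ = permMat M.symm := by
  ext x y
  simp only [permMat, Matrix.conjTranspose_apply, Matrix.of_apply]
  have h : toVec y = M (toVec x) ↔ toVec x = M.symm (toVec y) := by
    rw [LinearEquiv.eq_symm_apply, eq_comm]
  simp only [h]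
  split_ifs <;> simp

theorem permMat_symm_mul (M : (P → ZMod 2) ≃ₗ[ZMod 2] (Q → ZMod 2)) :
    permMat M.symm * permMat M = 1 := by
  ext x' x
  rw [Matrix.mul_apply, Finset.sum_eq_single (toVec.symm (M (toVec x)))]
  · simp [permMat, Matrix.one_apply]
  · intro z _ hz
    simp only [permMat, Matrix.of_apply]
    rw [if_neg (fun e => hz ?_) (c := toVec z = M (toVec x)), mul_zero]
    rw [← e]; simp
  · simp

theorem permMat_isPauliUnitary (M : (P → ZMod 2) ≃ₗ[ZMod 2] (Q → ZMod 2)) :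
    IsPauliUnitary (permMat M) := by
  refine ⟨⟨?_, ?_⟩, ?_, ?_⟩
  · rw [permMat_conjTranspose, permMat_symm_mul]
  · rw [permMat_conjTranspose]
    exact permMat_symm_mul M.symm
  · exact fun a b => ⟨1, _, _, one_pow 4, by rw [one_smul]; exact permMat_mul_matW M a b⟩
  · rw [permMat_conjTranspose]
    exact fun a b => ⟨1, _, _, one_pow 4, by rw [one_smul]; exact permMat_mul_matW M.symm a b⟩

/-- The one-qubit Hadamard gate. -/
def hadamard : Matrix (Fin 2) (Fin 2) ℂ :=
  Matrix.of fun y x => ((Real.sqrt 2)⁻¹ : ℂ) *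
    sgn ((show ZMod 2 from y) * (show ZMod 2 from x))

theorem hadamard_star : star hadamard = hadamard := by
  ext y x
  have h : ∀ a : ZMod 2, (starRingEnd ℂ) (sgn a) = sgn a := fun a => by
    rcases zmod_two_cases a with rfl | rfl <;> simp [sgn_one]
  simp only [hadamard, Matrix.star_apply, Matrix.of_apply, star_mul', RCLike.star_def, h,
    map_inv₀, Complex.conj_ofReal]
  exact congrArg (fun t => _ * sgn t) (mul_comm (show ZMod 2 from x) (show ZMod 2 from y))

theorem hadamard_mul_self : hadamard * hadamard = 1 := by
  have h2 : ((Real.sqrt 2 : ℝ) : ℂ)⁻¹ * ((Real.sqrt 2 : ℝ) : ℂ)⁻¹ = 1 / 2 := by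
    rw [← mul_inv, ← Complex.ofReal_mul, Real.mul_self_sqrt (by norm_num)]
    norm_num
  have e0 : ∀ y x : Fin 2, hadamard y x = ((Real.sqrt 2)⁻¹ : ℂ) *
    sgn ((show ZMod 2 from y) * (show ZMod 2 from x)) := fun _ _ => rfl
  have s00 : sgn ((show ZMod 2 from (0 : Fin 2)) * (show ZMod 2 from (0 : Fin 2))) = 1 := sgn_zero
  have s01 : sgn ((show ZMod 2 from (0 : Fin 2)) * (show ZMod 2 from (1 : Fin 2))) = 1 := sgn_zero
  have s10 : sgn ((show ZMod 2 from (1 : Fin 2)) * (show ZMod 2 from (0 : Fin 2))) = 1 := sgn_zero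
  have s11 : sgn ((show ZMod 2 from (1 : Fin 2)) * (show ZMod 2 from (1 : Fin 2))) = -1 := sgn_one
  ext y x
  rw [Matrix.mul_apply, Fin.sum_univ_two]
  fin_cases y <;> fin_cases x <;>
    simp only [e0, s00, s01, s10, s11, Fin.zero_eta, Fin.mk_one, Fin.isValue, mul_one, mul_neg,
      neg_mul, h2, Matrix.one_apply] <;> norm_num

/-- Hadamard gates on the qubits in `h`. -/
def hadMat (h : Set Q) : Matrix (Config Q) (Config Q) ℂ :=
  tensorOp fun q => if q ∈ h then hadamard else 1

theorem hadMat_conjTranspose (h : Set Q) : (hadMat h)ᴴ = hadMat h := by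
  have e := tensorOp_star fun q => if q ∈ h then hadamard else 1
  rw [← Matrix.star_eq_conjTranspose, hadMat, e]
  congr 1
  funext q
  split_ifs
  · exact hadamard_star
  · exact star_one _

theorem hadMat_mul_self (h : Set Q) : hadMat h * hadMat h = 1 := by
  rw [hadMat, tensorOp_mul, ← tensorOp_one]
  congr 1
  funext q
  split_ifs
  · exact hadamard_mul_self
  · exact mul_one _

/-- X- and Z-labels are exchanged on h; the sign counts the qubits of h carrying both, since there
XZ becomes ZX = -XZ. -/
theorem hadMat_mul_matW (h : Set Q) (a b : Q → ZMod 2) :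
    hadMat h * matW a b = sgn (∑ q, if q ∈ h then a q * b q else 0) •
      (matW (fun q => if q ∈ h then b q else a q) (fun q => if q ∈ h then a q else b q) *
        hadMat h) := by
  -- Equality of the sign exponents of the two sides on one qubit of h; the remaining factor of the
  -- Hadamard entry is common.
  have key : ∀ a b x y : ZMod 2, b * x + y * (x + a) = a * b + (a * (y + b) + (y + b) * x) := by
    decide
  ext y x
  rw [Matrix.smul_apply, mul_matW_apply, matW_mul_apply, smul_eq_mul, dotProduct, dotProduct,
    sgn_sum, sgn_sum, sgn_sum, hadMat, tensorOp, Matrix.of_apply, Matrix.of_apply,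
    ← Finset.prod_mul_distrib, ← Finset.prod_mul_distrib, ← Finset.prod_mul_distrib]
  refine Finset.prod_congr rfl fun q _ => ?_
  change sgn (b q * toVec x q) * (if q ∈ h then hadamard else 1) (toVec y q) (toVec x q + a q) = _
  change _ = sgn _ * (sgn ((if q ∈ h then a q else b q) *
    (toVec y q + if q ∈ h then b q else a q)) * (if q ∈ h then hadamard else 1)
      (toVec y q + if q ∈ h then b q else a q) (toVec x q))
  generalize toVec x q = x
  generalize toVec y q = y
  by_cases hq : q ∈ h
  · simp only [if_pos hq]
    change sgn (b q * x) * (_ * sgn (y * (x + a q))) =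
      sgn (a q * b q) * (sgn (a q * (y + b q)) * (_ * sgn ((y + b q) * x)))
    rw [mul_left_comm, ← sgn_add, key, sgn_add, sgn_add]
    ring
  · simp only [if_neg hq, sgn_zero, one_mul]
    change sgn (b q * x) * (if y = x + a q then 1 else 0) =
      sgn (b q * (y + a q)) * (if y + a q = x then 1 else 0)
    have e : ∀ y x a : ZMod 2, y = x + a ↔ y + a = x := by decide
    by_cases hy : y + a q = x
    · rw [if_pos hy, if_pos ((e _ _ _).mpr hy), hy]
    · rw [if_neg hy, if_neg (fun h => hy ((e _ _ _).mp h)), mul_zero, mul_zero]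

theorem hadMat_isPauliUnitary (h : Set Q) : IsPauliUnitary (hadMat h) := by
  have c : PauliCovariant (hadMat h) := fun a b =>
    ⟨_, _, _, sgn_pow_four _, hadMat_mul_matW h a b⟩
  refine ⟨⟨?_, ?_⟩, c, ?_⟩
  · rw [hadMat_conjTranspose, hadMat_mul_self]
  · rw [hadMat_conjTranspose, hadMat_mul_self]
  · rw [hadMat_conjTranspose]; exact c

end Gates

/-! ## Standard forms -/

section StandardForm

/-- A register of `l` main qubits and `r` further qubits. -/
inductive Reg (l r : ℕ) : Type
  | main (i : Fin l)
  | anc (j : Fin r)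

/-- The qubits of `Reg l r` as a disjoint union. -/
def Reg.equiv (l r : ℕ) : Fin l ⊕ Fin r ≃ Reg l r where
  toFun := Sum.elim Reg.main Reg.anc
  invFun
    | Reg.main i => Sum.inl i
    | Reg.anc j => Sum.inr j
  left_inv := by rintro (i | j) <;> rfl
  right_inv := by rintro (i | j) <;> rfl

instance (l r : ℕ) : Fintype (Reg l r) := Fintype.ofEquiv _ (Reg.equiv l r)

theorem Reg.card (l r : ℕ) : Fintype.card (Reg l r) = l + r := by
  rw [← Fintype.card_congr (Reg.equiv l r)]; simp

/-- A vector on `Reg l r` given by its two parts. -/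
def Reg.vec {l r : ℕ} (a : Fin l → ZMod 2) (w : Fin r → ZMod 2) : Reg l r → ZMod 2
  | Reg.main i => a i
  | Reg.anc j => w j

@[simp] theorem Reg.vec_main {l r : ℕ} (a : Fin l → ZMod 2) (w : Fin r → ZMod 2) (i : Fin l) :
    Reg.vec a w (Reg.main i) = a i := rfl

@[simp] theorem Reg.vec_anc {l r : ℕ} (a : Fin l → ZMod 2) (w : Fin r → ZMod 2) (j : Fin r) :
    Reg.vec a w (Reg.anc j) = w j := rfl

/-- Coordinates for the chain K ⊆ O ⊆ E with K the kernel of π on O: the main coordinates are π,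
identifying O/K with the l main qubits; the set h collects coordinates of K, and the remaining ones
are coordinates of E/O. -/
theorem exists_linearEquiv_adapted {E : Type*} [AddCommGroup E] [Module (ZMod 2) E]
    [FiniteDimensional (ZMod 2) E] (O : Submodule (ZMod 2) E) (l r : ℕ)
    (hdim : Module.finrank (ZMod 2) E = l + r) (π : E →ₗ[ZMod 2] (Fin l → ZMod 2))
    (hπ : O.map π = ⊤) :
    ∃ (h : Set (Fin r)) (M : E ≃ₗ[ZMod 2] (Reg l r → ZMod 2)),
      (∀ y, y ∈ O ↔ ∀ j ∉ h, M y (Reg.anc j) = 0) ∧ ∀ y i, M y (Reg.main i) = π y i := by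
  set K := LinearMap.ker (π.domRestrict O) with hK
  set p := Module.finrank (ZMod 2) K with hp
  set q := Module.finrank (ZMod 2) (E ⧸ O) with hq
  have h1 : l + p = Module.finrank (ZMod 2) O := by
    rw [← LinearMap.finrank_range_add_finrank_ker (π.domRestrict O), LinearMap.range_domRestrict,
      hπ, finrank_top, Module.finrank_fin_fun]
  have h2 : q + Module.finrank (ZMod 2) O = l + r := by
    rw [← hdim]; exact Submodule.finrank_quotient_add_finrank O
  have hr : p + q = r := by omega
  let e : Fin r ≃ Fin p ⊕ Fin q := (finCongr hr.symm).trans finSumFinEquiv.symm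
  let κ₀ : K ≃ₗ[ZMod 2] (Fin p → ZMod 2) := LinearEquiv.ofFinrankEq _ _ (by simp [hp])
  obtain ⟨κ₁, hκ₁⟩ := LinearMap.exists_extend (κ₀ : K →ₗ[ZMod 2] (Fin p → ZMod 2))
  obtain ⟨κ, hκ⟩ := LinearMap.exists_extend κ₁
  let ω₀ : (E ⧸ O) ≃ₗ[ZMod 2] (Fin q → ZMod 2) := LinearEquiv.ofFinrankEq _ _ (by simp [hq])
  let ω : E →ₗ[ZMod 2] (Fin q → ZMod 2) := ω₀.toLinearMap ∘ₗ O.mkQ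
  have hω : ∀ y, ω y = 0 ↔ y ∈ O := fun y => by simp [ω]
  let M₀ : E →ₗ[ZMod 2] (Reg l r → ZMod 2) := LinearMap.pi
    (Reg.rec (fun i => LinearMap.proj i ∘ₗ π)
      (fun j => Sum.elim (fun a => LinearMap.proj a ∘ₗ κ) (fun b => LinearMap.proj b ∘ₗ ω) (e j)))
  have hinl : ∀ y i, M₀ y (Reg.main i) = π y i := fun y i => rfl
  have hinrl : ∀ y j a, e j = Sum.inl a → M₀ y (Reg.anc j) = κ y a := fun y j a h => by
    simp [M₀, h]
  have hinrr : ∀ y j b, e j = Sum.inr b → M₀ y (Reg.anc j) = ω y b := fun y j b h => by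
    simp [M₀, h]
  have hO : ∀ y, y ∈ O ↔ ∀ j ∉ {j | (e j).isLeft = true}, M₀ y (Reg.anc j) = 0 := by
    intro y
    rw [← hω]
    constructor
    · intro h j hj
      rcases he : e j with a | b
      · exact absurd (by simp [he]) hj
      · rw [hinrr y j b he, h]; rfl
    · intro h
      funext b
      have := h (e.symm (Sum.inr b)) (by simp)
      rwa [hinrr y _ b (by simp)] at this
  -- The quotient coordinates put a kernel vector in `O`, then π puts it in `K`, where κ is
  -- injective. Surjectivity follows from the dimensions.
  have hinj : Function.Injective M₀ := by
    rw [injective_iff_map_eq_zero]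
    intro y hy
    have hyO : y ∈ O := (hO y).mpr fun j _ => by rw [hy]; rfl
    have hyK : (⟨y, hyO⟩ : O) ∈ K := by
      rw [hK, LinearMap.mem_ker]
      funext i
      change π y i = 0
      rw [← hinl, hy]; rfl
    have h3 : κ₀ ⟨⟨y, hyO⟩, hyK⟩ = κ y := by
      have e1 := LinearMap.congr_fun hκ₁ ⟨⟨y, hyO⟩, hyK⟩
      have e2 := LinearMap.congr_fun hκ ⟨y, hyO⟩
      exact (e2.trans e1).symm
    have h4 : κ y = 0 := by
      funext a
      rw [← hinrl y (e.symm (Sum.inl a)) a (by simp), hy]; rfl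
    rw [h4, LinearEquiv.map_eq_zero_iff] at h3
    simpa using congrArg (fun z : K => (z.1.1 : E)) h3
  refine ⟨{j | (e j).isLeft = true}, LinearMap.linearEquivOfInjective M₀ hinj
    (by simp [hdim, Reg.card]), ?_, ?_⟩
  · intro y; exact hO y
  · intro y i; rfl

/-- A register with commuting families of local stabilizers is brought to a register in which
the local stabilizers are the operators `Z` of the last `r` qubits, and the restrictions `x`, `z` of
the nonlocal stabilizers act on the first `l` qubits by `ξ`, `ζ`. -/
theorem exists_standard_form {A T R : Type*} [Fintype A] (l r : ℕ)
    (hA : Fintype.card A = l + r) (x : T → A → ZMod 2) (z : R → A → ZMod 2)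
    (ξ : T → Fin l → ZMod 2) (ζ : R → Fin l → ZMod 2)
    (hpair : ∀ τ ρ, x τ ⬝ᵥ z ρ = ξ τ ⬝ᵥ ζ ρ)
    (hξ : Submodule.span (ZMod 2) (Set.range ξ) = ⊤) (hζ : ∀ v, (∀ ρ, v ⬝ᵥ ζ ρ = 0) → v = 0)
    (hx : ∀ u, (∀ ρ, u ⬝ᵥ z ρ = 0) → u ∈ Submodule.span (ZMod 2) (Set.range x)) :
    ∃ U : Matrix (Config (Reg l r)) (Config A) ℂ, IsPauliUnitary U ∧
      (∀ τ, ∃ w : Fin r → ZMod 2,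
        U * matW (x τ) 0 = matW (Reg.vec (ξ τ) 0) (Reg.vec (l := l) 0 w) * U) ∧
      (∀ ρ, ∃ w : Fin r → ZMod 2, U * matW 0 (z ρ) = matW 0 (Reg.vec (ζ ρ) w) * U) ∧
      (∀ u : A → ZMod 2, (∀ ρ, u ⬝ᵥ z ρ = 0) → ∃ w : Fin r → ZMod 2,
        U * matW u 0 = matW 0 (Reg.vec (l := l) 0 w) * U) ∧
      (∀ v : A → ZMod 2, (∀ τ, x τ ⬝ᵥ v = 0) → ∃ w : Fin r → ZMod 2,
        U * matW 0 v = matW 0 (Reg.vec (l := l) 0 w) * U) ∧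
      (∀ w : Fin r → ZMod 2, ∃ u v : A → ZMod 2, (∀ ρ, u ⬝ᵥ z ρ = 0) ∧
        (∀ τ, x τ ⬝ᵥ v = 0) ∧
        U * matW u v = matW 0 (Reg.vec (l := l) 0 w) * U) := by
  set O := Submodule.span (ZMod 2) (Set.range x) with hO
  let Zm : (A → ZMod 2) →ₗ[ZMod 2] (R → ZMod 2) :=
    LinearMap.pi fun ρ => (dotProductBilin (ZMod 2) (ZMod 2)).flip (z ρ)
  let Lm : (Fin l → ZMod 2) →ₗ[ZMod 2] (R → ZMod 2) :=
    LinearMap.pi fun ρ => (dotProductBilin (ZMod 2) (ZMod 2)).flip (ζ ρ)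
  have hZm : ∀ y ρ, Zm y ρ = y ⬝ᵥ z ρ := fun _ _ => rfl
  have hLm : ∀ y ρ, Lm y ρ = y ⬝ᵥ ζ ρ := fun _ _ => rfl
  have hLker : LinearMap.ker Lm = ⊥ := by
    rw [LinearMap.ker_eq_bot']
    intro v hv
    exact hζ v fun ρ => by rw [← hLm, hv]; rfl
  -- By `hζ` the map `Lm` is injective, so the main coordinates can be recovered linearly from the
  -- pairings with the z's.
  obtain ⟨g, hg⟩ := Lm.exists_leftInverse_of_injective hLker
  set π := g ∘ₗ Zm with hπdef
  have hZx : ∀ τ, Zm (x τ) = Lm (ξ τ) := fun τ => by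
    funext ρ; rw [hZm, hLm, hpair]
  have hπx : ∀ τ, π (x τ) = ξ τ := fun τ => by
    rw [hπdef, LinearMap.comp_apply, hZx]
    exact LinearMap.congr_fun hg (ξ τ)
  -- Only on `O` do the pairings of y with the z's depend on π y alone, since `g` is merely a left
  -- inverse of `Lm`. Hence the kernel of π on `O` consists of the combinations of the x's
  -- orthogonal to all z's.
  have hπO : ∀ y ∈ O, Zm y = Lm (π y) := by
    intro y hy
    induction hy using Submodule.span_induction with
    | mem y hy => obtain ⟨τ, rfl⟩ := hy; rw [hZx, hπx]
    | zero => simp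
    | add y y' _ _ h h' => rw [map_add, h, h', map_add, map_add]
    | smul c y _ h => rw [map_smul, h, map_smul, map_smul]
  have hπtop : O.map π = ⊤ := by
    rw [hO, Submodule.map_span, ← hξ]
    congr 1
    ext v
    constructor
    · rintro ⟨_, ⟨τ, rfl⟩, rfl⟩; exact ⟨τ, (hπx τ).symm⟩
    · rintro ⟨τ, rfl⟩; exact ⟨_, ⟨τ, rfl⟩, hπx τ⟩
  obtain ⟨h, M, hMO, hMπ⟩ := exists_linearEquiv_adapted O l r (by simp [hA]) π hπtop
  -- Hadamard gates go on the coordinates of K. They turn the local X-operators into Z's, joining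
  -- the local Z-operators, which already sit on the coordinates of E/O.
  set s : Set (Reg l r) := Reg.anc '' h with hs
  have hsl : ∀ i, Reg.main i ∉ s := fun i => by simp [hs]
  have hsr : ∀ j, Reg.anc j ∈ s ↔ j ∈ h := fun j => by simp [hs]
  have hU : IsPauliUnitary (hadMat s * permMat M) :=
    (permMat_isPauliUnitary M).mul (hadMat_isPauliUnitary s)
  -- Bookkeeping for the composite gate. The last hypothesis says that no Hadamard qubit carries
  -- both X and Z, so that the sign is 1.
  have hact : ∀ (a b : A → ZMod 2) (a' b' : Reg l r → ZMod 2),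
      (∀ i, M a (Reg.main i) = a' (Reg.main i)) →
      (∀ j, a' (Reg.anc j) = if j ∈ h then dualVec M b (Reg.anc j) else M a (Reg.anc j)) →
      (∀ i, dualVec M b (Reg.main i) = b' (Reg.main i)) →
      (∀ j, b' (Reg.anc j) = if j ∈ h then M a (Reg.anc j) else dualVec M b (Reg.anc j)) →
      (∀ j ∈ h, M a (Reg.anc j) * dualVec M b (Reg.anc j) = 0) →
      (hadMat s * permMat M) * matW a b = matW a' b' * (hadMat s * permMat M) := by
    intro a b a' b' h1 h2 h3 h4 h5
    rw [Matrix.mul_assoc, permMat_mul_matW, ← Matrix.mul_assoc, hadMat_mul_matW]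
    have e1 : (∑ q, if q ∈ s then M a q * dualVec M b q else 0) = 0 := by
      refine Finset.sum_eq_zero fun q _ => ?_
      rcases q with i | j
      · rw [if_neg (hsl i)]
      · simp only [hsr]
        split_ifs with hj
        · exact h5 j hj
        · rfl
    have e2 : (fun q => if q ∈ s then dualVec M b q else M a q) = a' := by
      funext q
      rcases q with i | j
      · rw [if_neg (hsl i), h1]
      · simp only [hsr, h2]
    have e3 : (fun q => if q ∈ s then M a q else dualVec M b q) = b' := by
      funext q
      rcases q with i | j
      · rw [if_neg (hsl i), h3]
      · simp only [hsr, h4]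
    rw [e1, e2, e3, sgn_zero, one_smul, Matrix.mul_assoc]
  have hd0 : dualVec M 0 = 0 := by funext q; simp [dualVec]
  have hsymm_inl : ∀ i, M.symm (Pi.single (Reg.main i) 1) ∈ O ∧
      π (M.symm (Pi.single (Reg.main i) 1)) = Pi.single i 1 := by
    intro i
    refine ⟨(hMO _).mpr fun j _ => by simp, ?_⟩
    funext i'
    rw [← hMπ, LinearEquiv.apply_symm_apply]
    simp [Pi.single_apply]
  have hsymm_inr : ∀ w : Fin r → ZMod 2, (∀ j ∉ h, w j = 0) →
      M.symm (Reg.vec 0 w) ∈ O ∧ π (M.symm (Reg.vec 0 w)) = 0 := by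
    intro w hw
    refine ⟨(hMO _).mpr fun j hj => by simp [hw j hj], ?_⟩
    funext i'
    rw [← hMπ, LinearEquiv.apply_symm_apply]
    rfl
  have hsingle : ∀ j : Fin r, (Pi.single (Reg.anc j) 1 : Reg l r → ZMod 2) =
      Reg.vec 0 (Pi.single j 1) := by
    intro j
    funext q
    rcases q with i | j' <;> simp [Pi.single_apply]
  have hpi0 : ∀ y ∈ O, π y = 0 → ∀ ρ, y ⬝ᵥ z ρ = 0 := by
    intro y hy h0 ρ
    rw [← hZm, hπO y hy, h0, map_zero]; rfl
  have hOv : ∀ v, (∀ τ, x τ ⬝ᵥ v = 0) → ∀ y ∈ O, y ⬝ᵥ v = 0 := by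
    intro v hv y hy
    induction hy using Submodule.span_induction with
    | mem y hy => obtain ⟨τ, rfl⟩ := hy; exact hv τ
    | zero => simp
    | add y y' _ _ h h' => rw [add_dotProduct, h, h', add_zero]
    | smul c y _ h => rw [smul_dotProduct, h, smul_zero]
  refine ⟨hadMat s * permMat M, hU, ?_, ?_, ?_, ?_, ?_⟩
  · intro τ
    have hxO : x τ ∈ O := Submodule.subset_span ⟨τ, rfl⟩
    refine ⟨fun j => M (x τ) (Reg.anc j), hact _ _ _ _ ?_ ?_ ?_ ?_ ?_⟩
    · intro i; rw [hMπ, hπx]; rfl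
    · intro j
      split_ifs with hj
      · rw [hd0]; rfl
      · rw [(hMO _).mp hxO j hj]; rfl
    · intro i; rw [hd0]; rfl
    · intro j
      split_ifs with hj
      · rfl
      · rw [hd0]; exact (hMO _).mp hxO j hj
    · intro j _; rw [hd0]; exact mul_zero _
  · intro ρ
    refine ⟨fun j => dualVec M (z ρ) (Reg.anc j), hact _ _ _ _ ?_ ?_ ?_ ?_ ?_⟩
    · intro i; rw [map_zero]
    · intro j
      split_ifs with hj
      · have := hsymm_inr (Pi.single j 1) fun j' hj' => by
          rw [Pi.single_apply, if_neg]; rintro rfl; exact hj' hj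
        rw [dualVec, hsingle, dotProduct_comm, hpi0 _ this.1 this.2]; rfl
      · rw [map_zero]
    · intro i
      rw [dualVec, dotProduct_comm, ← hZm, hπO _ (hsymm_inl i).1, (hsymm_inl i).2, hLm]
      simp
    · intro j
      split_ifs with hj
      · have := hsymm_inr (Pi.single j 1) fun j' hj' => by
          rw [Pi.single_apply, if_neg]; rintro rfl; exact hj' hj
        rw [map_zero]
        change dualVec M (z ρ) (Reg.anc j) = 0
        rw [dualVec, hsingle, dotProduct_comm, hpi0 _ this.1 this.2]
      · rfl
    · intro j _; rw [map_zero]; exact zero_mul _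
  · intro u hu
    have huO : u ∈ O := hx u hu
    have hπu : π u = 0 := by
      have : Zm u = 0 := by funext ρ; exact hu ρ
      rw [hπdef, LinearMap.comp_apply, this, map_zero]
    refine ⟨fun j => M u (Reg.anc j), hact _ _ _ _ ?_ ?_ ?_ ?_ ?_⟩
    · intro i; rw [hMπ, hπu]; rfl
    · intro j
      split_ifs with hj
      · rw [hd0]
      · rw [(hMO _).mp huO j hj]; rfl
    · intro i; rw [hd0]; rfl
    · intro j
      split_ifs with hj
      · rfl
      · rw [hd0]; exact (hMO _).mp huO j hj
    · intro j _; rw [hd0]; exact mul_zero _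
  · intro v hv
    refine ⟨fun j => dualVec M v (Reg.anc j), hact _ _ _ _ ?_ ?_ ?_ ?_ ?_⟩
    · intro i; rw [map_zero]
    · intro j
      split_ifs with hj
      · have := hsymm_inr (Pi.single j 1) fun j' hj' => by
          rw [Pi.single_apply, if_neg]; rintro rfl; exact hj' hj
        rw [dualVec, hsingle, dotProduct_comm, hOv v hv _ this.1]; rfl
      · rw [map_zero]
    · intro i
      rw [dualVec, dotProduct_comm, hOv v hv _ (hsymm_inl i).1]; rfl
    · intro j
      split_ifs with hj
      · have := hsymm_inr (Pi.single j 1) fun j' hj' => by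
          rw [Pi.single_apply, if_neg]; rintro rfl; exact hj' hj
        rw [map_zero]
        change dualVec M v (Reg.anc j) = 0
        rw [dualVec, hsingle, dotProduct_comm, hOv v hv _ this.1]
      · rfl
    · intro j _; rw [map_zero]; exact zero_mul _
  · intro w
    -- A Z on the further qubits has two sources: its part on `h` comes from a local X-operator and
    -- the rest from a local Z-operator.
    set w₁ : Fin r → ZMod 2 := fun j => if j ∈ h then w j else 0 with hw₁
    set w₂ : Fin r → ZMod 2 := fun j => if j ∈ h then 0 else w j with hw₂
    have h1 := hsymm_inr w₁ fun j hj => by rw [hw₁]; exact if_neg hj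
    set v := dualVec M.symm (Reg.vec 0 w₂) with hv
    have hvdot : ∀ y, v ⬝ᵥ y = Reg.vec 0 w₂ ⬝ᵥ M y := fun y => by
      rw [hv, dualVec_dotProduct]; rfl
    have hdv : dualVec M v = Reg.vec 0 w₂ := by
      funext q
      rw [dualVec, hvdot, LinearEquiv.apply_symm_apply]
      simp
    refine ⟨M.symm (Reg.vec 0 w₁), v, hpi0 _ h1.1 h1.2, ?_, hact _ _ _ _ ?_ ?_ ?_ ?_ ?_⟩
    · intro τ
      have hxO : x τ ∈ O := Submodule.subset_span ⟨τ, rfl⟩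
      rw [dotProduct_comm, hvdot, dotProduct]
      refine Finset.sum_eq_zero fun q _ => ?_
      rcases q with i | j
      · simp
      · by_cases hj : j ∈ h
        · simp [hw₂, hj]
        · rw [(hMO _).mp hxO j hj, mul_zero]
    · intro i; simp
    · intro j
      rw [hdv, LinearEquiv.apply_symm_apply]
      by_cases hj : j ∈ h <;> simp [hw₁, hw₂, hj]
    · intro i; rw [hdv]; rfl
    · intro j
      rw [hdv, LinearEquiv.apply_symm_apply]
      by_cases hj : j ∈ h <;> simp [hw₁, hw₂, hj]
    · intro j hj
      rw [hdv]
      simp [hw₂, hj]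

/-- A factorization of a bilinear pairing through its rank. -/
theorem exists_rank_factorization {T R : Type*} [Finite R] (G : T → R → ZMod 2) :
    ∃ (l : ℕ) (ξ : T → Fin l → ZMod 2) (ζ : R → Fin l → ZMod 2),
      l = Module.finrank (ZMod 2) (Submodule.span (ZMod 2) (Set.range G)) ∧
      (∀ τ ρ, G τ ρ = ξ τ ⬝ᵥ ζ ρ) ∧ Submodule.span (ZMod 2) (Set.range ξ) = ⊤ ∧
      ∀ v, (∀ ρ, v ⬝ᵥ ζ ρ = 0) → v = 0 := by
  have := Fintype.ofFinite R
  set E := Submodule.span (ZMod 2) (Set.range G) with hE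
  let b := Module.finBasis (ZMod 2) E
  let γ : T → E := fun τ => ⟨G τ, Submodule.subset_span ⟨τ, rfl⟩⟩
  have hsum : ∀ v ρ, (b.equivFun.symm v).1 ρ = v ⬝ᵥ fun i => (b i).1 ρ := by
    intro v ρ
    rw [Module.Basis.equivFun_symm_apply, Submodule.coe_sum, Finset.sum_apply, dotProduct]
    rfl
  refine ⟨_, fun τ => b.equivFun (γ τ), fun ρ i => (b i).1 ρ, rfl, ?_, ?_, ?_⟩
  · intro τ ρ
    rw [← hsum, LinearEquiv.symm_apply_apply]
  · have h1 : Submodule.span (ZMod 2) (Set.range γ) = ⊤ := by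
      apply Submodule.map_injective_of_injective E.injective_subtype
      rw [Submodule.map_span, Submodule.map_top, Submodule.range_subtype, ← Set.range_comp]
      rfl
    have h2 : Set.range (fun τ => b.equivFun (γ τ)) =
        (b.equivFun : E →ₗ[ZMod 2] _) '' Set.range γ := by
      rw [← Set.range_comp]; rfl
    rw [h2, ← Submodule.map_span, h1, Submodule.map_top, LinearEquiv.range]
  · intro v hv
    have h : b.equivFun.symm v = 0 := by
      apply Subtype.ext
      funext ρ
      rw [hsum]; exact hv ρ
    exact (LinearEquiv.map_eq_zero_iff _).mp h

/-- Two operators with the same image in a common standard register correspond to each other under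
one standard form followed by the inverse of the other. -/
theorem intertwine_trans {A B K : Type*} [Fintype A] [Fintype B] [Fintype K]
    {S : Matrix (Config K) (Config A) ℂ} {S' : Matrix (Config K) (Config B) ℂ} (hS' : IsUnitary S')
    {W : Matrix (Config A) (Config A) ℂ} {W' : Matrix (Config B) (Config B) ℂ}
    {W'' : Matrix (Config K) (Config K) ℂ} (h : S * W = W'' * S) (h' : S' * W' = W'' * S') :
    (S'ᴴ * S) * W = W' * (S'ᴴ * S) := by
  rw [Matrix.mul_assoc, h, ← Matrix.mul_assoc, (hS'.mul_eq_iff _ _).mp h', Matrix.mul_assoc]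

/-- Two registers of equal size, whose restricted stabilizers `x`, `z` and `x'`, `z'` have the same
commutation relations, are related by a Clifford unitary that matches these operators up to local
stabilizers. The second register has no local stabilizers of type `X`. -/
theorem exists_block_unitary {A B T R RA RB : Type*} [Fintype A] [Fintype B] [Finite R]
    (hcard : Fintype.card A = Fintype.card B)
    (x : T → A → ZMod 2) (z : R → A → ZMod 2) (za : RA → A → ZMod 2)
    (x' : T → B → ZMod 2) (z' : R → B → ZMod 2) (za' : RB → B → ZMod 2)
    (hpair : ∀ τ ρ, x τ ⬝ᵥ z ρ = x' τ ⬝ᵥ z' ρ)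
    (hza : ∀ τ a, x τ ⬝ᵥ za a = 0) (hza' : ∀ τ a, x' τ ⬝ᵥ za' a = 0)
    (hx : ∀ u, (∀ ρ, u ⬝ᵥ z ρ = 0) → (∀ a, u ⬝ᵥ za a = 0) →
      u ∈ Submodule.span (ZMod 2) (Set.range x))
    (hx' : ∀ u, (∀ ρ, u ⬝ᵥ z' ρ = 0) → (∀ a, u ⬝ᵥ za' a = 0) → u = 0) :
    ∃ U : Matrix (Config B) (Config A) ℂ, IsPauliUnitary U ∧
      (∀ τ, ∃ w : B → ZMod 2, (∀ τ', x' τ' ⬝ᵥ w = 0) ∧ U * matW (x τ) 0 = matW (x' τ) w * U) ∧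
      (∀ ρ, ∃ w : B → ZMod 2, (∀ τ', x' τ' ⬝ᵥ w = 0) ∧ U * matW 0 (z ρ) = matW 0 (z' ρ + w) * U) ∧
      (∀ u : A → ZMod 2, (∀ ρ, u ⬝ᵥ z ρ = 0) → (∀ a, u ⬝ᵥ za a = 0) →
        ∃ w : B → ZMod 2, (∀ τ', x' τ' ⬝ᵥ w = 0) ∧ U * matW u 0 = matW 0 w * U) ∧
      (∀ v : A → ZMod 2, (∀ τ, x τ ⬝ᵥ v = 0) →
        ∃ w : B → ZMod 2, (∀ τ', x' τ' ⬝ᵥ w = 0) ∧ U * matW 0 v = matW 0 w * U) ∧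
      (∀ w : B → ZMod 2, (∀ τ', x' τ' ⬝ᵥ w = 0) → ∃ u v : A → ZMod 2,
        (∀ ρ, u ⬝ᵥ z ρ = 0) ∧ (∀ a, u ⬝ᵥ za a = 0) ∧
        (∀ τ, x τ ⬝ᵥ v = 0) ∧ U * matW u v = matW 0 w * U) := by
  obtain ⟨l, ξ, ζ, hl, hG, hξ, hζ⟩ := exists_rank_factorization fun τ ρ => x τ ⬝ᵥ z ρ
  have hle : l ≤ Fintype.card A := by
    have := Fintype.ofFinite R
    let Zm : (A → ZMod 2) →ₗ[ZMod 2] (R → ZMod 2) :=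
      LinearMap.pi fun ρ => (dotProductBilin (ZMod 2) (ZMod 2)).flip (z ρ)
    -- The rows of the pairing matrix lie in the image of a space of dimension |A|, so the rank l
    -- leaves room for r = |A| - l further qubits.
    have h1 : Submodule.span (ZMod 2) (Set.range fun τ ρ => x τ ⬝ᵥ z ρ) ≤ LinearMap.range Zm := by
      rw [Submodule.span_le]
      rintro _ ⟨τ, rfl⟩
      exact ⟨x τ, rfl⟩
    have h2 := Submodule.finrank_mono h1
    have h3 := LinearMap.finrank_range_le Zm
    rw [Module.finrank_fintype_fun_eq_card] at h3
    omega
  obtain ⟨r, hr⟩ := Nat.exists_eq_add_of_le hle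
  obtain ⟨S, hS, s1, s2, s3, s4, s5⟩ := exists_standard_form l r hr x (Sum.elim z za) ξ
    (Sum.elim ζ fun _ => 0) (by
      rintro τ (ρ | a)
      · exact hG τ ρ
      · simpa using hza τ a) hξ (fun v hv => hζ v fun ρ => hv (Sum.inl ρ))
    (fun u hu => hx u (fun ρ => hu (Sum.inl ρ)) fun a => hu (Sum.inr a))
  obtain ⟨S', hS', s1', s2', s3', s4', s5'⟩ := exists_standard_form l r (hcard ▸ hr) x'
    (Sum.elim z' za') ξ (Sum.elim ζ fun _ => 0) (by
      rintro τ (ρ | a)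
      · exact (hpair τ ρ).symm.trans (hG τ ρ)
      · simpa using hza' τ a) hξ (fun v hv => hζ v fun ρ => hv (Sum.inl ρ))
    (fun u hu => by
      rw [hx' u (fun ρ => hu (Sum.inl ρ)) fun a => hu (Sum.inr a)]
      exact Submodule.zero_mem _)
  -- Without local X-operators on the second register, each Z on the further qubits comes from a
  -- local Z-operator alone.
  have hz5 : ∀ w : Fin r → ZMod 2, ∃ v : B → ZMod 2, (∀ τ, x' τ ⬝ᵥ v = 0) ∧
      S' * matW 0 v = matW 0 (Reg.vec (l := l) 0 w) * S' := by
    intro w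
    obtain ⟨u, v, hu, hv, e⟩ := s5' w
    rw [hx' u (fun ρ => hu (Sum.inl ρ)) fun a => hu (Sum.inr a)] at e
    exact ⟨v, hv, e⟩
  have hadd : ∀ (a : Fin l → ZMod 2) (w w' : Fin r → ZMod 2),
      Reg.vec a w' + Reg.vec 0 (w + w') = Reg.vec a w := by
    intro a w w'
    funext q
    rcases q with i | j
    · simp
    · change w' j + (w j + w' j) = w j
      rw [add_comm (w j), ← add_assoc, CharTwo.add_self_eq_zero, zero_add]
  refine ⟨S'ᴴ * S, hS.mul hS'.conjTranspose, ?_, ?_, ?_, ?_, ?_⟩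
  · intro τ
    obtain ⟨w, hw⟩ := s1 τ
    obtain ⟨w', hw'⟩ := s1' τ
    -- The two standard forms agree on the main qubits but may differ by w + w' on the further ones;
    -- that discrepancy is absorbed in a local stabilizer.
    obtain ⟨v, hv, e⟩ := hz5 (w + w')
    refine ⟨v, hv, intertwine_trans hS'.unitary hw ?_⟩
    rw [matW_split, ← Matrix.mul_assoc, hw', Matrix.mul_assoc, e, ← Matrix.mul_assoc,
      matW_mul_right, hadd]
  · intro ρ
    obtain ⟨w, hw⟩ := s2 (Sum.inl ρ)
    obtain ⟨w', hw'⟩ := s2' (Sum.inl ρ)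
    obtain ⟨v, hv, e⟩ := hz5 (w + w')
    refine ⟨v, hv, intertwine_trans hS'.unitary hw ?_⟩
    change S' * matW 0 (z' ρ) = _ at hw'
    rw [← matW_zero_mul, ← Matrix.mul_assoc, hw', Matrix.mul_assoc, e, ← Matrix.mul_assoc,
      matW_zero_mul, hadd]
    rfl
  · intro u hu hua
    obtain ⟨w, hw⟩ := s3 u (by rintro (ρ | a); exacts [hu ρ, hua a])
    obtain ⟨v, hv, e⟩ := hz5 w
    exact ⟨v, hv, intertwine_trans hS'.unitary hw e⟩
  · intro u hu
    obtain ⟨w, hw⟩ := s4 u hu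
    obtain ⟨v, hv, e⟩ := hz5 w
    exact ⟨v, hv, intertwine_trans hS'.unitary hw e⟩
  · intro v hv
    obtain ⟨w, hw⟩ := s4' v hv
    obtain ⟨u, v', hu, hv', e⟩ := s5 w
    exact ⟨u, v', fun ρ => hu (Sum.inl ρ), fun a => hu (Sum.inr a), hv',
      intertwine_trans hS'.unitary e hw⟩

end StandardForm

/-! ## Tensor products over a partition of the registers -/

section Tensor

variable {D : Type*} [Fintype D]

/-- The tensor product of the operators `U δ`, from the registers `A δ` included in `P` by `ι` to
the registers `B δ` included in `Q` by `κ`. -/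
def blockTensor {P Q : Type*} {A B : D → Type*} (ι : ∀ δ, A δ → P) (κ : ∀ δ, B δ → Q)
    (U : ∀ δ, Matrix (Config (B δ)) (Config (A δ)) ℂ) : Matrix (Config Q) (Config P) ℂ :=
  Matrix.of fun y x => ∏ δ, U δ (fun b => y (κ δ b)) (fun a => x (ι δ a))

/-- The blocks `A δ` partition `P`. -/
def IsPartition {D P : Type*} {A : D → Type*} (ι : ∀ δ, A δ → P) : Prop :=
  Function.Bijective fun s : Σ δ, A δ => ι s.1 s.2

variable {P Q : Type*} [Fintype P] [Fintype Q] {A B : D → Type*}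
  [∀ δ, Fintype (A δ)] [∀ δ, Fintype (B δ)] {ι : ∀ δ, A δ → P} {κ : ∀ δ, B δ → Q}

theorem IsPartition.sum_eq (hι : IsPartition ι) {M : Type*} [AddCommMonoid M] (f : P → M) :
    ∑ p, f p = ∑ δ, ∑ a, f (ι δ a) := by
  rw [← Fintype.sum_sigma' fun δ a => f (ι δ a)]
  exact (Equiv.sum_comp (Equiv.ofBijective _ hι) f).symm

theorem IsPartition.exists_glue {D P X : Type*} {A : D → Type*} {ι : ∀ δ, A δ → P}
    (hι : IsPartition ι) (f : ∀ δ, A δ → X) : ∃ g : P → X, ∀ δ, (fun a => g (ι δ a)) = f δ := by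
  let e := Equiv.ofBijective _ hι
  refine ⟨fun p => f (e.symm p).1 (e.symm p).2, fun δ => funext fun a => ?_⟩
  exact congrArg (fun s : Σ δ, A δ => f s.1 s.2) (e.symm_apply_apply ⟨δ, a⟩)

theorem IsPartition.ext {D P X : Type*} {A : D → Type*} {ι : ∀ δ, A δ → P}
    (hι : IsPartition ι) {f g : P → X} (h : ∀ δ a, f (ι δ a) = g (ι δ a)) : f = g := by
  funext p
  obtain ⟨⟨δ, a⟩, rfl⟩ := hι.2 p
  exact h δ a

/-- Basis states of a partitioned register. -/
def IsPartition.configEquiv {D P : Type*} {A : D → Type*} {ι : ∀ δ, A δ → P}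
    (hι : IsPartition ι) : Config P ≃ ∀ δ, Config (A δ) :=
  Equiv.ofBijective (fun y δ a => y (ι δ a))
    ⟨fun _ _ h => hι.ext fun δ a => congrFun (congrFun h δ) a, fun f => by
      obtain ⟨g, hg⟩ := hι.exists_glue f
      exact ⟨g, funext hg⟩⟩

/-- The sum over intermediate basis states of a partitioned register is a product of sums over the
blocks. -/
theorem blockTensor_mul {P Q R : Type*} [Fintype Q] {A B C : D → Type*} [∀ δ, Fintype (B δ)]
    {ι : ∀ δ, A δ → P} {κ : ∀ δ, B δ → Q} {ν : ∀ δ, C δ → R} (hκ : IsPartition κ)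
    (V : ∀ δ, Matrix (Config (C δ)) (Config (B δ)) ℂ)
    (U : ∀ δ, Matrix (Config (B δ)) (Config (A δ)) ℂ) :
    blockTensor κ ν V * blockTensor ι κ U = blockTensor ι ν fun δ => V δ * U δ := by
  ext y x
  simp only [blockTensor, Matrix.mul_apply, Matrix.of_apply, ← Finset.prod_mul_distrib]
  rw [Finset.prod_univ_sum, Fintype.piFinset_univ]
  exact Equiv.sum_comp hκ.configEquiv fun z : ∀ δ, Config (B δ) =>
    ∏ δ, V δ (fun b => y (ν δ b)) (z δ) * U δ (z δ) (fun a => x (ι δ a))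

theorem blockTensor_conjTranspose {P Q : Type*} {A B : D → Type*} (ι : ∀ δ, A δ → P)
    (κ : ∀ δ, B δ → Q) (U : ∀ δ, Matrix (Config (B δ)) (Config (A δ)) ℂ) :
    (blockTensor ι κ U)ᴴ = blockTensor κ ι fun δ => (U δ)ᴴ := by
  ext x y
  simp [blockTensor, Matrix.conjTranspose_apply]

theorem blockTensor_one (hι : IsPartition ι) :
    blockTensor ι ι (fun δ => (1 : Matrix (Config (A δ)) (Config (A δ)) ℂ)) = 1 := by
  ext y x
  simp only [blockTensor, Matrix.of_apply, Matrix.one_apply]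
  by_cases h : y = x
  · simp [h]
  · rw [if_neg h]
    have : ∃ δ, (fun a => y (ι δ a)) ≠ fun a => x (ι δ a) := by
      by_contra! h'
      exact h (hι.ext fun δ a => congrFun (h' δ) a)
    obtain ⟨δ, hδ⟩ := this
    exact Finset.prod_eq_zero (Finset.mem_univ δ) (if_neg hδ)

theorem IsUnitary.blockTensor (hι : IsPartition ι) (hκ : IsPartition κ)
    {U : ∀ δ, Matrix (Config (B δ)) (Config (A δ)) ℂ} (hU : ∀ δ, IsUnitary (U δ)) :
    IsUnitary (blockTensor ι κ U) := by
  refine ⟨?_, ?_⟩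
  · rw [blockTensor_conjTranspose, blockTensor_mul hκ, ← blockTensor_one hι]
    congr 1
    funext δ
    exact (hU δ).1
  · rw [blockTensor_conjTranspose, blockTensor_mul hι, ← blockTensor_one hκ]
    congr 1
    funext δ
    exact (hU δ).2

/-- Restricting both labels to the blocks splits the dot products into sums, so the signs multiply
and the phases of the blocks combine to their product. -/
theorem blockTensor_mul_matW (hι : IsPartition ι) (hκ : IsPartition κ)
    (U : ∀ δ, Matrix (Config (B δ)) (Config (A δ)) ℂ) (c : D → ℂ) (a b : P → ZMod 2)
    (a' b' : Q → ZMod 2)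
    (h : ∀ δ, U δ * matW (fun p => a (ι δ p)) (fun p => b (ι δ p)) =
      c δ • (matW (fun q => a' (κ δ q)) (fun q => b' (κ δ q)) * U δ)) :
    blockTensor ι κ U * matW a b = (∏ δ, c δ) • (matW a' b' * blockTensor ι κ U) := by
  ext y x
  rw [Matrix.smul_apply, mul_matW_apply, matW_mul_apply, dotProduct, dotProduct, hι.sum_eq,
    hκ.sum_eq, sgn_sum, sgn_sum, blockTensor, Matrix.of_apply, Matrix.of_apply,
    ← Finset.prod_mul_distrib, ← Finset.prod_mul_distrib, smul_eq_mul, ← Finset.prod_mul_distrib]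
  refine Finset.prod_congr rfl fun δ _ => ?_
  have e := congrFun (congrFun (h δ) fun q => y (κ δ q)) fun p => x (ι δ p)
  rw [Matrix.smul_apply, mul_matW_apply, matW_mul_apply] at e
  exact e

theorem blockTensor_mul_matW_of_eq (hι : IsPartition ι) (hκ : IsPartition κ)
    (U : ∀ δ, Matrix (Config (B δ)) (Config (A δ)) ℂ) (a b : P → ZMod 2)
    (a' b' : Q → ZMod 2)
    (h : ∀ δ, U δ * matW (fun p => a (ι δ p)) (fun p => b (ι δ p)) =
      matW (fun q => a' (κ δ q)) (fun q => b' (κ δ q)) * U δ) :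
    blockTensor ι κ U * matW a b = matW a' b' * blockTensor ι κ U := by
  have := blockTensor_mul_matW hι hκ U (fun _ => 1) a b a' b' (fun δ => by rw [one_smul]; exact h δ)
  simpa using this

theorem PauliCovariant.blockTensor (hι : IsPartition ι) (hκ : IsPartition κ)
    {U : ∀ δ, Matrix (Config (B δ)) (Config (A δ)) ℂ} (hU : ∀ δ, PauliCovariant (U δ)) :
    PauliCovariant (blockTensor ι κ U) := by
  intro a b
  choose c a' b' hc h using fun δ => hU δ (fun p => a (ι δ p)) (fun p => b (ι δ p))
  obtain ⟨a'', ha''⟩ := hκ.exists_glue a'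
  obtain ⟨b'', hb''⟩ := hκ.exists_glue b'
  refine ⟨∏ δ, c δ, a'', b'', ?_, blockTensor_mul_matW hι hκ U c a b a'' b'' fun δ => ?_⟩
  · rw [← Finset.prod_pow]
    exact Finset.prod_eq_one fun δ _ => hc δ
  · rw [ha'', hb'']; exact h δ

theorem IsPauliUnitary.blockTensor (hι : IsPartition ι) (hκ : IsPartition κ)
    {U : ∀ δ, Matrix (Config (B δ)) (Config (A δ)) ℂ} (hU : ∀ δ, IsPauliUnitary (U δ)) :
    IsPauliUnitary (blockTensor ι κ U) :=
  ⟨IsUnitary.blockTensor hι hκ fun δ => (hU δ).unitary,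
    PauliCovariant.blockTensor hι hκ fun δ => (hU δ).fwd, by
      rw [blockTensor_conjTranspose]
      exact PauliCovariant.blockTensor hκ hι fun δ => (hU δ).bwd⟩

/-- Two stabilizer groups on registers partitioned into blocks are conjugate by a tensor product of
Clifford unitaries on the blocks, if their nonlocal generators `x`, `z` and `x'`, `z'` have the same
commutation relations on every block and the operators on a block that commute with the restrictions
of the nonlocal generators are stabilizers. -/
theorem exists_tensor_unitary {T S SA SB : Type*} [Finite S]
    (hι : IsPartition ι) (hκ : IsPartition κ)
    (hcard : ∀ δ, Fintype.card (A δ) = Fintype.card (B δ))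
    (x : T → P → ZMod 2) (z : S → P → ZMod 2) (za : SA → P → ZMod 2)
    (x' : T → Q → ZMod 2) (z' : S → Q → ZMod 2) (za' : SB → Q → ZMod 2)
    (hpair : ∀ δ τ ρ, ∑ p, x τ (ι δ p) * z ρ (ι δ p) = ∑ q, x' τ (κ δ q) * z' ρ (κ δ q))
    (hza : ∀ δ τ a, ∑ p, x τ (ι δ p) * za a (ι δ p) = 0)
    (hza' : ∀ δ τ a, ∑ q, x' τ (κ δ q) * za' a (κ δ q) = 0)
    (hx : ∀ δ (u : A δ → ZMod 2), (∀ ρ, ∑ p, u p * z ρ (ι δ p) = 0) →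
      (∀ a, ∑ p, u p * za a (ι δ p) = 0) →
      u ∈ Submodule.span (ZMod 2) (Set.range fun τ p => x τ (ι δ p)))
    (hx' : ∀ δ (u : B δ → ZMod 2), (∀ ρ, ∑ q, u q * z' ρ (κ δ q) = 0) →
      (∀ a, ∑ q, u q * za' a (κ δ q) = 0) → u = 0)
    (G : Set (Matrix.unitaryGroup (Config P) ℂ)) (H : Set (Matrix.unitaryGroup (Config Q) ℂ))
    (hG : ∀ g ∈ G, (∃ τ, g = opW (x τ) 0) ∨ (∃ ρ, g = opW 0 (z ρ)) ∨
      (∃ u : P → ZMod 2, (∀ δ ρ, ∑ p, u (ι δ p) * z ρ (ι δ p) = 0) ∧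
        (∀ δ a, ∑ p, u (ι δ p) * za a (ι δ p) = 0) ∧ g = opW u 0) ∨
      ∃ v : P → ZMod 2, (∀ δ τ, ∑ p, x τ (ι δ p) * v (ι δ p) = 0) ∧ g = opW 0 v)
    (hH : ∀ h ∈ H, (∃ τ, h = opW (x' τ) 0) ∨ (∃ ρ, h = opW 0 (z' ρ)) ∨
      ∃ w : Q → ZMod 2, (∀ δ τ, ∑ q, x' τ (κ δ q) * w (κ δ q) = 0) ∧ h = opW 0 w)
    (hGx : ∀ τ, opW (x τ) 0 ∈ Subgroup.closure G) (hGz : ∀ ρ, opW 0 (z ρ) ∈ Subgroup.closure G)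
    (hGu : ∀ u : P → ZMod 2, (∀ δ ρ, ∑ p, u (ι δ p) * z ρ (ι δ p) = 0) →
      (∀ δ a, ∑ p, u (ι δ p) * za a (ι δ p) = 0) → opW u 0 ∈ Subgroup.closure G)
    (hGv : ∀ v : P → ZMod 2, (∀ δ τ, ∑ p, x τ (ι δ p) * v (ι δ p) = 0) →
      opW 0 v ∈ Subgroup.closure G)
    (hHx : ∀ τ, opW (x' τ) 0 ∈ Subgroup.closure H) (hHz : ∀ ρ, opW 0 (z' ρ) ∈ Subgroup.closure H)
    (hHw : ∀ w : Q → ZMod 2, (∀ δ τ, ∑ q, x' τ (κ δ q) * w (κ δ q) = 0) →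
      opW 0 w ∈ Subgroup.closure H) :
    ∃ U : ∀ δ, Matrix (Config (B δ)) (Config (A δ)) ℂ, (∀ δ, IsClifford (U δ)) ∧
      IsClifford (blockTensor ι κ U) ∧
      ConjEq (blockTensor ι κ U) (Subgroup.closure G) (Subgroup.closure H) := by
  choose U hU h1 h2 h3 h4 h5 using fun δ => exists_block_unitary (hcard δ)
    (fun τ p => x τ (ι δ p)) (fun ρ p => z ρ (ι δ p)) (fun a p => za a (ι δ p))
    (fun τ q => x' τ (κ δ q)) (fun ρ q => z' ρ (κ δ q)) (fun a q => za' a (κ δ q))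
    (hpair δ) (hza δ) (hza' δ) (hx δ) (hx' δ)
  have hW : IsPauliUnitary (blockTensor ι κ U) := IsPauliUnitary.blockTensor hι hκ hU
  have glue : ∀ f : ∀ δ, B δ → ZMod 2, (∀ δ τ, ∑ q, x' τ (κ δ q) * f δ q = 0) →
      ∃ w : Q → ZMod 2, (∀ δ, (fun q => w (κ δ q)) = f δ) ∧
        ∀ δ τ, ∑ q, x' τ (κ δ q) * w (κ δ q) = 0 := by
    intro f hf
    obtain ⟨w, hw⟩ := hκ.exists_glue f
    refine ⟨w, hw, fun δ τ => ?_⟩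
    rw [← hf δ τ]
    exact Finset.sum_congr rfl fun q _ => by rw [← hw δ]
  have k1 : ∀ τ, ∃ w : Q → ZMod 2, (∀ δ τ, ∑ q, x' τ (κ δ q) * w (κ δ q) = 0) ∧
      blockTensor ι κ U * matW (x τ) 0 = matW (x' τ) w * blockTensor ι κ U := by
    intro τ
    choose f hf ef using fun δ => h1 δ τ
    obtain ⟨w, hw, hw'⟩ := glue f hf
    exact ⟨w, hw', blockTensor_mul_matW_of_eq hι hκ U _ _ _ _ fun δ => by rw [hw]; exact ef δ⟩
  have k2 : ∀ ρ, ∃ w : Q → ZMod 2, (∀ δ τ, ∑ q, x' τ (κ δ q) * w (κ δ q) = 0) ∧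
      blockTensor ι κ U * matW 0 (z ρ) = matW 0 (z' ρ + w) * blockTensor ι κ U := by
    intro ρ
    choose f hf ef using fun δ => h2 δ ρ
    obtain ⟨w, hw, hw'⟩ := glue f hf
    refine ⟨w, hw', blockTensor_mul_matW_of_eq hι hκ U _ _ _ _ fun δ => ?_⟩
    have : (fun q => (z' ρ + w) (κ δ q)) = (fun q => z' ρ (κ δ q)) + f δ := by
      rw [← hw]; rfl
    rw [this]; exact ef δ
  -- Local stabilizers of the target are pulled back block by block, and the glued preimages are
  -- stabilizers by `hGu` and `hGv`.
  have k5 : ∀ w : Q → ZMod 2, (∀ δ τ, ∑ q, x' τ (κ δ q) * w (κ δ q) = 0) →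
      ∃ g ∈ Subgroup.closure G, blockTensor ι κ U * g.1 = matW 0 w * blockTensor ι κ U := by
    intro w hw
    choose f f' hf hfa hf' ef using fun δ => h5 δ (fun q => w (κ δ q)) (hw δ)
    obtain ⟨u, hu⟩ := hι.exists_glue f
    obtain ⟨v, hv⟩ := hι.exists_glue f'
    refine ⟨opW u v, ?_, blockTensor_mul_matW_of_eq hι hκ U _ _ _ _ fun δ => by
      rw [hu, hv]; exact ef δ⟩
    rw [opW_split]
    refine Subgroup.mul_mem _ (hGu u (fun δ ρ => ?_) fun δ a => ?_) (hGv v fun δ τ => ?_)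
    · rw [← hf δ ρ]; exact Finset.sum_congr rfl fun q _ => by rw [← hu δ]
    · rw [← hfa δ a]; exact Finset.sum_congr rfl fun q _ => by rw [← hu δ]
    · rw [← hf' δ τ]; exact Finset.sum_congr rfl fun q _ => by rw [← hv δ]
  refine ⟨U, fun δ => (hU δ).isClifford, hW.isClifford,
    conjEq_closure _ hW.unitary G H (fun g hg => ?_) (fun h hh => ?_)⟩
  · rcases hG g hg with ⟨τ, rfl⟩ | ⟨ρ, rfl⟩ | ⟨u, hu, hua, rfl⟩ | ⟨v, hv, rfl⟩
    · obtain ⟨w, hw, e⟩ := k1 τ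
      refine ⟨opW (x' τ) w, ?_, e⟩
      rw [opW_split]
      exact Subgroup.mul_mem _ (hHx τ) (hHw w hw)
    · obtain ⟨w, hw, e⟩ := k2 ρ
      refine ⟨opW 0 (z' ρ + w), ?_, e⟩
      rw [opW_add_right]
      exact Subgroup.mul_mem _ (hHz ρ) (hHw w hw)
    · choose f hf ef using fun δ => h3 δ (fun p => u (ι δ p)) (hu δ) (hua δ)
      obtain ⟨w, hw, hw'⟩ := glue f hf
      exact ⟨opW 0 w, hHw w hw',
        blockTensor_mul_matW_of_eq hι hκ U _ _ _ _ fun δ => by rw [hw]; exact ef δ⟩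
    · choose f hf ef using fun δ => h4 δ (fun p => v (ι δ p)) (hv δ)
      obtain ⟨w, hw, hw'⟩ := glue f hf
      exact ⟨opW 0 w, hHw w hw',
        blockTensor_mul_matW_of_eq hι hκ U _ _ _ _ fun δ => by rw [hw]; exact ef δ⟩
  · rcases hH h hh with ⟨τ, rfl⟩ | ⟨ρ, rfl⟩ | ⟨w, hw, rfl⟩
    · obtain ⟨w, hw, e⟩ := k1 τ
      obtain ⟨g, hg, e'⟩ := k5 w hw
      -- The image of x τ is x' τ times a local Z(w). Multiplying by the preimage of Z(w) cancels
      -- it, as Z(w) squares to 1.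
      refine ⟨opW (x τ) 0 * g, Subgroup.mul_mem _ (hGx τ) hg, ?_⟩
      change blockTensor ι κ U * (matW (x τ) 0 * g.1) = matW (x' τ) 0 * _
      rw [← Matrix.mul_assoc, e, Matrix.mul_assoc, e', ← Matrix.mul_assoc, matW_mul_right,
        add_self_vec]
    · obtain ⟨w, hw, e⟩ := k2 ρ
      obtain ⟨g, hg, e'⟩ := k5 w hw
      refine ⟨opW 0 (z ρ) * g, Subgroup.mul_mem _ (hGz ρ) hg, ?_⟩
      change blockTensor ι κ U * (matW 0 (z ρ) * g.1) = matW 0 (z' ρ) * _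
      rw [← Matrix.mul_assoc, e, Matrix.mul_assoc, e', ← Matrix.mul_assoc, matW_zero_mul,
        add_assoc, add_self_vec, add_zero]
    · exact k5 w hw

end Tensor

/-! ## Homology of color-selected links -/

section Homology

set_option linter.unusedSectionVars false

variable {V : Type*} {d : ℕ} {L : AbstractSimplicialComplex V} {col : V → Fin (d + 1)}

theorem face_of_subset {s t : Finset V} (hs : s ∈ L.faces) (hts : t ⊆ s) (ht : t.Nonempty) :
    t ∈ L.faces :=
  (L.isRelLowerSet_faces hs).2 hts ht

theorem face_nonempty {s : Finset V} (hs : s ∈ L.faces) : s.Nonempty :=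
  (L.isRelLowerSet_faces hs).1

theorem IsColoring.injOn (hcol : IsColoring L col) {s : Finset V} (hs : s ∈ L.faces) {u v : V}
    (hu : u ∈ s) (hv : v ∈ s) (h : col u = col v) : u = v := by
  by_contra huv
  refine hcol u v huv (face_of_subset hs ?_ ⟨u, by simp⟩) h
  intro w hw
  rcases Finset.mem_insert.mp hw with rfl | hw
  · exact hu
  · rwa [Finset.mem_singleton.mp hw]

theorem IsColoring.card_image (hcol : IsColoring L col) {s : Finset V} (hs : s ∈ L.faces) :
    (s.image col).card = s.card :=
  Finset.card_image_of_injOn fun _ hu _ hv h => hcol.injOn hs hu hv h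

theorem IsColoring.card_image_of_subset (hcol : IsColoring L col) {s t : Finset V}
    (hs : s ∈ L.faces) (hts : t ⊆ s) : (t.image col).card = t.card :=
  Finset.card_image_of_injOn fun _ hu _ hv h => hcol.injOn hs (hts hu) (hts hv) h

variable [Fintype V]

/-- The boundary of a mod-2 chain, given as a function on all finite sets of vertices. -/
def bd (f : Finset V → ZMod 2) (t : Finset V) : ZMod 2 := ∑ v ∈ tᶜ, f (insert v t)

theorem bd_zero : bd (0 : Finset V → ZMod 2) = 0 := by
  funext t; simp [bd]

theorem bd_add (f g : Finset V → ZMod 2) : bd (f + g) = bd f + bd g := by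
  funext t; simp [bd, Finset.sum_add_distrib]

theorem bd_sum {ι : Type*} (s : Finset ι) (f : ι → Finset V → ZMod 2) :
    bd (∑ i ∈ s, f i) = ∑ i ∈ s, bd (f i) := by
  funext t
  simp only [bd, Finset.sum_apply]
  rw [Finset.sum_comm]

/-- `f` is a chain of the link of `σ` on simplices with `j` vertices and colors in `P`. -/
def IsLinkChain (L : AbstractSimplicialComplex V) (col : V → Fin (d + 1)) (σ : Finset V)
    (P : Finset (Fin (d + 1))) (j : ℕ) (f : Finset V → ZMod 2) : Prop :=
  ∀ s, f s ≠ 0 → s ∪ σ ∈ L.faces ∧ s.card = j ∧ ∀ v ∈ s, col v ∈ P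

/-- Translates the boundary on typed link faces into `bd`: the simplices with one vertex more that
contain t are the sets t ∪ {v} with v outside t. -/
theorem sum_linkFace_eq_bd (σ : Finset V) (j : ℕ) (f : Finset V → ZMod 2)
    (hf : ∀ s, f s ≠ 0 → s.card = j + 1 ∧ Disjoint s σ ∧ s ∪ σ ∈ L.faces) (t : Finset V)
    (ht : t.card = j) :
    (∑ s : LinkFace L σ (j + 1), if t ⊆ s.1 then f s.1 else 0) = bd f t := by
  have h1 : bd f t = ∑ s ∈ tᶜ.image (fun v => insert v t), f s := by
    rw [Finset.sum_image]
    · rfl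
    · intro u hu v hv h
      have hu' : u ∉ t := by simpa using hu
      have : u ∈ insert v t := by
        rw [← show insert u t = insert v t from h]; exact Finset.mem_insert_self u t
      exact (Finset.mem_insert.mp this).resolve_right hu'
  rw [h1, ← Finset.sum_subtype (Finset.univ.filter fun s : Finset V =>
    s.card = j + 1 ∧ Disjoint s σ ∧ s ∪ σ ∈ L.faces) (by simp)
    (fun s => if t ⊆ s then f s else 0), Finset.sum_filter,
    ← Finset.sum_ite_mem_eq (tᶜ.image fun v => insert v t)]
  refine Finset.sum_congr rfl fun s _ => ?_
  by_cases hs : f s = 0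
  · simp [hs]
  have e : t ⊆ s ↔ s ∈ tᶜ.image (fun v => insert v t) := by
    have := (Finset.exists_eq_insert_iff (s := t) (t := s)).symm
    rw [ht, (hf s hs).1] at this
    simpa using this
  rw [if_pos (hf s hs)]
  simp only [e]

theorem IsColoring.col_notMem (hcol : IsColoring L col) {σ s : Finset V} (hs : s ∪ σ ∈ L.faces)
    (hd : Disjoint s σ) {v : V} (hv : v ∈ s) : col v ∉ σ.image col := by
  intro h
  obtain ⟨u, hu, e⟩ := Finset.mem_image.mp h
  have := hcol.injOn hs (Finset.mem_union_right _ hu) (Finset.mem_union_left _ hv) e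
  exact Finset.disjoint_left.mp hd hv (this ▸ hu)

theorem IsLinkChain.disjoint {σ : Finset V} {P : Finset (Fin (d + 1))} {s : Finset V}
    (hP : Disjoint P (σ.image col)) (hs : ∀ v ∈ s, col v ∈ P) : Disjoint s σ := by
  rw [Finset.disjoint_left] at hP ⊢
  exact fun v hv hvσ => hP (hs v hv) (Finset.mem_image_of_mem col hvσ)

theorem mem_linkCycles {σ : Finset V} {j : ℕ} {f : Finset V → ZMod 2}
    (hf : ∀ s, f s ≠ 0 → s.card = j ∧ Disjoint s σ ∧ s ∪ σ ∈ L.faces)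
    (h : ∀ t : Finset V, t.card + 1 = j → Disjoint t σ → t ∪ σ ∈ L.faces → bd f t = 0) :
    (fun s : LinkFace L σ j => f s.1) ∈ linkCycles L σ j := by
  cases j with
  | zero => exact Submodule.mem_top
  | succ j =>
    change _ ∈ LinearMap.ker _
    rw [LinearMap.mem_ker]
    funext t
    change (∑ s : LinkFace L σ (j + 1), if t.1 ⊆ s.1 then f s.1 else 0) = 0
    rw [sum_linkFace_eq_bd σ j f hf t.1 t.2.1]
    exact h t.1 (by rw [t.2.1]) t.2.2.1 t.2.2.2

/-- The links of a closed homology manifold are acyclic below the top dimension. -/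
theorem exists_bd_eq_of_full (hclosed : IsClosedHomologyManifold L d) (hcol : IsColoring L col)
    {σ : Finset V} (hσ : σ ∈ L.faces) {j : ℕ} (hj : j + σ.card < d + 1) {f : Finset V → ZMod 2}
    (hf : IsLinkChain L col σ (σ.image col)ᶜ j f) (hbd : bd f = 0) :
    ∃ g, IsLinkChain L col σ (σ.image col)ᶜ (j + 1) g ∧ bd g = f := by
  have hdisj : ∀ s, f s ≠ 0 → s.card = j ∧ Disjoint s σ ∧ s ∪ σ ∈ L.faces := fun s hs =>
    ⟨(hf s hs).2.1, IsLinkChain.disjoint disjoint_compl_left (hf s hs).2.2, (hf s hs).1⟩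
  have hcyc := mem_linkCycles hdisj fun t _ _ _ => by rw [hbd]; rfl
  have h0 := hclosed σ hσ j
  rw [if_neg (by omega)] at h0
  have hsub : Subsingleton (LinkHomology L σ j) := Module.finrank_zero_iff.mp h0
  have hmem : (⟨_, hcyc⟩ : linkCycles L σ j) ∈
      (LinearMap.range (linkBoundary L σ j)).submoduleOf (linkCycles L σ j) := by
    rw [← Submodule.Quotient.mk_eq_zero]
    exact Subsingleton.elim _ _
  obtain ⟨g', hg'⟩ : ∃ g', linkBoundary L σ j g' = fun s : LinkFace L σ j => f s.1 := hmem
  let g : Finset V → ZMod 2 := fun s =>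
    if h : s.card = j + 1 ∧ Disjoint s σ ∧ s ∪ σ ∈ L.faces then g' ⟨s, h⟩ else 0
  have hg : ∀ s, g s ≠ 0 → s.card = j + 1 ∧ Disjoint s σ ∧ s ∪ σ ∈ L.faces := by
    intro s hs
    by_contra h
    exact hs (dif_neg h)
  refine ⟨g, fun s hs => ⟨(hg s hs).2.2, (hg s hs).1, fun v hv => ?_⟩, ?_⟩
  · rw [Finset.mem_compl]
    exact hcol.col_notMem (hg s hs).2.2 (hg s hs).2.1 hv
  · funext t
    by_cases ht : t.card = j ∧ Disjoint t σ ∧ t ∪ σ ∈ L.faces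
    · rw [← sum_linkFace_eq_bd σ j g hg t ht.1]
      have := congrFun hg' ⟨t, ht⟩
      rw [← this]
      refine Finset.sum_congr rfl fun s _ => ?_
      have : g s.1 = g' s := dif_pos s.2
      rw [this]
    · have hft : f t = 0 := by
        by_contra h
        exact ht (hdisj t h)
      rw [hft]
      refine Finset.sum_eq_zero fun v hv => ?_
      by_contra h
      obtain ⟨h1, h2, h3⟩ := hg _ h
      rw [Finset.card_insert_of_notMem (by simpa using hv)] at h1
      refine ht ⟨by omega, h2.mono_left (Finset.subset_insert v t), ?_⟩
      exact face_of_subset h3 (Finset.union_subset_union_left (Finset.subset_insert v t))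
        ((face_nonempty hσ).mono Finset.subset_union_right)

/-! ### Splitting a chain at a vertex, and acyclicity of color-selected subcomplexes. -/

/-- The part of a chain on the simplices containing `v`, as a chain of the link of `v`. -/
def linkPart (v : V) (g : Finset V → ZMod 2) : Finset V → ZMod 2 :=
  fun s => if v ∈ s then 0 else g (insert v s)

/-- The join of a chain with the vertex `v`. -/
def cone (v : V) (h : Finset V → ZMod 2) : Finset V → ZMod 2 :=
  fun s => if v ∈ s then h (s.erase v) else 0

theorem bd_linkPart (v : V) (g : Finset V → ZMod 2) (t : Finset V) :
    bd (linkPart v g) t = if v ∈ t then 0 else bd g (insert v t) := by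
  split_ifs with h
  · exact Finset.sum_eq_zero fun u _ => if_pos (Finset.mem_insert_of_mem h)
  · have e : tᶜ = insert v (insert v t)ᶜ := by
      rw [Finset.compl_insert, Finset.insert_erase (by simpa using h)]
    rw [bd, e, Finset.sum_insert (by simp), linkPart, if_pos (Finset.mem_insert_self v t), zero_add]
    refine Finset.sum_congr rfl fun u hu => ?_
    have hu' : u ∉ insert v t := by simpa using hu
    rw [linkPart, if_neg, Finset.insert_comm]
    rw [Finset.mem_insert, not_or] at hu' ⊢
    exact ⟨Ne.symm hu'.1, h⟩

theorem cone_linkPart (v : V) (g : Finset V → ZMod 2) (s : Finset V) :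
    cone v (linkPart v g) s = if v ∈ s then g s else 0 := by
  rw [cone]
  split_ifs with h
  · rw [linkPart, if_neg (Finset.notMem_erase v s), Finset.insert_erase h]
  · rfl

/-- The usual formula ∂(v * h) = h + v * ∂h modulo 2, for a chain h avoiding v. -/
theorem bd_cone (v : V) (h : Finset V → ZMod 2) (hv : ∀ s, v ∈ s → h s = 0) :
    bd (cone v h) = h + cone v (bd h) := by
  funext t
  rw [Pi.add_apply]
  by_cases ht : v ∈ t
  · rw [hv t ht, zero_add, cone, if_pos ht]
    have e : (t.erase v)ᶜ = insert v tᶜ := by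
      ext u; by_cases hu : u = v <;> simp [hu]
    rw [bd, bd, e, Finset.sum_insert (by simpa using ht), hv _ (Finset.mem_insert_self _ _), zero_add]
    refine Finset.sum_congr rfl fun u hu => ?_
    have hu' : u ∉ t := by simpa using hu
    have huv : u ≠ v := fun h => hu' (h ▸ ht)
    rw [cone, if_pos (Finset.mem_insert_of_mem ht), Finset.erase_insert_of_ne huv]
  · rw [cone, if_neg ht, add_zero, bd, Finset.sum_eq_single v]
    · rw [cone, if_pos (Finset.mem_insert_self v t), Finset.erase_insert ht]
    · intro u _ hu
      rw [cone, if_neg]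
      rw [Finset.mem_insert, not_or]
      exact ⟨Ne.symm hu, ht⟩
    · simp [ht]

theorem IsLinkChain.linkPart (hcol : IsColoring L col) {σ : Finset V} {P : Finset (Fin (d + 1))}
    {j : ℕ} {g : Finset V → ZMod 2} {v : V}
    (hg : IsLinkChain L col σ (insert (col v) P) (j + 1) g) :
    IsLinkChain L col (insert v σ) P j (linkPart v g) := by
  intro s hs
  have hvs : v ∉ s := fun h => hs (if_pos h)
  rw [UnfoldingColorCode.linkPart, if_neg hvs] at hs
  obtain ⟨h1, h2, h3⟩ := hg _ hs
  have e : insert v s ∪ σ = s ∪ insert v σ := by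
    rw [Finset.insert_union, Finset.union_insert]
  refine ⟨e ▸ h1, ?_, fun u hu => ?_⟩
  · rw [Finset.card_insert_of_notMem hvs] at h2; omega
  · refine (Finset.mem_insert.mp (h3 u (Finset.mem_insert_of_mem hu))).resolve_left fun h => hvs ?_
    have := hcol.injOn h1 (Finset.mem_union_left _ (Finset.mem_insert_of_mem hu))
      (Finset.mem_union_left _ (Finset.mem_insert_self v s)) h
    exact this ▸ hu

/-- Taking the link part at v commutes with the boundary, and a boundary f without vertices of the
color of v has no part at v. -/
theorem IsLinkChain.bd_linkPart_eq_zero {P : Finset (Fin (d + 1))} {f g : Finset V → ZMod 2}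
    {v : V} (hv : col v ∉ P) (hf : ∀ s, f s ≠ 0 → ∀ u ∈ s, col u ∈ P) (h : bd g = f) :
    bd (UnfoldingColorCode.linkPart v g) = 0 := by
  funext t
  rw [bd_linkPart]
  split_ifs
  · rfl
  · rw [h]
    by_contra h'
    exact hv (hf _ h' v (Finset.mem_insert_self v t))

theorem insert_mem_faces_of_linkPart_ne_zero {σ : Finset V} (hcol : IsColoring L col)
    {P : Finset (Fin (d + 1))} {j : ℕ} {g : Finset V → ZMod 2} {v : V}
    (hg : IsLinkChain L col σ (insert (col v) P) (j + 1) g) (h : linkPart v g ≠ 0) :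
    insert v σ ∈ L.faces := by
  obtain ⟨s, hs⟩ := Function.ne_iff.mp h
  exact face_of_subset (hg.linkPart hcol s hs).1 Finset.subset_union_right
    (Finset.insert_nonempty _ _)

theorem card_compl_union_image_insert {P : Finset (Fin (d + 1))} {σ : Finset V} {v : V} {n : ℕ}
    (hv : col v ∉ P ∪ σ.image col) (h : (P ∪ σ.image col)ᶜ.card = n + 1) :
    (P ∪ (insert v σ).image col)ᶜ.card = n := by
  rw [Finset.image_insert, Finset.union_insert, Finset.compl_insert,
    Finset.card_erase_of_mem (Finset.mem_compl.mpr hv), h, Nat.add_sub_cancel]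

theorem card_compl_insert_union_image {P : Finset (Fin (d + 1))} {σ : Finset V}
    {e : Fin (d + 1)} {n : ℕ}
    (hv : e ∉ P ∪ σ.image col) (h : (P ∪ σ.image col)ᶜ.card = n + 1) :
    (insert e P ∪ σ.image col)ᶜ.card = n := by
  rw [Finset.insert_union, Finset.compl_insert,
    Finset.card_erase_of_mem (Finset.mem_compl.mpr hv), h, Nat.add_sub_cancel]

/-- The subcomplexes of a link spanned by the vertices with colors in `P` are acyclic below the top
dimension. -/
theorem exists_bd_eq (hclosed : IsClosedHomologyManifold L d) (hcol : IsColoring L col) (n : ℕ) :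
    ∀ (σ : Finset V) (P : Finset (Fin (d + 1))), σ ∈ L.faces → Disjoint P (σ.image col) →
      (P ∪ σ.image col)ᶜ.card = n → ∀ j < P.card, ∀ f : Finset V → ZMod 2,
      IsLinkChain L col σ P j f → bd f = 0 → ∃ g, IsLinkChain L col σ P (j + 1) g ∧ bd g = f := by
  induction n with
  | zero =>
    intro σ P hσ hP hn j hj f hf hbd
    -- With no color left out, the selected subcomplex is the whole link, where acyclicity is the
    -- manifold hypothesis.
    have hPc : P = (σ.image col)ᶜ := by
      have h1 : P ∪ σ.image col = Finset.univ := by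
        rwa [Finset.card_eq_zero, Finset.compl_eq_empty_iff] at hn
      exact (IsCompl.of_eq (disjoint_iff.mp hP) h1).eq_compl
    have hc : P.card + σ.card = d + 1 := by
      rw [hPc, Finset.card_compl, hcol.card_image hσ, Fintype.card_fin]
      have := Finset.card_le_univ (σ.image col)
      rw [hcol.card_image hσ, Fintype.card_fin] at this
      omega
    subst hPc
    exact exists_bd_eq_of_full hclosed hcol hσ (by omega) hf hbd
  | succ n ih =>
    intro σ P hσ hP hn j hj f hf hbd
    obtain ⟨e, he⟩ : (P ∪ σ.image col)ᶜ.Nonempty := by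
      rw [← Finset.card_pos]; omega
    rw [Finset.mem_compl] at he
    have heP : e ∉ P := fun h => he (Finset.mem_union_left _ h)
    have heσ : e ∉ σ.image col := fun h => he (Finset.mem_union_right _ h)
    -- First f is filled using one additional color e; the vertices of color e must then be removed
    -- from the filling.
    obtain ⟨g, hg, hgf⟩ := ih σ (insert e P) hσ (by
      rw [Finset.disjoint_insert_left]; exact ⟨heσ, hP⟩)
      (card_compl_insert_union_image he hn) j
      (by rw [Finset.card_insert_of_notMem heP]; omega) f
      (fun s hs => ⟨(hf s hs).1, (hf s hs).2.1,
        fun v hv => Finset.mem_insert_of_mem ((hf s hs).2.2 v hv)⟩) hbd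
    -- At each vertex v of color e the link part of g is a cycle of the P-colored link of σ ∪ {v},
    -- and the induction hypothesis fills it there. A zero link part is treated apart, because σ ∪
    -- {v} need not be a simplex then.
    have key : ∀ v, ∃ h, col v = e → IsLinkChain L col (insert v σ) P (j + 1) h ∧
        bd h = linkPart v g := by
      intro v
      by_cases hv : col v = e
      swap
      · exact ⟨0, fun h => absurd h hv⟩
      subst hv
      by_cases h0 : linkPart v g = 0
      · exact ⟨0, fun _ => ⟨fun s hs => absurd rfl hs, by rw [h0, bd_zero]⟩⟩
      · have hface := insert_mem_faces_of_linkPart_ne_zero hcol hg h0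
        obtain ⟨h, hh⟩ := ih (insert v σ) P hface (by
          rw [Finset.image_insert, Finset.disjoint_insert_right]; exact ⟨heP, hP⟩)
          (card_compl_union_image_insert he hn) j hj (linkPart v g) (hg.linkPart hcol)
          (IsLinkChain.bd_linkPart_eq_zero heP (fun s hs => (hf s hs).2.2) hgf)
        exact ⟨h, fun _ => hh⟩
    choose h hh using key
    let E : Finset V := Finset.univ.filter fun v => col v = e
    have hE : ∀ v ∈ E, col v = e := fun v hv => by simpa [E] using hv
    -- Each cone from v over its link part is replaced by the filling `h v`, which has the same
    -- boundary.
    refine ⟨g + ∑ v ∈ E, (h v + cone v (linkPart v g)), ?_, ?_⟩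
    · intro s hs
      by_cases hs' : ∃ v ∈ E, h v s ≠ 0
      · obtain ⟨v, hv, hvs⟩ := hs'
        obtain ⟨h1, h2, h3⟩ := (hh v (hE v hv)).1 s hvs
        exact ⟨face_of_subset h1 (Finset.union_subset_union_right (Finset.subset_insert v σ))
          ((face_nonempty hσ).mono Finset.subset_union_right), h2, h3⟩
      · push Not at hs'
        have hsum : (g + ∑ v ∈ E, (h v + cone v (linkPart v g))) s =
            g s + ∑ v ∈ E, if v ∈ s then g s else 0 := by
          rw [Pi.add_apply, Finset.sum_apply]
          congr 1
          refine Finset.sum_congr rfl fun v hv => ?_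
          rw [Pi.add_apply, hs' v hv, zero_add, cone_linkPart]
        rw [hsum] at hs
        have hgs : g s ≠ 0 := fun h0 => hs (by simp [h0])
        obtain ⟨h1, h2, h3⟩ := hg s hgs
        refine ⟨h1, h2, fun v hv => (Finset.mem_insert.mp (h3 v hv)).resolve_left fun hve => ?_⟩
        apply hs
        -- A simplex has at most one vertex of color e, so its coefficient is removed exactly once.
        rw [Finset.sum_eq_single v]
        · rw [if_pos hv, CharTwo.add_self_eq_zero]
        · intro u hu huv
          rw [if_neg]
          intro hus
          exact huv (hcol.injOn h1 (Finset.mem_union_left _ hus) (Finset.mem_union_left _ hv)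
            ((hE u hu).trans hve.symm))
        · intro hvE
          exact absurd (by simp [E, hve]) hvE
    · rw [bd_add, bd_sum, hgf, Finset.sum_eq_zero, add_zero]
      intro v hv
      have hve := hE v hv
      have h1 : bd (linkPart v g) = 0 :=
        IsLinkChain.bd_linkPart_eq_zero (hve ▸ heP) (fun s hs => (hf s hs).2.2) hgf
      rw [bd_add, (hh v hve).2, bd_cone v (linkPart v g) fun s hs => if_pos hs, h1]
      funext s
      simp [cone, CharTwo.add_self_eq_zero]

end Homology

/-! ## Top cycles of links and duality -/

section Duality

set_option linter.unusedSectionVars false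

variable {V : Type*} {d : ℕ} {L : AbstractSimplicialComplex V} {col : V → Fin (d + 1)} [Fintype V]

/-- Homogeneity excludes simplices above the top dimension, so nothing is divided out and the
homology is the space of cycles itself. -/
theorem finrank_linkCycles_top (hL : IsHomogeneousComplex L d)
    (hclosed : IsClosedHomologyManifold L d) {σ : Finset V} (hσ : σ ∈ L.faces) {j : ℕ}
    (hj : j + σ.card = d + 1) : Module.finrank (ZMod 2) (linkCycles L σ j) = 1 := by
  have hempty : IsEmpty (LinkFace L σ (j + 1)) := by
    refine ⟨fun s => ?_⟩
    have h1 := hL.2.1 _ s.2.2.2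
    rw [Finset.card_union_of_disjoint s.2.2.1, s.2.1] at h1
    omega
  have hrange : LinearMap.range (linkBoundary L σ j) = ⊥ := by
    rw [eq_bot_iff]
    rintro _ ⟨g, rfl⟩
    rw [Subsingleton.elim g 0, map_zero]
    exact Submodule.zero_mem _
  have h0 := hclosed σ hσ j
  rw [if_pos hj] at h0
  have h1 := Submodule.finrank_quotient_add_finrank
    ((LinearMap.range (linkBoundary L σ j)).submoduleOf (linkCycles L σ j))
  have h2 : (LinearMap.range (linkBoundary L σ j)).submoduleOf (linkCycles L σ j) = ⊥ := by
    rw [hrange, Submodule.submoduleOf, Submodule.comap_bot, Submodule.ker_subtype]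
  have h3 : Module.finrank (ZMod 2)
      ((LinearMap.range (linkBoundary L σ j)).submoduleOf (linkCycles L σ j)) = 0 := by
    rw [h2, finrank_bot]
  change Module.finrank (ZMod 2) (LinkHomology L σ j) + _ = _ at h1
  omega

/-- A simplex of codimension one lies in exactly two top simplices. -/
theorem ridge_card (hL : IsHomogeneousComplex L d) (hclosed : IsClosedHomologyManifold L d)
    {r : Finset V} (hr : r ∈ L.faces) (hcard : r.card = d) :
    (Finset.univ.filter fun v => v ∉ r ∧ insert v r ∈ L.faces).card = 2 := by
  have h1 : Module.finrank (ZMod 2) (LinearMap.ker (linkBoundary L r 0)) = 1 :=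
    finrank_linkCycles_top hL hclosed hr (j := 1) (by omega)
  have h2 := LinearMap.finrank_range_add_finrank_ker (linkBoundary L r 0)
  rw [h1, Module.finrank_fintype_fun_eq_card] at h2
  have h3 : Module.finrank (ZMod 2) (LinearMap.range (linkBoundary L r 0)) ≤ 1 := by
    refine (Submodule.finrank_le _).trans ?_
    rw [Module.finrank_fintype_fun_eq_card, Fintype.card_le_one_iff]
    intro a b
    exact Subtype.ext ((Finset.card_eq_zero.mp a.2.1).trans (Finset.card_eq_zero.mp b.2.1).symm)
  -- The augmentation sends a single vertex to 1, so its rank is 1; its kernel has dimension 1,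
  -- hence the link has two vertices.
  have h4 : Module.finrank (ZMod 2) (LinearMap.range (linkBoundary L r 0)) ≠ 0 := by
    intro h
    have hbot := Submodule.finrank_eq_zero.mp h
    have : Nonempty (LinkFace L r (0 + 1)) := by
      rw [← Fintype.card_pos_iff]; omega
    obtain ⟨s⟩ := this
    have hmem : linkBoundary L r 0 (Pi.single s 1) ∈ LinearMap.range (linkBoundary L r 0) :=
      ⟨_, rfl⟩
    rw [hbot, Submodule.mem_bot] at hmem
    have := congrFun hmem ⟨∅, rfl, Finset.disjoint_empty_left r, by simpa using hr⟩
    change (∑ s' : LinkFace L r (0 + 1), if ∅ ⊆ s'.1 then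
      (Pi.single s 1 : LinkFace L r (0 + 1) → ZMod 2) s' else 0) = 0 at this
    simp at this
  have h5 : Fintype.card (LinkFace L r (0 + 1)) = 2 := by omega
  rw [← h5, Fintype.card_subtype]
  refine Finset.card_bij (fun v _ => {v}) ?_ ?_ ?_
  · intro v hv
    simp only [Finset.mem_filter, Finset.mem_univ, true_and] at hv ⊢
    refine ⟨Finset.card_singleton v, Finset.disjoint_singleton_left.mpr hv.1, ?_⟩
    rw [Finset.singleton_union]
    exact hv.2
  · intro u _ v _ h
    exact Finset.singleton_injective h
  · intro s hs
    simp only [Finset.mem_filter, Finset.mem_univ, true_and] at hs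
    obtain ⟨v, rfl⟩ := Finset.card_eq_one.mp hs.1
    refine ⟨v, ?_, rfl⟩
    simp only [Finset.mem_filter, Finset.mem_univ, true_and]
    refine ⟨Finset.disjoint_singleton_left.mp hs.2.1, ?_⟩
    rw [← Finset.singleton_union]
    exact hs.2.2

/-- The top cycles of a link are constant. -/
theorem exists_const_of_cycle (hL : IsHomogeneousComplex L d)
    (hclosed : IsClosedHomologyManifold L d) {σ : Finset V} (hσ : σ ∈ L.faces) {j : ℕ}
    (hj : j + σ.card = d + 1) {f : Finset V → ZMod 2}
    (hf : ∀ s, f s ≠ 0 → s.card = j ∧ Disjoint s σ ∧ s ∪ σ ∈ L.faces) (hbd : bd f = 0) :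
    ∃ a, ∀ s, s.card = j → Disjoint s σ → s ∪ σ ∈ L.faces → f s = a := by
  -- The sum of all top simplices of the link. It is a cycle because each ridge has two cofaces, and
  -- it is nonzero by homogeneity, so it spans the one-dimensional space of top cycles.
  let o : Finset V → ZMod 2 := fun s =>
    if s.card = j ∧ Disjoint s σ ∧ s ∪ σ ∈ L.faces then 1 else 0
  have ho : ∀ s, o s ≠ 0 → s.card = j ∧ Disjoint s σ ∧ s ∪ σ ∈ L.faces := by
    intro s hs
    by_contra h
    exact hs (if_neg h)
  have hfc := mem_linkCycles hf fun t _ _ _ => by rw [hbd]; rfl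
  have hoc := mem_linkCycles ho fun t ht1 ht2 ht3 => by
    have e : bd o t = ((tᶜ.filter fun v =>
        (insert v t).card = j ∧ Disjoint (insert v t) σ ∧ insert v t ∪ σ ∈ L.faces).card :
          ZMod 2) := by
      rw [bd, Finset.card_filter, Nat.cast_sum]
      exact Finset.sum_congr rfl fun v _ => by simp [o]
    have e' : (tᶜ.filter fun v =>
        (insert v t).card = j ∧ Disjoint (insert v t) σ ∧ insert v t ∪ σ ∈ L.faces) =
        Finset.univ.filter fun v => v ∉ t ∪ σ ∧ insert v (t ∪ σ) ∈ L.faces := by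
      ext v
      simp only [Finset.mem_filter, Finset.mem_compl, Finset.mem_univ, true_and,
        Finset.disjoint_insert_left, Finset.insert_union, Finset.mem_union, not_or]
      constructor
      · rintro ⟨h1, -, h2, h3⟩
        exact ⟨⟨h1, h2.1⟩, h3⟩
      · rintro ⟨⟨h1, h2⟩, h3⟩
        exact ⟨h1, by rw [Finset.card_insert_of_notMem h1, ht1], ⟨h2, ht2⟩, h3⟩
    rw [e, e', ridge_card hL hclosed ht3 (by rw [Finset.card_union_of_disjoint ht2]; omega)]
    rfl
  have h1 := finrank_linkCycles_top hL hclosed hσ hj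
  have hne : (⟨_, hoc⟩ : linkCycles L σ j) ≠ 0 := by
    obtain ⟨τ, hτ, hτc, hστ⟩ := hL.2.2 σ hσ
    have hτσ : τ \ σ ∪ σ = τ := Finset.sdiff_union_of_subset hστ
    have hmem : (τ \ σ).card = j ∧ Disjoint (τ \ σ) σ ∧ τ \ σ ∪ σ ∈ L.faces := by
      refine ⟨?_, Finset.sdiff_disjoint, hτσ.symm ▸ hτ⟩
      rw [Finset.card_sdiff_of_subset hστ]; omega
    intro h
    have := congrFun (congrArg Subtype.val h) ⟨τ \ σ, hmem⟩
    change o (τ \ σ) = 0 at this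
    rw [show o (τ \ σ) = 1 from if_pos hmem] at this
    exact one_ne_zero this
  obtain ⟨c, hc⟩ := (finrank_eq_one_iff_of_nonzero' _ hne).mp h1 ⟨_, hfc⟩
  refine ⟨c, fun s h2 h3 h4 => ?_⟩
  have := congrFun (congrArg Subtype.val hc) ⟨s, h2, h3, h4⟩
  change c * o s = f s at this
  rw [← this, show o s = 1 from if_pos ⟨h2, h3, h4⟩, mul_one]

theorem IsColoring.card_eq_of_image_eq (hcol : IsColoring L col) {σ s : Finset V}
    {P : Finset (Fin (d + 1))} (hs : s ∪ σ ∈ L.faces) (hP : s.image col = P) : s.card = P.card := by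
  rw [← hP, hcol.card_image_of_subset hs Finset.subset_union_left]

/-- The top cycles of the color-selected subcomplexes of a link are combinations of links of
simplices with the complementary colors. -/
theorem exists_link_combination (hL : IsHomogeneousComplex L d)
    (hclosed : IsClosedHomologyManifold L d) (hcol : IsColoring L col) (n : ℕ) :
    ∀ (σ : Finset V) (P : Finset (Fin (d + 1))), σ ∈ L.faces → Disjoint P (σ.image col) →
      (P ∪ σ.image col)ᶜ.card = n → ∀ f : Finset V → ZMod 2,
      IsLinkChain L col σ P P.card f → bd f = 0 →
      ∃ a : Finset V → ZMod 2, ∀ s, s.image col = P → f s =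
        ∑ τ ∈ Finset.univ.filter (fun τ : Finset V =>
          τ.image col = (P ∪ σ.image col)ᶜ ∧ s ∪ τ ∪ σ ∈ L.faces), a τ := by
  induction n with
  | zero =>
    intro σ P hσ hP hn f hf hbd
    have h1 : P ∪ σ.image col = Finset.univ := by
      rwa [Finset.card_eq_zero, Finset.compl_eq_empty_iff] at hn
    have hc : P.card + σ.card = d + 1 := by
      rw [← hcol.card_image hσ, ← Finset.card_union_of_disjoint hP, h1, Finset.card_univ,
        Fintype.card_fin]
    have hf' : ∀ s, f s ≠ 0 → s.card = P.card ∧ Disjoint s σ ∧ s ∪ σ ∈ L.faces := fun s hs =>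
      ⟨(hf s hs).2.1, IsLinkChain.disjoint hP (hf s hs).2.2, (hf s hs).1⟩
    obtain ⟨a, ha⟩ := exists_const_of_cycle hL hclosed hσ hc hf' hbd
    refine ⟨fun _ => a, fun s hs => ?_⟩
    have e : (P ∪ σ.image col)ᶜ = ∅ := Finset.card_eq_zero.mp hn
    by_cases hsL : s ∪ σ ∈ L.faces
    · rw [Finset.sum_eq_single ∅]
      · exact ha s (hcol.card_eq_of_image_eq hsL hs)
          (IsLinkChain.disjoint hP fun v hv => hs ▸ Finset.mem_image_of_mem col hv) hsL
      · intro τ hτ hτ0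
        rw [Finset.mem_filter, e, Finset.image_eq_empty] at hτ
        exact absurd hτ.2.1 hτ0
      · intro h
        refine absurd ?_ h
        rw [Finset.mem_filter, e]
        simpa using hsL
    · have h0 : f s = 0 := by
        by_contra h
        exact hsL (hf s h).1
      rw [h0, Finset.sum_eq_zero]
      intro τ hτ
      rw [Finset.mem_filter, e, Finset.image_eq_empty] at hτ
      obtain ⟨-, rfl, h⟩ := hτ
      exact absurd (by simpa using h) hsL
  | succ n ih =>
    intro σ P hσ hP hn f hf hbd
    obtain ⟨e, he⟩ : (P ∪ σ.image col)ᶜ.Nonempty := by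
      rw [← Finset.card_pos]; omega
    have heQ := he
    rw [Finset.mem_compl] at he
    have heP : e ∉ P := fun h => he (Finset.mem_union_left _ h)
    have heσ : e ∉ σ.image col := fun h => he (Finset.mem_union_right _ h)
    -- A top cycle for P lies below the top dimension once a color e is added, so it bounds a chain
    -- g.
    obtain ⟨g, hg, hgf⟩ := exists_bd_eq hclosed hcol n σ (insert e P) hσ (by
      rw [Finset.disjoint_insert_left]; exact ⟨heσ, hP⟩)
      (card_compl_insert_union_image he hn) P.card
      (by rw [Finset.card_insert_of_notMem heP]; omega) f
      (fun s hs => ⟨(hf s hs).1, (hf s hs).2.1,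
        fun v hv => Finset.mem_insert_of_mem ((hf s hs).2.2 v hv)⟩) hbd
    have hcompl : ∀ v, col v = e →
        (P ∪ (insert v σ).image col)ᶜ = (P ∪ σ.image col)ᶜ.erase e := by
      rintro v rfl
      rw [Finset.image_insert, Finset.union_insert, Finset.compl_insert]
    have key : ∀ v, ∃ a : Finset V → ZMod 2, col v = e → ∀ s, s.image col = P → linkPart v g s =
        ∑ τ ∈ Finset.univ.filter (fun τ : Finset V =>
          τ.image col = (P ∪ σ.image col)ᶜ.erase e ∧ s ∪ τ ∪ insert v σ ∈ L.faces), a τ := by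
      intro v
      by_cases hv : col v = e
      swap
      · exact ⟨0, fun h => absurd h hv⟩
      by_cases h0 : linkPart v g = 0
      · exact ⟨0, fun _ s _ => by rw [h0]; simp⟩
      · rw [← hcompl v hv]
        subst hv
        have hface := insert_mem_faces_of_linkPart_ne_zero hcol hg h0
        obtain ⟨a, ha⟩ := ih (insert v σ) P hface (by
          rw [Finset.image_insert, Finset.disjoint_insert_right]; exact ⟨heP, hP⟩)
          (card_compl_union_image_insert he hn) (linkPart v g) (hg.linkPart hcol)
          (IsLinkChain.bd_linkPart_eq_zero heP (fun s hs => (hf s hs).2.2) hgf)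
        exact ⟨a, fun _ => ha⟩
    choose a ha using key
    let E : Finset V := Finset.univ.filter fun v => col v = e
    have hE : ∀ v, v ∈ E ↔ col v = e := fun v => by simp [E]
    -- The coefficient of τ is the one that its vertex of color e assigns to the rest of τ by
    -- induction.
    refine ⟨fun τ => ∑ v ∈ E, if v ∈ τ then a v (τ.erase v) else 0, fun s hs => ?_⟩
    have hEs : E ⊆ sᶜ := by
      intro v hv
      rw [Finset.mem_compl]
      intro hvs
      exact heP (hs ▸ (hE v).mp hv ▸ Finset.mem_image_of_mem col hvs)
    -- Only a vertex of color e can extend s in the boundary of g: s already has all the colors of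
    -- P, and colors do not repeat in a simplex.
    have h1 : f s = ∑ v ∈ E, linkPart v g s := by
      rw [← hgf, bd, ← Finset.sum_subset hEs]
      · refine Finset.sum_congr rfl fun v hv => ?_
        rw [linkPart, if_neg (Finset.mem_compl.mp (hEs hv))]
      · intro v hv hvE
        by_contra h
        obtain ⟨h1, h2, h3⟩ := hg _ h
        have hvP : col v ∈ P := (Finset.mem_insert.mp (h3 v (Finset.mem_insert_self v s))).resolve_left
          fun h => hvE ((hE v).mpr h)
        have h4 := hcol.card_image_of_subset h1 (t := insert v s) Finset.subset_union_left
        rw [Finset.image_insert, hs, Finset.insert_eq_of_mem hvP, h2] at h4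
        omega
    rw [h1, Finset.sum_comm]
    refine Finset.sum_congr rfl fun v hv => ?_
    have hve := (hE v).mp hv
    rw [ha v hve s hs, ← Finset.sum_filter]
    refine Finset.sum_nbij' (fun τ => insert v τ) (fun τ => τ.erase v) ?_ ?_ ?_ ?_ ?_
    · intro τ hτ
      simp only [Finset.mem_filter, Finset.mem_univ, true_and] at hτ ⊢
      refine ⟨⟨?_, ?_⟩, Finset.mem_insert_self v τ⟩
      · rw [Finset.image_insert, hτ.1, hve, Finset.insert_erase heQ]
      · have : s ∪ insert v τ ∪ σ = s ∪ τ ∪ insert v σ := by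
          ext u; simp only [Finset.mem_union, Finset.mem_insert]; tauto
        rw [this]; exact hτ.2
    · intro τ hτ
      simp only [Finset.mem_filter, Finset.mem_univ, true_and] at hτ ⊢
      obtain ⟨⟨h2, h3⟩, hvτ⟩ := hτ
      refine ⟨?_, ?_⟩
      · rw [← h2]
        ext c
        simp only [Finset.mem_image, Finset.mem_erase]
        constructor
        · rintro ⟨u, ⟨huv, hu⟩, rfl⟩
          refine ⟨fun h => huv ?_, u, hu, rfl⟩
          exact hcol.injOn h3 (by simp [hu]) (by simp [hvτ]) (h.trans hve.symm)
        · rintro ⟨hc, u, hu, rfl⟩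
          exact ⟨u, ⟨fun h => hc (h ▸ hve), hu⟩, rfl⟩
      · have : s ∪ τ.erase v ∪ insert v σ = s ∪ τ ∪ σ := by
          ext u
          simp only [Finset.mem_union, Finset.mem_insert, Finset.mem_erase]
          by_cases huv : u = v
          · subst huv; simp [hvτ]
          · simp [huv]
        rw [this]; exact h3
    · intro τ hτ
      simp only [Finset.mem_filter, Finset.mem_univ, true_and] at hτ
      refine Finset.erase_insert fun h => ?_
      have h5 := Finset.mem_image_of_mem col h
      rw [hτ.1, hve] at h5
      exact Finset.notMem_erase _ _ h5
    · intro τ hτ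
      exact Finset.insert_erase (Finset.mem_filter.mp hτ).2
    · intro τ hτ
      simp only [Finset.mem_filter, Finset.mem_univ, true_and] at hτ
      rw [Finset.erase_insert]
      intro h
      have h5 := Finset.mem_image_of_mem col h
      rw [hτ.1, hve] at h5
      exact Finset.notMem_erase _ _ h5

/-- The coboundary is adjoint to the boundary. -/
theorem sum_mul_coboundary (f b : Finset V → ZMod 2) :
    ∑ s, f s * ∑ v ∈ s, b (s.erase v) = ∑ t, bd f t * b t := by
  have h1 : ∀ s : Finset V, f s * ∑ v ∈ s, b (s.erase v) =
      ∑ v, if v ∈ s then f s * b (s.erase v) else 0 := fun s => by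
    rw [Finset.mul_sum, Finset.sum_ite_mem_eq]
  have h2 : ∀ t : Finset V, bd f t * b t = ∑ v, if v ∈ tᶜ then f (insert v t) * b t else 0 :=
    fun t => by rw [bd, Finset.sum_mul, Finset.sum_ite_mem_eq]
  simp only [h1, h2]
  rw [Finset.sum_comm, Finset.sum_comm (s := Finset.univ (α := Finset V))]
  refine Finset.sum_congr rfl fun v _ => ?_
  rw [← Finset.sum_filter, ← Finset.sum_filter]
  refine Finset.sum_nbij' (fun s => s.erase v) (fun t => insert v t) ?_ ?_ ?_ ?_ ?_
  · intro s _; simp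
  · intro t _; simp
  · intro s hs; exact Finset.insert_erase (Finset.mem_filter.mp hs).2
  · intro t ht
    exact Finset.erase_insert (by simpa using ht)
  · intro s hs
    rw [Finset.insert_erase (Finset.mem_filter.mp hs).2]

/-- A top cochain of a color-selected subcomplex of a link is a coboundary if it is orthogonal to
the links of the simplices with the complementary colors. -/
theorem exists_coboundary (hL : IsHomogeneousComplex L d)
    (hclosed : IsClosedHomologyManifold L d) (hcol : IsColoring L col) {σ : Finset V}
    (hσ : σ ∈ L.faces) {P : Finset (Fin (d + 1))} (hP : Disjoint P (σ.image col))
    (g : Finset V → ZMod 2)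
    (hg : ∀ τ : Finset V, τ.image col = (P ∪ σ.image col)ᶜ →
      ∑ s ∈ Finset.univ.filter (fun s : Finset V => s.image col = P ∧ s ∪ τ ∪ σ ∈ L.faces),
        g s = 0) :
    ∃ b : Finset V → ZMod 2, ∀ s, s.image col = P → s ∪ σ ∈ L.faces →
      g s = ∑ v ∈ s, b (s.erase v) := by
  let F := {s : Finset V // s.image col = P ∧ s ∪ σ ∈ L.faces}
  let B : (Finset V → ZMod 2) →ₗ[ZMod 2] (F → ZMod 2) :=
    { toFun := fun b s => ∑ v ∈ s.1, b (s.1.erase v)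
      map_add' := fun b c => by funext s; simp [Finset.sum_add_distrib]
      map_smul' := fun r b => by funext s; simp [Finset.mul_sum] }
  by_cases hmem : (fun s : F => g s.1) ∈ LinearMap.range B
  · obtain ⟨b, hb⟩ := hmem
    exact ⟨b, fun s h1 h2 => (congrFun hb ⟨s, h1, h2⟩).symm⟩
  · exfalso
    -- If g is no coboundary, some functional vanishes on all coboundaries but not on g. Read as a
    -- chain f it is a cycle, hence a sum of links of complementary simplices, and these all pair to
    -- zero with g.
    obtain ⟨φ, hφ, hker⟩ := Submodule.exists_le_ker_of_notMem hmem
    let ε : F → F → ZMod 2 := fun s s' => if s' = s then 1 else 0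
    let f : Finset V → ZMod 2 := fun s =>
      if h : s.image col = P ∧ s ∪ σ ∈ L.faces then φ (ε ⟨s, h⟩) else 0
    have hfF : ∀ s, f s ≠ 0 → s.image col = P ∧ s ∪ σ ∈ L.faces := by
      intro s hs
      by_contra h
      exact hs (dif_neg h)
    have hφf : ∀ h : Finset V → ZMod 2, φ (fun s : F => h s.1) = ∑ s, f s * h s := by
      intro h
      have e : (fun s : F => h s.1) = ∑ s : F, h s.1 • ε s := by
        funext s
        rw [Finset.sum_apply, Finset.sum_eq_single s]
        · simp [ε]
        · intro s' _ hs'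
          simp [ε, Ne.symm hs']
        · intro hs
          exact absurd (Finset.mem_univ s) hs
      rw [e, map_sum]
      have e2 : ∀ s : F, φ (h s.1 • ε s) = f s.1 * h s.1 := by
        intro s
        rw [map_smul, smul_eq_mul, mul_comm]
        congr 1
        have hs : f s.1 = φ (ε ⟨s.1, s.2⟩) := dif_pos s.2
        exact hs.symm
      simp only [e2]
      rw [← Finset.sum_subtype (Finset.univ.filter fun s : Finset V =>
        s.image col = P ∧ s ∪ σ ∈ L.faces) (by simp) fun s => f s * h s, Finset.sum_filter]
      refine Finset.sum_congr rfl fun s _ => ?_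
      split_ifs with hs
      · rfl
      · rw [show f s = 0 from dif_neg hs, zero_mul]
    have hbd : bd f = 0 := by
      funext t
      -- By adjointness the value of φ on the coboundary of the indicator of t is the boundary of f
      -- at t.
      have h1 : φ (B (Pi.single t 1)) = 0 := hker ⟨_, rfl⟩
      have h2 := hφf fun s => ∑ v ∈ s, (Pi.single t 1 : Finset V → ZMod 2) (s.erase v)
      rw [sum_mul_coboundary] at h2
      have h3 : ∑ t', bd f t' * (Pi.single t 1 : Finset V → ZMod 2) t' = bd f t := by
        simp [Pi.single_apply]
      rw [h3] at h2
      exact h2.symm.trans h1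
    obtain ⟨a, ha⟩ := exists_link_combination hL hclosed hcol _ σ P hσ hP rfl f
      (fun s hs => ⟨(hfF s hs).2, hcol.card_eq_of_image_eq (hfF s hs).2 (hfF s hs).1,
        fun v hv => (hfF s hs).1 ▸ Finset.mem_image_of_mem col hv⟩) hbd
    apply hφ
    rw [hφf g]
    have h1 : ∀ s, f s * g s = ∑ τ, if (s.image col = P ∧ s ∪ τ ∪ σ ∈ L.faces) ∧
        τ.image col = (P ∪ σ.image col)ᶜ then a τ * g s else 0 := by
      intro s
      by_cases hs : s.image col = P
      · rw [ha s hs, Finset.sum_mul, Finset.sum_filter]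
        refine Finset.sum_congr rfl fun τ _ => ?_
        simp only [hs, true_and, and_comm]
      · have : f s = 0 := by
          by_contra h
          exact hs (hfF s h).1
        simp [this, hs]
    simp only [h1]
    rw [Finset.sum_comm]
    refine Finset.sum_eq_zero fun τ _ => ?_
    by_cases hτ : τ.image col = (P ∪ σ.image col)ᶜ
    · simp only [hτ, and_true]
      rw [← Finset.sum_filter, ← Finset.mul_sum, hg τ hτ, mul_zero]
    · exact Finset.sum_eq_zero fun s _ => if_neg fun h => hτ h.2

end Duality

/-! ## Functions on the top simplices of a star -/

section Stars

set_option linter.unusedSectionVars false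

variable {V : Type*} {d : ℕ} {L : AbstractSimplicialComplex V} {col : V → Fin (d + 1)} [Fintype V]

/-- The top simplices containing `ρ`. -/
def facetsOver (L : AbstractSimplicialComplex V) (d : ℕ) (ρ : Finset V) : Finset (Finset V) :=
  Finset.univ.filter fun t => t ∈ L.faces ∧ t.card = d + 1 ∧ ρ ⊆ t

theorem mem_facetsOver {ρ t : Finset V} :
    t ∈ facetsOver L d ρ ↔ t ∈ L.faces ∧ t.card = d + 1 ∧ ρ ⊆ t := by
  simp [facetsOver]

theorem IsColoring.image_facet (hcol : IsColoring L col) {t : Finset V} (ht : t ∈ L.faces)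
    (hc : t.card = d + 1) : t.image col = Finset.univ := by
  rw [← Finset.card_eq_iff_eq_univ, hcol.card_image ht, hc, Fintype.card_fin]

theorem exists_color_notMem (col : V → Fin (d + 1)) {ρ : Finset V} (h : ρ.card < d + 1) :
    ∃ c, c ∉ ρ.image col := by
  by_contra! hc
  have h1 : ρ.image col = Finset.univ := Finset.eq_univ_of_forall hc
  have h2 := Finset.card_image_le (s := ρ) (f := col)
  rw [h1, Finset.card_univ, Fintype.card_fin] at h2
  omega

theorem facetsOver_eq_empty {ρ : Finset V} (hne : ρ.Nonempty) (h : ρ ∉ L.faces) :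
    facetsOver L d ρ = ∅ := by
  rw [Finset.eq_empty_iff_forall_notMem]
  intro t ht
  rw [mem_facetsOver] at ht
  exact h (face_of_subset ht.1 ht.2.2 hne)

/-- Every top simplex has exactly one vertex of each color, so a star is the disjoint union of the
smaller stars obtained by adding a vertex of color c. -/
theorem sum_facetsOver_eq (hcol : IsColoring L col) (ρ : Finset V) (c : Fin (d + 1))
    (y : Finset V → ZMod 2) :
    ∑ t ∈ facetsOver L d ρ, y t =
      ∑ v ∈ Finset.univ.filter (fun v => col v = c), ∑ t ∈ facetsOver L d (insert v ρ), y t := by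
  have h1 : ∀ v, facetsOver L d (insert v ρ) = (facetsOver L d ρ).filter fun t => v ∈ t := by
    intro v
    ext t
    simp only [mem_facetsOver, Finset.mem_filter, Finset.insert_subset_iff]
    tauto
  simp only [h1, Finset.sum_filter (fun t => _ ∈ t)]
  rw [Finset.sum_comm]
  refine Finset.sum_congr rfl fun t ht => ?_
  rw [mem_facetsOver] at ht
  have hc : c ∈ t.image col := by rw [hcol.image_facet ht.1 ht.2.1]; exact Finset.mem_univ c
  obtain ⟨v, hv, hvc⟩ := Finset.mem_image.mp hc
  rw [Finset.sum_eq_single v]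
  · rw [if_pos hv]
  · intro u hu huv
    rw [if_neg]
    intro hut
    exact huv (hcol.injOn ht.1 hut hv ((Finset.mem_filter.mp hu).2.trans hvc.symm))
  · intro h
    exact absurd (by simp [hvc]) h

theorem card_facetsOver_ridge (hL : IsHomogeneousComplex L d)
    (hclosed : IsClosedHomologyManifold L d) {r : Finset V} (hr : r ∈ L.faces)
    (hcard : r.card = d) : (facetsOver L d r).card = 2 := by
  rw [← ridge_card hL hclosed hr hcard]
  symm
  refine Finset.card_bij (fun v _ => insert v r) ?_ ?_ ?_
  · intro v hv
    rw [Finset.mem_filter] at hv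
    rw [mem_facetsOver, Finset.card_insert_of_notMem hv.2.1, hcard]
    exact ⟨hv.2.2, rfl, Finset.subset_insert v r⟩
  · intro u hu v hv h
    rw [Finset.mem_filter] at hu
    have : u ∈ insert v r := h ▸ Finset.mem_insert_self u r
    exact (Finset.mem_insert.mp this).resolve_right hu.2.1
  · intro t ht
    rw [mem_facetsOver] at ht
    obtain ⟨v, hv, e⟩ := Finset.exists_eq_insert_iff.mpr ⟨ht.2.2, by rw [hcard, ht.2.1]⟩
    exact ⟨v, by simp [hv, e, ht.1], e⟩

/-- A ridge has two top cofaces; smaller sets follow by adding vertices of a missing color one at a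
time. -/
theorem card_facetsOver_eq_zero (hL : IsHomogeneousComplex L d)
    (hclosed : IsClosedHomologyManifold L d) (hcol : IsColoring L col) (n : ℕ) :
    ∀ ρ : Finset V, ρ.Nonempty → ρ.card + n = d → ((facetsOver L d ρ).card : ZMod 2) = 0 := by
  induction n with
  | zero =>
    intro ρ hρ hn
    by_cases h : ρ ∈ L.faces
    · rw [card_facetsOver_ridge hL hclosed h (by omega)]
      rfl
    · rw [facetsOver_eq_empty hρ h]; simp
  | succ n ih =>
    intro ρ hρ hn
    obtain ⟨c, hc⟩ := exists_color_notMem col (ρ := ρ) (by omega)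
    have := sum_facetsOver_eq (L := L) hcol ρ c fun _ => 1
    simp only [Finset.sum_const, nsmul_eq_mul, mul_one] at this
    rw [this]
    refine Finset.sum_eq_zero fun v hv => ih _ (Finset.insert_nonempty v ρ) ?_
    rw [Finset.card_insert_of_notMem]
    · omega
    · intro h
      exact hc ((Finset.mem_filter.mp hv).2 ▸ Finset.mem_image_of_mem col h)

/-- The parity of the number of top simplices containing a given set of vertices. -/
theorem card_facetsOver (hL : IsHomogeneousComplex L d)
    (hclosed : IsClosedHomologyManifold L d) (hcol : IsColoring L col) {ρ : Finset V}
    (hρ : ρ.Nonempty) :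
    ((facetsOver L d ρ).card : ZMod 2) = if ρ ∈ L.faces ∧ ρ.card = d + 1 then 1 else 0 := by
  rcases lt_or_ge ρ.card (d + 1) with h | h
  · rw [if_neg (fun h' => by omega)]
    exact card_facetsOver_eq_zero hL hclosed hcol (d - ρ.card) ρ hρ (by omega)
  · have hsub : ∀ t ∈ facetsOver L d ρ, t = ρ := by
      intro t ht
      rw [mem_facetsOver] at ht
      exact (Finset.eq_of_subset_of_card_le ht.2.2 (by omega)).symm
    split_ifs with h'
    · have : facetsOver L d ρ = {ρ} := by
        rw [Finset.eq_singleton_iff_unique_mem]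
        exact ⟨mem_facetsOver.mpr ⟨h'.1, h'.2, subset_rfl⟩, hsub⟩
      rw [this]; simp
    · have : facetsOver L d ρ = ∅ := by
        rw [Finset.eq_empty_iff_forall_notMem]
        intro t ht
        have e := hsub t ht
        subst e
        rw [mem_facetsOver] at ht
        exact h' ⟨ht.1, ht.2.1⟩
      rw [this]; simp

/-- Orthogonality passes to fewer vertices, since larger stars are disjoint unions of smaller ones.
-/
theorem sum_facetsOver_eq_zero_of_le (hcol : IsColoring L col) {σ : Finset V} {j : ℕ}
    (hj : j + σ.card ≤ d + 1) (y : Finset V → ZMod 2)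
    (hy : ∀ ρ : Finset V, ρ.card = j → Disjoint ρ σ → ρ ∪ σ ∈ L.faces →
      ∑ t ∈ facetsOver L d (ρ ∪ σ), y t = 0) (n : ℕ) :
    ∀ ρ : Finset V, ρ.card + n = j → Disjoint ρ σ → ρ ∪ σ ∈ L.faces →
      ∑ t ∈ facetsOver L d (ρ ∪ σ), y t = 0 := by
  induction n with
  | zero => exact fun ρ h => hy ρ h
  | succ n ih =>
    intro ρ hn hd hρ
    obtain ⟨c, hc⟩ := exists_color_notMem col (ρ := ρ ∪ σ) (by
      rw [Finset.card_union_of_disjoint hd]; omega)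
    rw [sum_facetsOver_eq hcol _ c]
    refine Finset.sum_eq_zero fun v hv => ?_
    have hv' : v ∉ ρ ∪ σ := fun h =>
      hc ((Finset.mem_filter.mp hv).2 ▸ Finset.mem_image_of_mem col h)
    by_cases h : insert v (ρ ∪ σ) ∈ L.faces
    · rw [← Finset.insert_union] at h ⊢
      rw [Finset.mem_union, not_or] at hv'
      refine ih (insert v ρ) ?_ ?_ h
      · rw [Finset.card_insert_of_notMem hv'.1]; omega
      · rw [Finset.disjoint_insert_left]; exact ⟨hv'.2, hd⟩
    · rw [facetsOver_eq_empty (Finset.insert_nonempty _ _) h, Finset.sum_empty]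

/-- Reindexes the pairs (μ, v) with v in μ by ν = μ minus v and a vertex v outside ν. -/
theorem sum_powersetCard_succ_erase (s : Finset V) (i : ℕ) (F : V → Finset V → ZMod 2) :
    ∑ μ ∈ s.powersetCard (i + 1), ∑ v ∈ μ, F v (μ.erase v) =
      ∑ ν ∈ s.powersetCard i, ∑ v ∈ s \ ν, F v ν := by
  rw [Finset.sum_sigma', Finset.sum_sigma']
  refine Finset.sum_bij' (fun p _ => ⟨p.1.erase p.2, p.2⟩) (fun p _ => ⟨insert p.2 p.1, p.2⟩)
    ?_ ?_ ?_ ?_ ?_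
  · rintro ⟨μ, v⟩ h
    simp only [Finset.mem_sigma, Finset.mem_powersetCard] at h ⊢
    refine ⟨⟨(Finset.erase_subset v μ).trans h.1.1, ?_⟩, ?_⟩
    · rw [Finset.card_erase_of_mem h.2, h.1.2, Nat.add_sub_cancel]
    · rw [Finset.mem_sdiff]
      exact ⟨h.1.1 h.2, Finset.notMem_erase v μ⟩
  · rintro ⟨ν, v⟩ h
    simp only [Finset.mem_sigma, Finset.mem_powersetCard, Finset.mem_sdiff] at h ⊢
    refine ⟨⟨Finset.insert_subset h.2.1 h.1.1, ?_⟩, Finset.mem_insert_self v ν⟩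
    rw [Finset.card_insert_of_notMem h.2.2, h.1.2]
  · rintro ⟨μ, v⟩ h
    simp only [Finset.mem_sigma] at h
    simp only [Finset.insert_erase h.2]
  · rintro ⟨ν, v⟩ h
    simp only [Finset.mem_sigma, Finset.mem_sdiff] at h
    simp only [Finset.erase_insert h.2.2]
  · rintro ⟨μ, v⟩ _
    rfl

/-- A function on the top simplices of the star of `σ` that is orthogonal to the stars of the
`j`-element simplices of the link is a combination of stars of `i`-element simplices of the link. -/
theorem exists_star_combination (hL : IsHomogeneousComplex L d)
    (hclosed : IsClosedHomologyManifold L d) (hcol : IsColoring L col) {σ : Finset V}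
    (hσ : σ ∈ L.faces) {j : ℕ} (hj : j + σ.card ≤ d + 1) (y : Finset V → ZMod 2)
    (hy : ∀ ρ : Finset V, ρ.card = j → Disjoint ρ σ → ρ ∪ σ ∈ L.faces →
      ∑ t ∈ facetsOver L d (ρ ∪ σ), y t = 0) (m : ℕ) :
    m ≤ j + 1 → ∀ i, i + m + σ.card = d + 1 → ∃ a : Finset V → ZMod 2,
      ∀ t ∈ facetsOver L d σ, y t = ∑ μ ∈ (t \ σ).powersetCard i, a μ := by
  induction m with
  | zero =>
    intro _ i hi
    refine ⟨fun μ => y (μ ∪ σ), fun t ht => ?_⟩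
    rw [mem_facetsOver] at ht
    have hc : (t \ σ).card = i := by
      rw [Finset.card_sdiff_of_subset ht.2.2]; omega
    rw [← hc, Finset.powersetCard_self, Finset.sum_singleton,
      Finset.sdiff_union_of_subset ht.2.2]
  | succ m ih =>
    intro hm i hi
    obtain ⟨a, ha⟩ := ih (by omega) (i + 1) (by omega)
    -- The coefficients on each color class of (i+1)-element simplices form a coboundary, which
    -- lowers the size of the simplices by one.
    have hT : ∀ N : Finset (Fin (d + 1)), ∃ b : Finset V → ZMod 2,
        Disjoint N (σ.image col) → N.card = i + 1 → ∀ μ, μ.image col = N → μ ∪ σ ∈ L.faces →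
          a μ = ∑ v ∈ μ, b (μ.erase v) := by
      intro N
      by_cases hN : Disjoint N (σ.image col) ∧ N.card = i + 1
      swap
      · exact ⟨0, fun h1 h2 => absurd ⟨h1, h2⟩ hN⟩
      obtain ⟨hNσ, hNc⟩ := hN
      obtain ⟨b, hb⟩ := exists_coboundary hL hclosed hcol hσ hNσ a (by
        intro τ hτ
        by_cases hτσ : τ ∪ σ ∈ L.faces
        swap
        · refine Finset.sum_eq_zero fun s hs => absurd ?_ hτσ
          rw [Finset.mem_filter, Finset.union_assoc] at hs
          exact face_of_subset hs.2.2 Finset.subset_union_right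
            ((face_nonempty hσ).mono Finset.subset_union_right)
        have hτd : Disjoint τ σ := by
          refine IsLinkChain.disjoint (P := τ.image col) (col := col) ?_
            fun v hv => Finset.mem_image_of_mem col hv
          rw [hτ, Finset.compl_union]
          exact Finset.disjoint_of_subset_left Finset.inter_subset_right disjoint_compl_left
        have hτc : τ.card = m := by
          rw [hcol.card_eq_of_image_eq hτσ hτ, Finset.card_compl,
            Finset.card_union_of_disjoint hNσ, hNc, hcol.card_image hσ, Fintype.card_fin]
          omega
        -- A simplex τ of complementary colors has m ≤ j vertices, so y is orthogonal to its star as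
        -- well.
        have h0 := sum_facetsOver_eq_zero_of_le hcol hj y hy (j - m) τ
          (by omega) hτd hτσ
        rw [← h0]
        have h1 : ∀ t ∈ facetsOver L d (τ ∪ σ), y t =
            ∑ μ ∈ (Finset.univ.filter fun μ : Finset V => μ.card = i + 1 ∧ Disjoint μ σ),
              if μ ⊆ t then a μ else 0 := by
          intro t ht
          rw [mem_facetsOver] at ht
          rw [ha t (mem_facetsOver.mpr ⟨ht.1, ht.2.1, Finset.union_subset_right ht.2.2⟩),
            ← Finset.sum_filter]
          refine Finset.sum_congr ?_ fun _ _ => rfl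
          ext μ
          simp only [Finset.mem_powersetCard, Finset.mem_filter, Finset.mem_univ, true_and,
            Finset.subset_sdiff]
          tauto
        rw [Finset.sum_congr rfl h1, Finset.sum_comm]
        -- After exchanging the sums, μ is counted with the parity of the number of top simplices
        -- over μ ∪ τ ∪ σ, so only those μ survive that complete τ ∪ σ to a top simplex. These are
        -- the μ of color N in the link of τ.
        have h2 : ∀ μ : Finset V, (∑ t ∈ facetsOver L d (τ ∪ σ), if μ ⊆ t then a μ else 0) =
            if μ ∪ τ ∪ σ ∈ L.faces ∧ (μ ∪ τ ∪ σ).card = d + 1 then a μ else 0 := by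
          intro μ
          have e : (facetsOver L d (τ ∪ σ)).filter (fun t => μ ⊆ t) =
              facetsOver L d (μ ∪ τ ∪ σ) := by
            ext t
            simp only [mem_facetsOver, Finset.mem_filter, Finset.union_subset_iff]
            tauto
          rw [← Finset.sum_filter, e, Finset.sum_const, nsmul_eq_mul,
            card_facetsOver hL hclosed hcol ((face_nonempty hσ).mono Finset.subset_union_right)]
          split_ifs <;> simp
        simp only [h2]
        rw [← Finset.sum_filter, Finset.filter_filter]
        refine Finset.sum_congr ?_ fun _ _ => rfl
        ext μ
        simp only [Finset.mem_filter, Finset.mem_univ, true_and]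
        constructor
        · rintro ⟨hμ, hf⟩
          rw [Finset.union_assoc] at hf
          have hμc := (hcol.card_eq_of_image_eq hf hμ).trans hNc
          have hμd : Disjoint μ (τ ∪ σ) := by
            refine IsLinkChain.disjoint (P := N) (col := col) ?_
              fun v hv => hμ ▸ Finset.mem_image_of_mem col hv
            rw [Finset.image_union, hτ, Finset.disjoint_union_right]
            refine ⟨?_, hNσ⟩
            rw [Finset.compl_union]
            exact Finset.disjoint_of_subset_right Finset.inter_subset_left disjoint_compl_right
          refine ⟨⟨hμc, (Finset.disjoint_union_right.mp hμd).2⟩, ?_, ?_⟩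
          · rw [Finset.union_assoc]; exact hf
          · rw [Finset.union_assoc, Finset.card_union_of_disjoint hμd,
              Finset.card_union_of_disjoint hτd]
            omega
        · rintro ⟨⟨hμc, hμd⟩, hf, hc⟩
          refine ⟨?_, hf⟩
          have hτμ : Disjoint μ (τ ∪ σ) := by
            rw [← Finset.card_union_eq_card_add_card, ← Finset.union_assoc, hc,
              Finset.card_union_of_disjoint hτd]
            omega
          have himg := hcol.image_facet hf hc
          rw [Finset.union_assoc] at hf himg
          have hcompl : IsCompl (μ.image col) ((τ ∪ σ).image col) := by
            constructor
            · rw [Finset.disjoint_left]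
              intro c hc' hc''
              obtain ⟨u, hu, rfl⟩ := Finset.mem_image.mp hc'
              exact hcol.col_notMem hf hτμ hu hc''
            · rw [codisjoint_iff, Finset.sup_eq_union, ← Finset.image_union, himg]; rfl
          rw [hcompl.eq_compl, Finset.image_union, hτ, Finset.compl_union, compl_compl,
            Finset.union_inter_distrib_right, Finset.inter_compl, Finset.union_empty]
          ext c
          rw [Finset.mem_inter, Finset.mem_compl]
          exact ⟨fun h => h.1, fun h => ⟨h, Finset.disjoint_left.mp hNσ h⟩⟩)
      exact ⟨b, fun _ _ => hb⟩
    choose b hb using hT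
    -- The new coefficient sums the primitives over the colors absent from ν and σ. It does not
    -- depend on t, because the vertices of t outside ν and σ carry each of these colors once.
    refine ⟨fun ν => ∑ c ∈ (ν.image col ∪ σ.image col)ᶜ, b (insert c (ν.image col)) ν,
      fun t ht => ?_⟩
    rw [ha t ht]
    rw [mem_facetsOver] at ht
    have hts : t \ σ ∪ σ = t := Finset.sdiff_union_of_subset ht.2.2
    have hsub : ∀ μ ⊆ t \ σ, μ ∪ σ ∈ L.faces := fun μ hμ =>
      face_of_subset (s := t \ σ ∪ σ) (by rw [hts]; exact ht.1) (Finset.union_subset_union_left hμ)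
        ((face_nonempty hσ).mono Finset.subset_union_right)
    have h1 : ∑ μ ∈ (t \ σ).powersetCard (i + 1), a μ =
        ∑ μ ∈ (t \ σ).powersetCard (i + 1), ∑ v ∈ μ,
          b (insert (col v) ((μ.erase v).image col)) (μ.erase v) := by
      refine Finset.sum_congr rfl fun μ hμ => ?_
      rw [Finset.mem_powersetCard] at hμ
      have hμσ := hsub μ hμ.1
      have hd : Disjoint μ σ := Finset.disjoint_of_subset_left hμ.1 Finset.sdiff_disjoint
      rw [hb (μ.image col) ?_ ?_ μ rfl hμσ]
      · refine Finset.sum_congr rfl fun v hv => ?_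
        rw [← Finset.image_insert, Finset.insert_erase hv]
      · rw [Finset.disjoint_left]
        intro c hc
        obtain ⟨u, hu, rfl⟩ := Finset.mem_image.mp hc
        exact hcol.col_notMem hμσ hd hu
      · rw [hcol.card_image_of_subset hμσ Finset.subset_union_left, hμ.2]
    rw [h1, sum_powersetCard_succ_erase (t \ σ) i fun v ν => b (insert (col v) (ν.image col)) ν]
    refine Finset.sum_congr rfl fun ν hν => ?_
    rw [Finset.mem_powersetCard] at hν
    have himg : ((t \ σ) \ ν).image col = (ν.image col ∪ σ.image col)ᶜ := by
      ext c
      rw [Finset.mem_compl, ← Finset.image_union]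
      constructor
      · rintro hc hc'
        obtain ⟨u, hu, rfl⟩ := Finset.mem_image.mp hc
        obtain ⟨w, hw, e⟩ := Finset.mem_image.mp hc'
        rw [Finset.mem_sdiff, Finset.mem_sdiff] at hu
        have hwt : w ∈ t := by
          rcases Finset.mem_union.mp hw with h | h
          · exact (Finset.mem_sdiff.mp (hν.1 h)).1
          · exact ht.2.2 h
        have := hcol.injOn ht.1 hwt hu.1.1 e
        subst this
        rcases Finset.mem_union.mp hw with h | h
        · exact hu.2 h
        · exact hu.1.2 h
      · intro hc
        have : c ∈ t.image col := by rw [hcol.image_facet ht.1 ht.2.1]; exact Finset.mem_univ c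
        obtain ⟨u, hu, rfl⟩ := Finset.mem_image.mp this
        refine Finset.mem_image_of_mem col ?_
        rw [Finset.mem_sdiff, Finset.mem_sdiff]
        refine ⟨⟨hu, fun h => hc ?_⟩, fun h => hc ?_⟩
        · exact Finset.mem_image_of_mem col (Finset.mem_union_right _ h)
        · exact Finset.mem_image_of_mem col (Finset.mem_union_left _ h)
    beta_reduce
    rw [← himg, Finset.sum_image]
    intro u hu w hw h
    simp only [Finset.coe_sdiff, Set.mem_sdiff, Finset.mem_coe] at hu hw
    exact hcol.injOn ht.1 hu.1.1 hw.1.1 h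

end Stars

/-! ## The complexes `L_N` are homogeneous and regular -/

section Shrunk

set_option linter.unusedSectionVars false

variable {V : Type*} [Fintype V] {d k : ℕ} {L : AbstractSimplicialComplex V} {col : V → Fin (d + 1)}

theorem card_colorChoice (hk : k + 2 ≤ d) (inst : Fintype (ColorChoice d k)) :
    @Fintype.card (ColorChoice d k) inst = d.choose (k + 1) := by
  rw [Fintype.card_of_subtype
    (Finset.powersetCard (d - 1 - k) (Finset.univ.erase (Fin.last d)))]
  · rw [Finset.card_powersetCard, Finset.card_erase_of_mem (Finset.mem_univ _), Finset.card_univ,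
      Fintype.card_fin, Nat.add_sub_cancel, ← Nat.choose_symm (show d - 1 - k ≤ d by omega)]
    congr 1
    omega
  · intro N
    rw [Finset.mem_powersetCard, Finset.subset_erase]
    simp

theorem IsColoring.image_filter_facet (hcol : IsColoring L col) {t : Finset V} (ht : t ∈ L.faces)
    (hc : t.card = d + 1) (M : Finset (Fin (d + 1))) :
    (t.filter fun v => col v ∈ M).image col = M := by
  ext c
  rw [Finset.mem_image]
  constructor
  · rintro ⟨v, hv, rfl⟩
    exact (Finset.mem_filter.mp hv).2
  · intro h
    have : c ∈ t.image col := by rw [hcol.image_facet ht hc]; exact Finset.mem_univ c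
    obtain ⟨v, hv, rfl⟩ := Finset.mem_image.mp this
    exact ⟨v, Finset.mem_filter.mpr ⟨hv, h⟩, rfl⟩

theorem IsColoring.card_filter_facet (hcol : IsColoring L col) {t : Finset V} (ht : t ∈ L.faces)
    (hc : t.card = d + 1) (M : Finset (Fin (d + 1))) :
    (t.filter fun v => col v ∈ M).card = M.card := by
  rw [← hcol.card_image_of_subset ht (Finset.filter_subset _ _), hcol.image_filter_facet ht hc]

/-- The vertex counts k+2 and d-1-k add up to d+1, so the d-simplex in the definition of the link
must be s ∪ τ. -/
theorem mem_linkOf_iff (hk : k + 2 ≤ d) {s τ : Finset V} (hτ : τ.card = d - 1 - k) :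
    s ∈ linkOf L d (k + 1) τ ↔ s.card = k + 2 ∧ Disjoint s τ ∧ s ∪ τ ∈ L.faces := by
  constructor
  · rintro ⟨_, h2, ⟨t, ⟨ht, htc, hτt⟩, hst⟩, h4⟩
    refine ⟨h2, h4, ?_⟩
    rwa [Finset.eq_of_subset_of_card_le (Finset.union_subset hst hτt)]
    rw [Finset.card_union_of_disjoint h4]
    omega
  · rintro ⟨h1, h2, h3⟩
    refine ⟨face_of_subset h3 Finset.subset_union_left (Finset.card_pos.mp (by omega)), h1,
      ⟨s ∪ τ, ⟨h3, ?_, Finset.subset_union_right⟩, Finset.subset_union_left⟩, h2⟩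
    rw [Finset.card_union_of_disjoint h2]
    omega

/-- In a d-simplex, the vertices with colors in N form a τ, and all others form a simplex of its
(k+1)-link. A simplex without colors in N lies in a d-simplex, hence in the boundary of that cell.
-/
theorem shrunk_isHomogeneous (hk : k + 2 ≤ d) (hL : IsHomogeneousComplex L d)
    (hcol : IsColoring L col) {N : Finset (Fin (d + 1))} (hN : N.card = d - 1 - k) :
    (shrunk L col k N).IsHomogeneous (k + 2) := by
  have key : ∀ t ∈ L.faces, ∀ h : t.card = d + 1, ∃ τ : {τ : Simplex L (d - 2 - k) //
      τ.1.image col = N}, τ.1.1 = t.filter fun v => col v ∈ N := by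
    intro t ht h
    have h1 := hcol.card_filter_facet ht h N
    refine ⟨⟨⟨_, face_of_subset ht (Finset.filter_subset _ _) (Finset.card_pos.mp ?_), ?_⟩,
      hcol.image_filter_facet ht h N⟩, rfl⟩ <;> omega
  refine ⟨?_, ?_⟩
  · obtain ⟨t, ht, hc⟩ := hL.1
    obtain ⟨τ, -⟩ := key t ht hc
    exact ⟨Sum.inr τ, rfl⟩
  · rintro (σ | τ)
    · right
      obtain ⟨t, ht, hc, hσt⟩ := hL.2.2 σ.1 σ.2.1
      obtain ⟨τ, hτ⟩ := key t ht hc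
      refine ⟨Sum.inr τ, rfl, t.filter fun v => col v ∉ N, ?_, fun v hv =>
        Finset.mem_filter.mpr ⟨hσt hv, σ.2.2.2 v hv⟩⟩
      have h1 := hcol.card_filter_facet ht hc N
      have h2 := Finset.card_filter_add_card_filter_not (s := t) fun v => col v ∈ N
      rw [mem_linkOf_iff hk (by rw [hτ, h1, hN]), hτ]
      refine ⟨by omega, (Finset.disjoint_filter_filter_not _ _ _).symm, ?_⟩
      rw [Finset.union_comm, Finset.filter_union_filter_not_eq]
      exact ht
    · exact Or.inl rfl

theorem eq_insert_of_subset_insert {a s : Finset V} {u v : V} (has : a ⊂ s)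
    (hs : s ⊂ insert u (insert v a)) : s = insert u a ∨ s = insert v a := by
  obtain ⟨w, hw, hwa⟩ := Finset.exists_of_ssubset has
  have h1 : insert w a ⊆ s := Finset.insert_subset hw has.subset
  have h2 := Finset.card_lt_card hs
  have h3 := Finset.card_insert_le u (insert v a)
  have h4 := Finset.card_insert_le v a
  have h5 := Finset.card_insert_of_notMem hwa
  have h6 := Finset.eq_of_subset_of_card_le h1 (by omega)
  have h7 := hs.subset hw
  rw [Finset.mem_insert, Finset.mem_insert] at h7
  rcases h7 with rfl | rfl | h
  · exact Or.inl h6.symm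
  · exact Or.inr h6.symm
  · exact absurd h hwa

theorem ncard_eq_two_of_insert {N : Finset (Fin (d + 1))} (S : Set (ShrunkCell L col k N))
    {a : Finset V} {u v : V} (huv : u ≠ v) (hu : u ∉ a)
    (hS : ∀ s, Sum.inl s ∈ S ↔ s.1 = insert u a ∨ s.1 = insert v a) (hS' : ∀ τ, Sum.inr τ ∉ S)
    (hua : insert u a ∈ L.faces ∧ (insert u a).card ≤ k + 2 ∧ ∀ w ∈ insert u a, col w ∉ N)
    (hva : insert v a ∈ L.faces ∧ (insert v a).card ≤ k + 2 ∧ ∀ w ∈ insert v a, col w ∉ N) :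
    S.ncard = 2 := by
  have : S = {Sum.inl ⟨_, hua⟩, Sum.inl ⟨_, hva⟩} := by
    ext c
    rcases c with s | τ
    · rw [hS]
      simp only [Set.mem_insert_iff, Set.mem_singleton_iff, Sum.inl.injEq, Subtype.ext_iff]
    · simp [hS']
  rw [this, Set.ncard_pair]
  intro h
  have h1 : insert u a = insert v a := congrArg Subtype.val (Sum.inl_injective h)
  have h2 : u ∈ insert v a := h1 ▸ Finset.mem_insert_self u a
  rcases Finset.mem_insert.mp h2 with h | h
  · exact huv h
  · exact hu h

/-- Between simplices this is combinatorics of finite sets. Below the cell of τ, a face a of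
codimension two has k+1 vertices, so a ∪ τ is a ridge, and its two top cofaces give the two
intermediate cells. -/
theorem shrunk_isRegular (hk : k + 2 ≤ d) (hL : IsHomogeneousComplex L d)
    (hclosed : IsClosedHomologyManifold L d) (hcol : IsColoring L col) {N : Finset (Fin (d + 1))} :
    (shrunk L col k N).IsRegular := by
  have sub : ∀ (σ : {σ : Finset V // σ ∈ L.faces ∧ σ.card ≤ k + 2 ∧ ∀ v ∈ σ, col v ∉ N})
      (s : Finset V), s.Nonempty → s ⊆ σ.1 → s ∈ L.faces ∧ s.card ≤ k + 2 ∧ ∀ v ∈ s, col v ∉ N :=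
    fun σ s hs h => ⟨face_of_subset σ.2.1 h hs, (Finset.card_le_card h).trans σ.2.2.1,
      fun v hv => σ.2.2.2 v (h hv)⟩
  constructor
  · rintro (σ | τ) hb
    · change σ.1.card - 1 = 1 at hb
      obtain ⟨u, v, huv, hσ⟩ := Finset.card_eq_two.mp (show σ.1.card = 2 by omega)
      refine ncard_eq_two_of_insert (a := ∅) _ huv (by simp) (fun s => ?_)
        (fun τ h => h) (sub σ _ (by simp) ?_) (sub σ _ (by simp) ?_)
      · change s.1 ⊂ σ.1 ↔ _
        rw [hσ]
        constructor
        · intro h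
          refine eq_insert_of_subset_insert ?_ h
          exact (Finset.empty_ssubset).mpr (face_nonempty s.2.1)
        · rintro (h | h) <;> rw [h]
          · refine Finset.ssubset_iff_subset_ne.mpr ⟨by simp, fun e => ?_⟩
            have := congrArg Finset.card e
            rw [Finset.card_pair huv] at this
            simp at this
          · refine Finset.ssubset_iff_subset_ne.mpr ⟨by simp, fun e => ?_⟩
            have := congrArg Finset.card e
            rw [Finset.card_pair huv] at this
            simp at this
      · rw [hσ]; simp
      · rw [hσ]; simp
    · exact absurd (show k + 2 = 1 from hb) (by omega)
  · rintro (a | a) (b | τ) hab hdim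
    · change a.1 ⊂ b.1 at hab
      change b.1.card - 1 = a.1.card - 1 + 2 at hdim
      have ha := (face_nonempty a.2.1).card_pos
      have hc := Finset.card_sdiff_of_subset hab.subset
      obtain ⟨u, v, huv, hba⟩ := Finset.card_eq_two.mp (show (b.1 \ a.1).card = 2 by omega)
      have hu : u ∈ b.1 \ a.1 := by rw [hba]; simp
      have hv : v ∈ b.1 \ a.1 := by rw [hba]; simp
      rw [Finset.mem_sdiff] at hu hv
      have hb : b.1 = insert u (insert v a.1) := by
        rw [← Finset.sdiff_union_of_subset hab.subset, hba]
        ext w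
        simp
      have hua := Finset.card_insert_of_notMem hu.2
      have hva := Finset.card_insert_of_notMem hv.2
      have hub : insert u a.1 ⊆ b.1 := Finset.insert_subset hu.1 hab.subset
      have hvb : insert v a.1 ⊆ b.1 := Finset.insert_subset hv.1 hab.subset
      refine ncard_eq_two_of_insert (a := a.1) _ huv hu.2 (fun s => ?_)
        (fun τ h => h.2) (sub b _ (by simp) hub) (sub b _ (by simp) hvb)
      change a.1 ⊂ s.1 ∧ s.1 ⊂ b.1 ↔ _
      constructor
      · rintro ⟨h1, h2⟩
        exact eq_insert_of_subset_insert h1 (hb ▸ h2)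
      · rintro (h | h) <;> rw [h]
        · exact ⟨Finset.ssubset_insert hu.2, hub.ssubset_of_ne fun e => by rw [e] at hua; omega⟩
        · exact ⟨Finset.ssubset_insert hv.2, hvb.ssubset_of_ne fun e => by rw [e] at hva; omega⟩
    · change ∃ ρ ∈ linkOf L d (k + 1) τ.1.1, a.1 ⊆ ρ at hab
      change k + 2 = a.1.card - 1 + 2 at hdim
      have ha := (face_nonempty a.2.1).card_pos
      have hτc : τ.1.1.card = d - 1 - k := by rw [τ.1.2.2]; omega
      have hlink := fun s => mem_linkOf_iff (L := L) (s := s) hk hτc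
      obtain ⟨ρ, hρ, haρ⟩ := hab
      rw [hlink] at hρ
      have hdisj : Disjoint a.1 τ.1.1 := Finset.disjoint_of_subset_left haρ hρ.2.1
      have hr : a.1 ∪ τ.1.1 ∈ L.faces :=
        face_of_subset hρ.2.2 (Finset.union_subset_union_left haρ)
          ((face_nonempty a.2.1).mono Finset.subset_union_left)
      have hrc : (a.1 ∪ τ.1.1).card = d := by
        rw [Finset.card_union_of_disjoint hdisj]; omega
      obtain ⟨u, v, huv, he⟩ := Finset.card_eq_two.mp (ridge_card hL hclosed hr hrc)
      have hmem : ∀ w, w ∉ a.1 ∪ τ.1.1 ∧ insert w (a.1 ∪ τ.1.1) ∈ L.faces ↔ w = u ∨ w = v := by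
        intro w
        have := congrArg (w ∈ ·) he
        simpa using this
      have hcell : ∀ w, w ∉ a.1 ∪ τ.1.1 → insert w (a.1 ∪ τ.1.1) ∈ L.faces →
          insert w a.1 ∈ L.faces ∧ (insert w a.1).card ≤ k + 2 ∧
            ∀ w' ∈ insert w a.1, col w' ∉ N := by
        intro w hw hwf
        rw [Finset.mem_union, not_or] at hw
        refine ⟨face_of_subset hwf (Finset.insert_subset_insert _ Finset.subset_union_left)
          (by simp), ?_, ?_⟩
        · rw [Finset.card_insert_of_notMem hw.1]; omega
        · intro w' hw'
          rw [← Finset.insert_union] at hwf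
          rw [← τ.2]
          exact hcol.col_notMem hwf (Finset.disjoint_insert_left.mpr ⟨hw.2, hdisj⟩) hw'
      have hu := (hmem u).mpr (Or.inl rfl)
      have hv := (hmem v).mpr (Or.inr rfl)
      refine ncard_eq_two_of_insert (a := a.1) _ huv (fun h => hu.1 (Finset.mem_union_left _ h))
        (fun s => ?_) (fun τ h => h.2)
        (hcell u hu.1 hu.2) (hcell v hv.1 hv.2)
      change a.1 ⊂ s.1 ∧ (∃ ρ ∈ linkOf L d (k + 1) τ.1.1, s.1 ⊆ ρ) ↔ _
      have hback : ∀ w, w ∉ a.1 ∪ τ.1.1 ∧ insert w (a.1 ∪ τ.1.1) ∈ L.faces → s.1 = insert w a.1 →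
          a.1 ⊂ s.1 ∧ (∃ ρ ∈ linkOf L d (k + 1) τ.1.1, s.1 ⊆ ρ) := by
        rintro w ⟨hw, hwf⟩ h
        rw [Finset.mem_union, not_or] at hw
        rw [h]
        refine ⟨Finset.ssubset_insert hw.1, _, (hlink _).mpr ⟨?_, ?_, ?_⟩, subset_rfl⟩
        · rw [Finset.card_insert_of_notMem hw.1]; omega
        · exact Finset.disjoint_insert_left.mpr ⟨hw.2, hdisj⟩
        · rwa [Finset.insert_union]
      constructor
      · rintro ⟨h1, ρ', hρ', h2⟩
        rw [hlink] at hρ'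
        obtain ⟨w, hw, hwa⟩ := Finset.exists_of_ssubset h1
        have hwτ : w ∉ τ.1.1 := Finset.disjoint_left.mp hρ'.2.1 (h2 hw)
        have hwc := Finset.card_insert_of_notMem hwa
        have hsub : insert w a.1 ⊆ s.1 := Finset.insert_subset hw h1.subset
        have hs : insert w a.1 = s.1 :=
          Finset.eq_of_subset_of_card_le hsub (by have := s.2.2.1; omega)
        have := (hmem w).mp ⟨by rw [Finset.mem_union, not_or]; exact ⟨hwa, hwτ⟩, by
          rw [← Finset.insert_union]
          exact face_of_subset hρ'.2.2 (Finset.union_subset_union_left (hsub.trans h2)) (by simp)⟩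
        rcases this with rfl | rfl
        · exact Or.inl hs.symm
        · exact Or.inr hs.symm
      · rintro (h | h)
        · exact hback u hu h
        · exact hback v hv h
    · exact hab.elim
    · exact hab.elim

end Shrunk

/-! ## The color code register -/

theorem isPartition_subtype {D P : Type*} {inP : D → P → Prop} (h : ∀ p, ∃! δ, inP δ p) :
    IsPartition fun δ (p : {p // inP δ p}) => p.1 := by
  constructor
  · rintro ⟨δ, p, hp⟩ ⟨δ', p', hp'⟩ (rfl : p = p')
    obtain rfl := (h p).unique hp hp'
    rfl
  · intro p
    obtain ⟨δ, hδ, -⟩ := h p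
    exact ⟨⟨δ, p, hδ⟩, rfl⟩

/-- The unitary group of a register. -/
abbrev QubitGroup (Q : Type*) [Fintype Q] : Type _ := Matrix.unitaryGroup (Config Q) ℂ

/-- The generators of the stabilizer group of a code. -/
def CSSCode.gens {Q : Type*} [Fintype Q] (C : CSSCode Q) : Set (QubitGroup Q) :=
  {g | ∃ s ∈ C.xGen, g = opX s} ∪ {g | ∃ s ∈ C.zGen, g = opZ s}

theorem CSSCode.mem_gens {Q : Type*} [Fintype Q] {C : CSSCode Q} {g : QubitGroup Q} :
    g ∈ C.gens ↔ (∃ s ∈ C.xGen, g = opW (ind s) 0) ∨ ∃ s ∈ C.zGen, g = opW 0 (ind s) := by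
  simp only [← opX_eq_opW, ← opZ_eq_opW]
  rfl

section ColorRegister

set_option linter.unusedSectionVars false

variable {V : Type*} {d k : ℕ} {L : AbstractSimplicialComplex V} {col : V → Fin (d + 1)} [Fintype V]

/-- The faces with `n` vertices, none of them of the last color. -/
abbrev PlainFace (L : AbstractSimplicialComplex V) (col : V → Fin (d + 1)) (n : ℕ) : Type _ :=
  {τ : Finset V // τ ∈ L.faces ∧ τ.card = n ∧ ∀ v ∈ τ, col v ≠ Fin.last d}

/-- The vector `[ρ ⊆ ·]` on simplices. -/
def incl (ρ : Finset V) : Finset V → ZMod 2 := fun t => if ρ ⊆ t then 1 else 0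

/-- A function on simplices as a vector on the color code register. -/
def vecCC (f : Finset V → ZMod 2) : QubitCC L col k → ZMod 2
  | Sum.inl t => f t.1
  | Sum.inr _ => 0

/-- A vector on the color code register as a function on simplices. -/
def evalCC (v : QubitCC L col k → ZMod 2) : Finset V → ZMod 2 := fun t =>
  if h : t ∈ L.faces ∧ t.card = d + 1 then v (Sum.inl ⟨t, h⟩) else 0

theorem evalCC_of_mem (v : QubitCC L col k → ZMod 2) {t : Finset V}
    (h : t ∈ L.faces ∧ t.card = d + 1) : evalCC v t = v (Sum.inl ⟨t, h⟩) := dif_pos h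

theorem vecCC_evalCC_add (v : QubitCC L col k → ZMod 2) :
    v = vecCC (evalCC v) + ∑ a, v (Sum.inr a) • ind {Sum.inr a} := by
  funext p
  rw [Pi.add_apply, Finset.sum_apply]
  rcases p with t | a
  · rw [Finset.sum_eq_zero fun a _ => by simp [ind], add_zero]
    exact (evalCC_of_mem v t.2).symm
  · rw [Finset.sum_eq_single a (fun b _ hb => by simp [ind, Ne.symm hb]) (by simp)]
    simp [ind, vecCC]

theorem vecCC_eq_zero {f : Finset V → ZMod 2}
    (h : ∀ t ∈ L.faces, t.card = d + 1 → f t = 0) :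
    (vecCC f : QubitCC L col k → ZMod 2) = 0 := by
  funext p
  rcases p with t | a
  · exact h t.1 t.2.1 t.2.2
  · rfl

theorem vecCC_incl_eq_zero {ρ : Finset V} (hne : ρ.Nonempty) (hρ : ρ ∉ L.faces) :
    (vecCC (incl ρ) : QubitCC L col k → ZMod 2) = 0 :=
  vecCC_eq_zero fun _ ht _ => if_neg fun h => hρ (face_of_subset ht h hne)

theorem IsColoring.exists_last (hcol : IsColoring L col) {t : Finset V} (ht : t ∈ L.faces)
    (hlast : Fin.last d ∈ t.image col) : ∃! δ : LastVertex col, δ.1 ∈ t := by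
  obtain ⟨v, hv, hc⟩ := Finset.mem_image.mp hlast
  exact ⟨⟨v, hc⟩, hv, fun δ hδ => Subtype.ext (hcol.injOn ht hδ hv (δ.2.trans hc.symm))⟩

/-! ### Blocks of the color code register and commutation inside them. -/

theorem existsUnique_inBlockCC (hcol : IsColoring L col) (p : QubitCC L col k) :
    ∃! δ, InBlockCC L col k δ p := by
  rcases p with t | a
  · obtain ⟨δ, h1, h2⟩ := hcol.exists_last t.2.1
      (by rw [hcol.image_facet t.2.1 t.2.2]; exact Finset.mem_univ _)
    exact ⟨δ, ⟨t.2.1, t.2.2, Finset.singleton_subset_iff.mpr h1⟩,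
      fun δ' h => h2 δ' (Finset.singleton_subset_iff.mp h.2.2)⟩
  · exact ⟨a.1, rfl, fun δ' h => h.symm⟩

/-- The qubits of a block of the color code register. -/
def blockEquivCC (δ : LastVertex col) :
    {t // t ∈ facetsOver L d {δ.1}} ⊕ AncillaCC L col k δ ≃ {p // InBlockCC L col k δ p} :=
  Equiv.ofBijective
    (Sum.elim
      (fun t => ⟨Sum.inl ⟨t.1, (mem_facetsOver.mp t.2).1, (mem_facetsOver.mp t.2).2.1⟩,
        mem_facetsOver.mp t.2⟩)
      (fun a => ⟨Sum.inr ⟨δ, a⟩, rfl⟩)) (by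
    constructor
    · rintro (t | a) (t' | a') h
      · have := congrArg Subtype.val (Sum.inl_injective (congrArg Subtype.val h))
        exact congrArg Sum.inl (Subtype.ext this)
      · cases congrArg Subtype.val h
      · cases congrArg Subtype.val h
      · have := Sum.inr_injective (congrArg Subtype.val h)
        exact congrArg Sum.inr (eq_of_heq (Sigma.mk.inj this).2)
    · rintro ⟨t | ⟨δ', a⟩, h⟩
      · exact ⟨Sum.inl ⟨t.1, mem_facetsOver.mpr h⟩, rfl⟩
      · obtain rfl : δ' = δ := h
        exact ⟨Sum.inr a, rfl⟩)

theorem sum_blockCC (δ : LastVertex col) (w : QubitCC L col k → ZMod 2) :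
    ∑ p : {p // InBlockCC L col k δ p}, w p.1 =
      ∑ t ∈ facetsOver L d {δ.1}, evalCC w t + ∑ a, w (Sum.inr ⟨δ, a⟩) := by
  rw [← Equiv.sum_comp (blockEquivCC δ) fun p => w p.1, Fintype.sum_sum_type,
    ← Finset.sum_coe_sort _ (evalCC w)]
  congr 1
  refine Finset.sum_congr rfl fun t _ => ?_
  have h := mem_facetsOver.mp t.2
  exact (evalCC_of_mem w ⟨h.1, h.2.1⟩).symm

theorem sum_blockCC_mul_vecCC (δ : LastVertex col) (v : QubitCC L col k → ZMod 2)
    (f : Finset V → ZMod 2) :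
    ∑ p : {p // InBlockCC L col k δ p}, v p.1 * vecCC f p.1 =
      ∑ t ∈ facetsOver L d {δ.1}, evalCC v t * f t := by
  have h0 : ∑ a, v (Sum.inr ⟨δ, a⟩) * vecCC f (Sum.inr ⟨δ, a⟩ : QubitCC L col k) = 0 :=
    Finset.sum_eq_zero fun a _ => mul_zero _
  rw [sum_blockCC δ fun p => v p * vecCC f p, h0, add_zero]
  refine Finset.sum_congr rfl fun t ht => ?_
  have h := mem_facetsOver.mp ht
  rw [evalCC_of_mem _ ⟨h.1, h.2.1⟩, evalCC_of_mem _ ⟨h.1, h.2.1⟩]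
  rfl

theorem sum_facetsOver_mul_incl (σ ρ : Finset V) (y : Finset V → ZMod 2) :
    ∑ t ∈ facetsOver L d σ, y t * incl ρ t = ∑ t ∈ facetsOver L d (ρ ∪ σ), y t := by
  have h : facetsOver L d (ρ ∪ σ) = (facetsOver L d σ).filter fun t => ρ ⊆ t := by
    ext t
    simp only [mem_facetsOver, Finset.mem_filter, Finset.union_subset_iff]
    tauto
  rw [h, Finset.sum_filter]
  exact Finset.sum_congr rfl fun t _ => by simp [incl]

/-- The two stars overlap within the block in the d-simplices over τ ∪ ρ ∪ {δ}, whose number is even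
unless that set is itself a d-simplex. -/
theorem sum_blockCC_incl_mul_incl (hL : IsHomogeneousComplex L d)
    (hclosed : IsClosedHomologyManifold L d) (hcol : IsColoring L col) (δ : LastVertex col)
    (τ ρ : Finset V) :
    ∑ p : {p // InBlockCC L col k δ p}, vecCC (incl τ) p.1 * vecCC (incl ρ) p.1 =
      if τ ∪ (ρ ∪ {δ.1}) ∈ L.faces ∧ (τ ∪ (ρ ∪ {δ.1})).card = d + 1 then 1 else 0 := by
  rw [← card_facetsOver hL hclosed hcol (by simp), sum_blockCC_mul_vecCC,
    sum_facetsOver_mul_incl]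
  have h1 : ∀ t ∈ facetsOver L d (ρ ∪ {δ.1}),
      evalCC (vecCC (incl τ) : QubitCC L col k → ZMod 2) t = 1 * incl τ t := by
    intro t ht
    have h := mem_facetsOver.mp ht
    rw [evalCC_of_mem _ ⟨h.1, h.2.1⟩, one_mul]
    rfl
  rw [Finset.sum_congr rfl h1, sum_facetsOver_mul_incl _ _ fun _ => 1]
  simp

/-- If the sum were 1, then w and δ would share a color in one d-simplex and coincide, leaving at
most d vertices in all. -/
theorem sum_blockCC_eq_zero_of_last (hL : IsHomogeneousComplex L d)
    (hclosed : IsClosedHomologyManifold L d) (hcol : IsColoring L col) (δ : LastVertex col)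
    {τ ρ : Finset V} (hc : τ.card + ρ.card ≤ d) {w : V} (hw : w ∈ τ ∪ ρ)
    (hwc : col w = Fin.last d) :
    ∑ p : {p // InBlockCC L col k δ p}, vecCC (incl τ) p.1 * vecCC (incl ρ) p.1 = 0 := by
  rw [sum_blockCC_incl_mul_incl hL hclosed hcol, if_neg]
  rintro ⟨h1, h2⟩
  rw [← Finset.union_assoc] at h1 h2
  have hδ : δ.1 ∈ τ ∪ ρ := by
    rwa [← hcol.injOn h1 (Finset.mem_union_left _ hw) (Finset.mem_union_right _ (by simp))
      (hwc.trans δ.2.symm)]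
  rw [Finset.union_eq_left.mpr (Finset.singleton_subset_iff.mpr hδ)] at h2
  have := Finset.card_union_le τ ρ
  omega

theorem sum_blockCC_mul_ancilla (v : QubitCC L col k → ZMod 2)
    (a : Σ δ : LastVertex col, AncillaCC L col k δ) :
    ∑ p : {p // InBlockCC L col k a.1 p}, v p.1 * ind {Sum.inr a} p.1 = v (Sum.inr a) := by
  rw [Finset.sum_eq_single ⟨Sum.inr a, rfl⟩ _ (by simp)]
  · simp [ind]
  · intro p _ hp
    rw [ind, if_neg, mul_zero]
    exact fun h => hp (Subtype.ext h)

theorem vecCC_mul_ancilla (f : Finset V → ZMod 2)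
    (a : Σ δ : LastVertex col, AncillaCC L col k δ) (p : QubitCC L col k) :
    vecCC f p * ind {Sum.inr a} p = 0 := by
  rcases p with t | b
  · simp [ind]
  · exact zero_mul _

theorem exists_star_combination_of_sum_eq_zero (hL : IsHomogeneousComplex L d)
    (hclosed : IsClosedHomologyManifold L d) (hcol : IsColoring L col) {n i : ℕ}
    (hn : 0 < n)
    (hni : i + n + 1 = d) (δ : LastVertex col) (v : QubitCC L col k → ZMod 2)
    (hv : ∀ ρ : PlainFace L col n,
      ∑ p : {p // InBlockCC L col k δ p}, v p.1 * vecCC (incl ρ.1) p.1 = 0) :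
    ∃ a : Finset V → ZMod 2, ∀ t ∈ facetsOver L d {δ.1},
      evalCC v t = ∑ μ ∈ (t \ {δ.1}).powersetCard i, a μ := by
  have hδ := L.singleton_mem δ.1
  refine exists_star_combination hL hclosed hcol hδ (j := n)
    (by rw [Finset.card_singleton]; omega) (evalCC v) ?_ (n + 1) le_rfl i
    (by rw [Finset.card_singleton]; omega)
  intro ρ hρ hd hf
  have := hv ⟨ρ, face_of_subset hf Finset.subset_union_left (Finset.card_pos.mp (by omega)), hρ,
    fun u hu hc => hcol.col_notMem hf hd hu (by rw [Finset.image_singleton, δ.2, hc]; simp)⟩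
  rwa [sum_blockCC_mul_vecCC, sum_facetsOver_mul_incl] at this

theorem sum_powersetCard_sdiff_eq (t : Finset V) (v : V) (i : ℕ) (a : Finset V → ZMod 2) :
    ∑ μ ∈ (t \ {v}).powersetCard i, a μ =
      ∑ μ ∈ (Finset.univ : Finset V).powersetCard i, if v ∉ μ ∧ μ ⊆ t then a μ else 0 := by
  rw [← Finset.sum_filter]
  refine Finset.sum_congr ?_ fun _ _ => rfl
  ext μ
  simp only [Finset.mem_powersetCard, Finset.mem_filter, Finset.subset_univ, true_and,
    Finset.subset_sdiff, Finset.disjoint_singleton_right]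
  tauto

/-- Inside the block of δ, the star of μ is the star of μ ∪ {δ}, a local generator; summing over δ
assembles the whole vector. -/
theorem vecCC_mem_span_star (hcol : IsColoring L col) {i : ℕ} (f : Finset V → ZMod 2)
    (hf : ∀ δ : LastVertex col, ∃ a : Finset V → ZMod 2, ∀ t ∈ facetsOver L d {δ.1},
      f t = ∑ μ ∈ (t \ {δ.1}).powersetCard i, a μ) :
    (vecCC f : QubitCC L col k → ZMod 2) ∈
      Submodule.span (ZMod 2) (Set.range fun ρ : Simplex L i => vecCC (incl ρ.1)) := by
  choose a ha using hf
  have key : (vecCC f : QubitCC L col k → ZMod 2) =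
      ∑ δ : LastVertex col, ∑ μ ∈ (Finset.univ : Finset V).powersetCard i,
        (if δ.1 ∉ μ then a δ μ else 0) • vecCC (incl (insert δ.1 μ)) := by
    funext p
    simp only [Finset.sum_apply, Pi.smul_apply, smul_eq_mul]
    rcases p with t | b
    · obtain ⟨δ, h1, h2⟩ := existsUnique_inBlockCC hcol (Sum.inl t : QubitCC L col k)
      rw [Finset.sum_eq_single δ _ (by simp)]
      · change f t.1 = _
        rw [ha δ t.1 (mem_facetsOver.mpr h1), sum_powersetCard_sdiff_eq]
        refine Finset.sum_congr rfl fun μ _ => ?_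
        have hδt : δ.1 ∈ t.1 := Finset.singleton_subset_iff.mp h1.2.2
        simp only [vecCC, incl, Finset.insert_subset_iff, hδt, true_and]
        split_ifs <;> simp_all
      · intro δ' _ hδ'
        refine Finset.sum_eq_zero fun μ _ => ?_
        have : ¬ insert δ'.1 μ ⊆ t.1 := fun h => hδ' (h2 δ' ⟨t.2.1, t.2.2,
          Finset.singleton_subset_iff.mpr (h (Finset.mem_insert_self _ _))⟩)
        simp [vecCC, incl, this]
    · exact (Finset.sum_eq_zero fun δ _ => Finset.sum_eq_zero fun μ _ => mul_zero _).symm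
  rw [key]
  refine Submodule.sum_mem _ fun δ _ => Submodule.sum_mem _ fun μ hμ => ?_
  by_cases h : δ.1 ∉ μ
  · refine Submodule.smul_mem _ _ ?_
    by_cases hface : insert δ.1 μ ∈ L.faces
    · refine Submodule.subset_span ⟨⟨_, hface, ?_⟩, rfl⟩
      rw [Finset.card_insert_of_notMem h, (Finset.mem_powersetCard.mp hμ).2]
    · rw [vecCC_incl_eq_zero (by simp) hface]
      exact Submodule.zero_mem _
  · rw [if_neg h, zero_smul]; exact Submodule.zero_mem _

/-- Local X-operators are also products of restricted nonlocal ones: the star of μ within the block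
splits into the stars of μ ∪ {w}, where w runs over the vertices of a color other than d that μ
lacks. Orthogonality to the ancilla vectors removes any X on ancillas. -/
theorem restrict_mem_span_plainStar (hL : IsHomogeneousComplex L d)
    (hclosed : IsClosedHomologyManifold L d) (hcol : IsColoring L col) {n i : ℕ} (hn : 0 < n)
    (hni : i + n + 1 = d) (δ : LastVertex col) (u : {p // InBlockCC L col k δ p} → ZMod 2)
    (hu : ∀ ρ : PlainFace L col n, ∑ p, u p * vecCC (incl ρ.1) p.1 = 0)
    (hu' : ∀ a : Σ δ : LastVertex col, AncillaCC L col k δ, ∑ p, u p * ind {Sum.inr a} p.1 = 0) :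
    u ∈ Submodule.span (ZMod 2)
      (Set.range fun (τ : PlainFace L col (i + 1)) (p : {p // InBlockCC L col k δ p}) =>
        vecCC (incl τ.1) p.1) := by
  obtain ⟨v, hv⟩ : ∃ v : QubitCC L col k → ZMod 2, u = fun p => v p.1 :=
    ⟨fun p => if h : InBlockCC L col k δ p then u ⟨p, h⟩ else 0, funext fun p => by
      beta_reduce; rw [dif_pos p.2]⟩
  subst hv
  obtain ⟨a, ha⟩ := exists_star_combination_of_sum_eq_zero hL hclosed hcol hn hni δ v hu
  have hmiss : ∀ μ : Finset V, μ.card = i → ∃ c, c ≠ Fin.last d ∧ c ∉ μ.image col := by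
    intro μ hμ
    obtain ⟨c, hc⟩ := exists_color_notMem col (ρ := insert δ.1 μ)
      (lt_of_le_of_lt (Finset.card_insert_le _ _) (by omega))
    rw [Finset.image_insert, Finset.mem_insert, not_or, δ.2] at hc
    exact ⟨c, hc⟩
  choose! c hc hc' using hmiss
  have key : (fun p : {p // InBlockCC L col k δ p} => v p.1) =
      ∑ μ ∈ (Finset.univ : Finset V).powersetCard i, ∑ w ∈ Finset.univ.filter (col · = c μ),
        (if ∀ x ∈ μ, col x ≠ Fin.last d then a μ else 0) •
          fun p : {p // InBlockCC L col k δ p} => vecCC (incl (insert w μ)) p.1 := by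
    funext ⟨p, hp⟩
    simp only [Finset.sum_apply, Pi.smul_apply, smul_eq_mul]
    rcases p with t | ⟨δ', b⟩
    · rw [← evalCC_of_mem v t.2, ha t.1 (mem_facetsOver.mpr hp), sum_powersetCard_sdiff_eq]
      have hδt : δ.1 ∈ t.1 := Finset.singleton_subset_iff.mp hp.2.2
      refine Finset.sum_congr rfl fun μ hμ => ?_
      obtain ⟨w, hw, hwc⟩ : ∃ w ∈ t.1, col w = c μ := by
        rw [← Finset.mem_image, hcol.image_facet t.2.1 t.2.2]
        exact Finset.mem_univ _
      rw [Finset.sum_eq_single w]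
      · simp only [vecCC, incl, Finset.insert_subset_iff, hw, true_and]
        by_cases hμt : μ ⊆ t.1
        · have : δ.1 ∉ μ ↔ ∀ x ∈ μ, col x ≠ Fin.last d := by
            constructor
            · intro h x hx e
              exact h (hcol.injOn t.2.1 (hμt hx) hδt (e.trans δ.2.symm) ▸ hx)
            · exact fun h h' => h _ h' δ.2
          simp [hμt, this]
        · simp [hμt]
      · intro w' hw' hne
        have : ¬ insert w' μ ⊆ t.1 := fun h => hne (hcol.injOn t.2.1
          (h (Finset.mem_insert_self _ _)) hw ((Finset.mem_filter.mp hw').2.trans hwc.symm))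
        simp [vecCC, incl, this]
      · intro h
        exact absurd (Finset.mem_filter.mpr ⟨Finset.mem_univ w, hwc⟩) h
    · obtain rfl : δ' = δ := hp
      have := hu' ⟨δ', b⟩
      rw [sum_blockCC_mul_ancilla v ⟨δ', b⟩] at this
      rw [this]
      exact (Finset.sum_eq_zero fun δ _ => Finset.sum_eq_zero fun μ _ => mul_zero _).symm
  rw [key]
  refine Submodule.sum_mem _ fun μ hμ => Submodule.sum_mem _ fun w hw => ?_
  have hμc := (Finset.mem_powersetCard.mp hμ).2
  have hwc := (Finset.mem_filter.mp hw).2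
  split_ifs with h
  · refine Submodule.smul_mem _ _ ?_
    by_cases hface : insert w μ ∈ L.faces
    · refine Submodule.subset_span ⟨⟨_, hface, ?_, ?_⟩, rfl⟩
      · rw [Finset.card_insert_of_notMem, hμc]
        exact fun hwμ => hc' μ hμc (hwc ▸ Finset.mem_image_of_mem col hwμ)
      · intro x hx
        rcases Finset.mem_insert.mp hx with rfl | hx
        · rw [hwc]; exact hc μ hμc
        · exact h x hx
    · rw [vecCC_incl_eq_zero (by simp) hface]
      exact Submodule.zero_mem _
  · rw [zero_smul]; exact Submodule.zero_mem _

/-! ### Generators of the color code -/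

theorem ind_image_star (ρ : Finset V) :
    (ind (Sum.inl '' {σ : Simplex L d | σ.1 ∈ starOf L d ρ}) : QubitCC L col k → ZMod 2) =
      vecCC (incl ρ) := by
  funext p
  rcases p with t | a
  · have : t.1 ∈ starOf L d ρ ↔ ρ ⊆ t.1 := ⟨fun h => h.2.2, fun h => ⟨t.2.1, t.2.2, h⟩⟩
    simp [ind, vecCC, incl, this]
  · simp [ind, vecCC]

theorem mem_gensCC {g : QubitGroup (QubitCC L col k)} :
    g ∈ (colorSide L col k).gens ↔
      (∃ τ : Simplex L (d - k - 2), g = opW (vecCC (incl τ.1)) 0) ∨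
      (∃ ρ : Simplex L k, g = opW 0 (vecCC (incl ρ.1))) ∨ ∃ a, g = opW 0 (ind {Sum.inr a}) := by
  rw [CSSCode.mem_gens]
  constructor
  · rintro (⟨s, hs, rfl⟩ | ⟨s, hs, rfl⟩)
    · rcases hs with ⟨_, ⟨τ, rfl⟩, rfl⟩ | ⟨_, h, -⟩
      · exact Or.inl ⟨τ, by rw [ind_image_star]⟩
      · exact h.elim
    · rcases hs with ⟨_, ⟨ρ, rfl⟩, rfl⟩ | ⟨_, ⟨a, rfl⟩, rfl⟩
      · exact Or.inr (Or.inl ⟨ρ, by rw [ind_image_star]⟩)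
      · exact Or.inr (Or.inr ⟨a, by rw [Set.image_singleton]⟩)
  · rintro (⟨τ, rfl⟩ | ⟨ρ, rfl⟩ | ⟨a, rfl⟩)
    · exact Or.inl ⟨_, Or.inl ⟨_, ⟨τ, rfl⟩, rfl⟩, by rw [ind_image_star]⟩
    · exact Or.inr ⟨_, Or.inl ⟨_, ⟨ρ, rfl⟩, rfl⟩, by rw [ind_image_star]⟩
    · exact Or.inr ⟨_, Or.inr ⟨_, ⟨a, rfl⟩, rfl⟩, by rw [Set.image_singleton]⟩

/-- A generator at a simplex with a vertex of color d is local: its simplex and one of the other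
type have d vertices together, so it commutes blockwise with every nonlocal generator. -/
theorem gensCC_cases (hk : k + 2 ≤ d) (hL : IsHomogeneousComplex L d)
    (hclosed : IsClosedHomologyManifold L d) (hcol : IsColoring L col)
    {g : QubitGroup (QubitCC L col k)} (hg : g ∈ (colorSide L col k).gens) :
    (∃ τ : PlainFace L col (d - k - 2 + 1), g = opW (vecCC (incl τ.1)) 0) ∨
    (∃ ρ : PlainFace L col (k + 1), g = opW 0 (vecCC (incl ρ.1))) ∨
    (∃ u : QubitCC L col k → ZMod 2,
      (∀ δ (ρ : PlainFace L col (k + 1)),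
        ∑ p : {p // InBlockCC L col k δ p}, u p.1 * vecCC (incl ρ.1) p.1 = 0) ∧
      (∀ δ (a : Σ δ : LastVertex col, AncillaCC L col k δ),
        ∑ p : {p // InBlockCC L col k δ p}, u p.1 * ind {Sum.inr a} p.1 = 0) ∧ g = opW u 0) ∨
    ∃ v : QubitCC L col k → ZMod 2,
      (∀ δ (τ : PlainFace L col (d - k - 2 + 1)),
        ∑ p : {p // InBlockCC L col k δ p}, vecCC (incl τ.1) p.1 * v p.1 = 0) ∧ g = opW 0 v := by
  rcases mem_gensCC.mp hg with ⟨τ, rfl⟩ | ⟨ρ, rfl⟩ | ⟨a, rfl⟩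
  · by_cases h : ∀ v ∈ τ.1, col v ≠ Fin.last d
    · exact Or.inl ⟨⟨τ.1, τ.2.1, τ.2.2, h⟩, rfl⟩
    · push Not at h
      obtain ⟨w, hw, hwc⟩ := h
      refine Or.inr (Or.inr (Or.inl ⟨_, fun δ ρ => ?_, fun δ a => ?_, rfl⟩))
      · refine sum_blockCC_eq_zero_of_last hL hclosed hcol δ ?_ (Finset.mem_union_left _ hw) hwc
        rw [τ.2.2, ρ.2.2.1]
        omega
      · exact Finset.sum_eq_zero fun p _ => vecCC_mul_ancilla _ _ _
  · by_cases h : ∀ v ∈ ρ.1, col v ≠ Fin.last d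
    · exact Or.inr (Or.inl ⟨⟨ρ.1, ρ.2.1, ρ.2.2, h⟩, rfl⟩)
    · push Not at h
      obtain ⟨w, hw, hwc⟩ := h
      refine Or.inr (Or.inr (Or.inr ⟨_, fun δ τ => ?_, rfl⟩))
      refine sum_blockCC_eq_zero_of_last hL hclosed hcol δ ?_ (Finset.mem_union_right _ hw) hwc
      rw [ρ.2.2, τ.2.2.1]
      omega
  · exact Or.inr (Or.inr (Or.inr ⟨_, fun δ τ =>
      Finset.sum_eq_zero fun p _ => vecCC_mul_ancilla _ _ _, rfl⟩))

/-- Completeness of the local X-stabilizers: orthogonality to the ρ's with k+1 vertices forces, in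
each block, a combination of stars of simplices with d-k-2 vertices in the link of δ. -/
theorem opW_left_mem_gensCC (hk : k + 2 ≤ d) (hL : IsHomogeneousComplex L d)
    (hclosed : IsClosedHomologyManifold L d) (hcol : IsColoring L col)
    (u : QubitCC L col k → ZMod 2)
    (hu : ∀ δ (ρ : PlainFace L col (k + 1)),
      ∑ p : {p // InBlockCC L col k δ p}, u p.1 * vecCC (incl ρ.1) p.1 = 0)
    (hu' : ∀ δ (a : Σ δ : LastVertex col, AncillaCC L col k δ),
      ∑ p : {p // InBlockCC L col k δ p}, u p.1 * ind {Sum.inr a} p.1 = 0) :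
    opW u 0 ∈ Subgroup.closure ((colorSide L col k).gens) := by
  refine opW_left_mem_of_mem_span _
    (Set.range fun τ : Simplex L (d - k - 2) => vecCC (incl τ.1)) ?_ ?_
  · rintro _ ⟨τ, rfl⟩
    exact Subgroup.subset_closure (mem_gensCC.mpr (Or.inl ⟨τ, rfl⟩))
  · rw [vecCC_evalCC_add u, Finset.sum_eq_zero, add_zero]
    · exact vecCC_mem_span_star hcol _ fun δ => exists_star_combination_of_sum_eq_zero hL hclosed
        hcol (Nat.succ_pos k) (by omega) δ u (hu δ)
    · intro a _
      rw [← sum_blockCC_mul_ancilla u a, hu' a.1 a, zero_smul]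

/-- The same duality with the sizes exchanged; here the ancilla part is arbitrary, each ancilla
being stabilized by its Z. -/
theorem opW_right_mem_gensCC (hk : k + 2 ≤ d) (hL : IsHomogeneousComplex L d)
    (hclosed : IsClosedHomologyManifold L d) (hcol : IsColoring L col)
    (v : QubitCC L col k → ZMod 2)
    (hv : ∀ δ (τ : PlainFace L col (d - k - 2 + 1)),
      ∑ p : {p // InBlockCC L col k δ p}, vecCC (incl τ.1) p.1 * v p.1 = 0) :
    opW 0 v ∈ Subgroup.closure ((colorSide L col k).gens) := by
  refine opW_right_mem_of_mem_span _
    ((Set.range fun ρ : Simplex L k => vecCC (incl ρ.1)) ∪ Set.range fun a => ind {Sum.inr a})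
    ?_ ?_
  · rintro _ (⟨ρ, rfl⟩ | ⟨a, rfl⟩)
    · exact Subgroup.subset_closure (mem_gensCC.mpr (Or.inr (Or.inl ⟨ρ, rfl⟩)))
    · exact Subgroup.subset_closure (mem_gensCC.mpr (Or.inr (Or.inr ⟨a, rfl⟩)))
  · rw [vecCC_evalCC_add v]
    refine Submodule.add_mem _ (Submodule.span_mono Set.subset_union_left ?_)
      (Submodule.sum_mem _ fun a _ => Submodule.smul_mem _ _
        (Submodule.subset_span (Or.inr ⟨a, rfl⟩)))
    refine vecCC_mem_span_star hcol _ fun δ => exists_star_combination_of_sum_eq_zero hL hclosed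
      hcol (n := d - k - 2 + 1) (Nat.succ_pos _) (by omega) δ v fun ρ => ?_
    rw [← hv δ ρ]
    exact Finset.sum_congr rfl fun p _ => mul_comm _ _

end ColorRegister

/-! ## The toric code register -/

section ToricRegister

set_option linter.unusedSectionVars false

variable {V : Type*} {d k : ℕ} {L : AbstractSimplicialComplex V} {col : V → Fin (d + 1)} [Fintype V]

/-- The simplices that carry a qubit of one of the toric codes. -/
def IsToricSimplex (L : AbstractSimplicialComplex V) (col : V → Fin (d + 1)) (k : ℕ)
    (s : Finset V) : Prop :=
  s ∈ L.faces ∧ s.card = k + 2 ∧ Fin.last d ∈ s.image col ∧ (s.image col)ᶜ.card = d - 1 - k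

/-- The toric code qubit on a simplex. -/
def qubitTC (s : Finset V) (h : IsToricSimplex L col k s) : QubitTC L col k :=
  Sum.inl ⟨⟨(s.image col)ᶜ, by simpa using h.2.2.1, h.2.2.2⟩,
    ⟨Sum.inl ⟨s, h.1, h.2.1.le, fun v hv => by simpa using ⟨v, hv, rfl⟩⟩, by
      change s.card - 1 = k + 1
      have := h.2.1
      omega⟩⟩

/-- A function on simplices as a vector on the toric code register. -/
def vecTC (f : Finset V → ZMod 2) : QubitTC L col k → ZMod 2
  | Sum.inl ⟨_, ⟨Sum.inl σ, _⟩⟩ => f σ.1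
  | Sum.inl ⟨_, ⟨Sum.inr _, _⟩⟩ => 0
  | Sum.inr _ => 0

/-- A vector on the toric code register as a function on simplices. -/
def evalTC (v : QubitTC L col k → ZMod 2) : Finset V → ZMod 2 := fun s =>
  if h : IsToricSimplex L col k s then v (qubitTC s h) else 0

theorem evalTC_of_mem (v : QubitTC L col k → ZMod 2) {s : Finset V}
    (h : IsToricSimplex L col k s) : evalTC v s = v (qubitTC s h) := dif_pos h

theorem vecTC_qubitTC (f : Finset V → ZMod 2) {s : Finset V} (h : IsToricSimplex L col k s) :
    vecTC f (qubitTC s h) = f s := rfl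

theorem IsColoring.image_eq_compl (hk : k + 2 ≤ d) (hcol : IsColoring L col)
    {N : Finset (Fin (d + 1))} (hN : N.card = d - 1 - k) {s : Finset V} (hs : s ∈ L.faces)
    (hc : s.card = k + 2) (hsN : ∀ v ∈ s, col v ∉ N) : s.image col = Nᶜ := by
  refine Finset.eq_of_subset_of_card_le (fun c h => ?_) ?_
  · obtain ⟨v, hv, rfl⟩ := Finset.mem_image.mp h
    exact Finset.mem_compl.mpr (hsN v hv)
  · rw [Finset.card_compl, Fintype.card_fin, hcol.card_image hs, hN]
    omega

theorem IsColoring.isToricSimplex (hk : k + 2 ≤ d) (hcol : IsColoring L col) {s : Finset V}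
    (hs : s ∈ L.faces) (hc : s.card = k + 2) {δ : LastVertex col} (hδ : δ.1 ∈ s) :
    IsToricSimplex L col k s := by
  refine ⟨hs, hc, δ.2 ▸ Finset.mem_image_of_mem col hδ, ?_⟩
  rw [Finset.card_compl, Fintype.card_fin, hcol.card_image hs]
  omega

/-- The color set N is determined by the simplex as the complement of its colors, and attached cells
have dimension k+2, so they carry no qubit. -/
theorem qubitTC_cases (hk : k + 2 ≤ d) (hcol : IsColoring L col) {motive : QubitTC L col k → Prop}
    (simplex : ∀ s h, motive (qubitTC s h)) (ancilla : ∀ a, motive (Sum.inr a))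
    (q : QubitTC L col k) : motive q := by
  rcases q with ⟨⟨N, hN⟩, ⟨⟨σ, hσ⟩ | τ, hdim⟩⟩ | a
  · change σ.card - 1 = k + 1 at hdim
    have hc : σ.card = k + 2 := by omega
    have himg := hcol.image_eq_compl hk hN.2 hσ.1 hc hσ.2.2
    obtain rfl : N = (σ.image col)ᶜ := by rw [himg, compl_compl]
    exact simplex σ ⟨hσ.1, hc, by simpa using hN.1, hN.2⟩
  · exact absurd (show k + 2 = k + 1 from hdim) (by omega)
  · exact ancilla a

theorem vecTC_evalTC_add (hk : k + 2 ≤ d) (hcol : IsColoring L col)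
    (v : QubitTC L col k → ZMod 2) :
    v = vecTC (evalTC v) + ∑ a, v (Sum.inr a) • ind {Sum.inr a} := by
  funext p
  rw [Pi.add_apply, Finset.sum_apply]
  induction p using qubitTC_cases hk hcol with
  | simplex s h =>
    rw [Finset.sum_eq_zero fun a _ => by simp [ind, qubitTC], add_zero]
    exact (evalTC_of_mem v h).symm
  | ancilla a =>
    rw [Finset.sum_eq_single a (fun b _ hb => by simp [ind, Ne.symm hb]) (by simp)]
    simp [ind, vecTC]

theorem existsUnique_inBlockTC (hk : k + 2 ≤ d) (hcol : IsColoring L col) (q : QubitTC L col k) :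
    ∃! δ, InBlockTC L col k δ q := by
  induction q using qubitTC_cases hk hcol with
  | simplex s h =>
    obtain ⟨δ, h1, h2⟩ := hcol.exists_last h.1 h.2.2.1
    exact ⟨δ, ⟨h.1, h.2.1, Finset.singleton_subset_iff.mpr h1⟩,
      fun δ' h => h2 δ' (Finset.singleton_subset_iff.mp h.2.2)⟩
  | ancilla a => exact ⟨a.1, rfl, fun δ' h => h.symm⟩

theorem isToricSimplex_of_mem (hk : k + 2 ≤ d) (hcol : IsColoring L col) {δ : LastVertex col}
    {s : Finset V} (hs : s ∈ facetsOver L (k + 1) {δ.1}) : IsToricSimplex L col k s := by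
  have h := mem_facetsOver.mp hs
  exact hcol.isToricSimplex hk h.1 h.2.1 (Finset.singleton_subset_iff.mp h.2.2)

/-- The qubits of a block of the toric code register. -/
def blockEquivTC (hk : k + 2 ≤ d) (hcol : IsColoring L col) (δ : LastVertex col) :
    {s // s ∈ facetsOver L (k + 1) {δ.1}} ⊕ AncillaTC L col k δ ≃
      {q // InBlockTC L col k δ q} :=
  Equiv.ofBijective
    (Sum.elim
      (fun s => ⟨qubitTC s.1 (isToricSimplex_of_mem hk hcol s.2), mem_facetsOver.mp s.2⟩)
      (fun a => ⟨Sum.inr ⟨δ, a⟩, rfl⟩)) (by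
    constructor
    · rintro (s | a) (s' | a') h
      · refine congrArg Sum.inl (Subtype.ext ?_)
        have h' := congrArg Subtype.val h
        by_contra hne
        -- Evaluating the indicator vector of s on both qubits separates them without comparing
        -- dependent pairs.
        have := congrArg (vecTC fun r => if r = s.1 then 1 else 0) h'
        rw [Sum.elim_inl, Sum.elim_inl, vecTC_qubitTC, vecTC_qubitTC, if_pos rfl,
          if_neg (Ne.symm hne)] at this
        exact one_ne_zero this
      · cases congrArg Subtype.val h
      · cases congrArg Subtype.val h
      · have := Sum.inr_injective (congrArg Subtype.val h)
        exact congrArg Sum.inr (eq_of_heq (Sigma.mk.inj this).2)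
    · rintro ⟨q, h⟩
      induction q using qubitTC_cases hk hcol with
      | simplex s hs => exact ⟨Sum.inl ⟨s, mem_facetsOver.mpr h⟩, rfl⟩
      | ancilla a =>
        obtain ⟨δ', a⟩ := a
        obtain rfl : δ' = δ := h
        exact ⟨Sum.inr a, rfl⟩)

theorem card_facetsOver_eq_ncard (n : ℕ) (ρ : Finset V) :
    (facetsOver L n ρ).card = (starOf L n ρ).ncard := by
  rw [← Set.ncard_coe_finset]
  congr 1
  ext t
  rw [Finset.mem_coe, mem_facetsOver]
  rfl

/-- By truncated subtraction, the ancillas pad each block to the larger of the two numbers of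
simplices. -/
theorem card_block_eq (hk : k + 2 ≤ d) (hcol : IsColoring L col) (δ : LastVertex col) :
    Fintype.card {p // InBlockCC L col k δ p} = Fintype.card {q // InBlockTC L col k δ q} := by
  rw [← Fintype.card_congr (blockEquivCC δ), ← Fintype.card_congr (blockEquivTC hk hcol δ),
    Fintype.card_sum, Fintype.card_sum, Fintype.card_coe, Fintype.card_coe,
    card_facetsOver_eq_ncard, card_facetsOver_eq_ncard, Fintype.card_fin, Fintype.card_fin]
  omega

theorem sum_blockTC (hk : k + 2 ≤ d) (hcol : IsColoring L col) (δ : LastVertex col)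
    (w : QubitTC L col k → ZMod 2) :
    ∑ q : {q // InBlockTC L col k δ q}, w q.1 =
      ∑ s ∈ facetsOver L (k + 1) {δ.1}, evalTC w s + ∑ a, w (Sum.inr ⟨δ, a⟩) := by
  rw [← Equiv.sum_comp (blockEquivTC hk hcol δ) fun q => w q.1, Fintype.sum_sum_type,
    ← Finset.sum_coe_sort _ (evalTC w)]
  congr 1
  exact Finset.sum_congr rfl fun s _ =>
    (evalTC_of_mem w (isToricSimplex_of_mem hk hcol s.2)).symm

theorem sum_blockTC_mul_vecTC (hk : k + 2 ≤ d) (hcol : IsColoring L col) (δ : LastVertex col)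
    (v : QubitTC L col k → ZMod 2) (f : Finset V → ZMod 2) :
    ∑ q : {q // InBlockTC L col k δ q}, v q.1 * vecTC f q.1 =
      ∑ s ∈ facetsOver L (k + 1) {δ.1}, evalTC v s * f s := by
  have h0 : ∑ a, v (Sum.inr ⟨δ, a⟩) * vecTC f (Sum.inr ⟨δ, a⟩ : QubitTC L col k) = 0 :=
    Finset.sum_eq_zero fun a _ => mul_zero _
  rw [sum_blockTC hk hcol δ fun p => v p * vecTC f p, h0, add_zero]
  refine Finset.sum_congr rfl fun s hs => ?_
  rw [evalTC_of_mem _ (isToricSimplex_of_mem hk hcol hs),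
    evalTC_of_mem _ (isToricSimplex_of_mem hk hcol hs), vecTC_qubitTC]

theorem sum_blockTC_mul_ancilla (v : QubitTC L col k → ZMod 2)
    (a : Σ δ : LastVertex col, AncillaTC L col k δ) :
    ∑ p : {p // InBlockTC L col k a.1 p}, v p.1 * ind {Sum.inr a} p.1 = v (Sum.inr a) := by
  rw [Finset.sum_eq_single ⟨Sum.inr a, rfl⟩ _ (by simp)]
  · simp [ind]
  · intro p _ hp
    rw [ind, if_neg, mul_zero]
    exact fun h => hp (Subtype.ext h)

theorem vecTC_mul_ancilla (f : Finset V → ZMod 2)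
    (a : Σ δ : LastVertex col, AncillaTC L col k δ) (p : QubitTC L col k) :
    vecTC f p * ind {Sum.inr a} p = 0 := by
  rcases p with t | b
  · simp [ind]
  · exact zero_mul _

/-- The vector of the simplices joined to `τ`. -/
def joinVec (L : AbstractSimplicialComplex V) (τ : Finset V) : Finset V → ZMod 2 := fun s =>
  if Disjoint s τ ∧ s ∪ τ ∈ L.faces then 1 else 0

/-- The vector of the simplices that contain `ρ` and have all colors outside `N`. -/
def inclOff (col : V → Fin (d + 1)) (N : Finset (Fin (d + 1))) (ρ : Finset V) :
    Finset V → ZMod 2 := fun s => if ρ ⊆ s ∧ s.image col = Nᶜ then 1 else 0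

/-- Only one (k+1)-simplex can contain both δ and the k+1 vertices of ρ. -/
theorem sum_facetsOver_mul_incl_of_plain (δ : LastVertex col) (ρ : PlainFace L col (k + 1))
    (y : Finset V → ZMod 2) (hy : insert δ.1 ρ.1 ∉ L.faces → y (insert δ.1 ρ.1) = 0) :
    ∑ s ∈ facetsOver L (k + 1) {δ.1}, y s * incl ρ.1 s = y (insert δ.1 ρ.1) := by
  have hδ : δ.1 ∉ ρ.1 := fun h => ρ.2.2.2 _ h δ.2
  have hc := Finset.card_insert_of_notMem hδ
  rw [ρ.2.2.1] at hc
  rw [Finset.sum_eq_single (insert δ.1 ρ.1)]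
  · simp [incl]
  · intro s hs hne
    rw [incl, if_neg, mul_zero]
    intro hρs
    have h := mem_facetsOver.mp hs
    refine hne (Finset.eq_of_subset_of_card_le
      (Finset.insert_subset (Finset.singleton_subset_iff.mp h.2.2) hρs) ?_).symm
    rw [h.2.1, hc]
  · intro h
    rw [hy, zero_mul]
    exact fun hf => h (mem_facetsOver.mpr ⟨hf, hc, by simp⟩)

theorem sum_blockTC_joinVec_mul_incl (hk : k + 2 ≤ d) (hcol : IsColoring L col)
    (δ : LastVertex col) (τ : PlainFace L col (d - k - 2 + 1)) (ρ : PlainFace L col (k + 1)) :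
    ∑ q : {q // InBlockTC L col k δ q}, vecTC (joinVec L τ.1) q.1 * vecTC (incl ρ.1) q.1 =
      if τ.1 ∪ (ρ.1 ∪ {δ.1}) ∈ L.faces ∧ (τ.1 ∪ (ρ.1 ∪ {δ.1})).card = d + 1 then 1 else 0 := by
  have hδ : δ.1 ∉ ρ.1 := fun h => ρ.2.2.2 _ h δ.2
  have hc := Finset.card_insert_of_notMem hδ
  rw [ρ.2.2.1] at hc
  have h1 : ∀ s ∈ facetsOver L (k + 1) {δ.1},
      evalTC (vecTC (joinVec L τ.1) : QubitTC L col k → ZMod 2) s * incl ρ.1 s =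
        joinVec L τ.1 s * incl ρ.1 s := fun s hs => by
    rw [evalTC_of_mem _ (isToricSimplex_of_mem hk hcol hs), vecTC_qubitTC]
  rw [sum_blockTC_mul_vecTC hk hcol, Finset.sum_congr rfl h1,
    sum_facetsOver_mul_incl_of_plain]
  · have h2 : τ.1 ∪ (ρ.1 ∪ {δ.1}) = insert δ.1 ρ.1 ∪ τ.1 := by
      rw [Finset.union_comm, Finset.insert_eq, Finset.union_comm ρ.1]
    rw [h2, joinVec]
    refine if_congr ⟨fun h => ⟨h.2, ?_⟩, fun h => ⟨?_, h.1⟩⟩ rfl rfl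
    · rw [Finset.card_union_of_disjoint h.1, hc, τ.2.2.1]
      omega
    · rw [← Finset.card_union_eq_card_add_card, h.2, hc, τ.2.2.1]
      omega
  · intro h
    exact if_neg fun h' => h (face_of_subset h'.2 Finset.subset_union_left (by simp))

/-- Each simplex qubit of the block is ρ ∪ {δ} for some ρ without color d, and the restricted
Z-generator of ρ is the Z of that qubit alone. Hence no X-operator commutes with all of them. -/
theorem eq_zero_of_sum_blockTC (hk : k + 2 ≤ d) (hcol : IsColoring L col) (δ : LastVertex col)
    (u : {q // InBlockTC L col k δ q} → ZMod 2)
    (hu : ∀ ρ : PlainFace L col (k + 1), ∑ q, u q * vecTC (incl ρ.1) q.1 = 0)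
    (hu' : ∀ a : Σ δ : LastVertex col, AncillaTC L col k δ, ∑ q, u q * ind {Sum.inr a} q.1 = 0) :
    u = 0 := by
  obtain ⟨v, hv⟩ : ∃ v : QubitTC L col k → ZMod 2, u = fun p => v p.1 :=
    ⟨fun p => if h : InBlockTC L col k δ p then u ⟨p, h⟩ else 0, funext fun p => by
      beta_reduce; rw [dif_pos p.2]⟩
  subst hv
  funext ⟨q, hq⟩
  induction q using qubitTC_cases hk hcol with
  | simplex s hs =>
    have hδ : δ.1 ∈ s := Finset.singleton_subset_iff.mp hq.2.2
    have hc : (s.erase δ.1).card = k + 1 := by rw [Finset.card_erase_of_mem hδ, hs.2.1]; rfl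
    have h1 := hu ⟨s.erase δ.1, face_of_subset hs.1 (Finset.erase_subset _ _)
      (Finset.card_pos.mp (by omega)), hc, fun v hv hvc => Finset.ne_of_mem_erase hv
        (hcol.injOn hs.1 (Finset.mem_of_mem_erase hv) hδ (hvc.trans δ.2.symm))⟩
    rw [sum_blockTC_mul_vecTC hk hcol, sum_facetsOver_mul_incl_of_plain,
      Finset.insert_erase hδ, evalTC_of_mem _ hs] at h1
    · exact h1
    · exact fun h => dif_neg fun h' => h h'.1
  | ancilla a =>
    obtain rfl : a.1 = δ := hq
    exact (sum_blockTC_mul_ancilla v a).symm.trans (hu' a)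

/-! ### Generators of the toric codes -/

theorem ind_image_sigma (N N' : ColorChoice d k) (S : Set ((shrunk L col k N.1).CellOfDim (k + 1)))
    (c : (shrunk L col k N'.1).CellOfDim (k + 1)) :
    (ind (Sum.inl '' (Sigma.mk N '' S)) : QubitTC L col k → ZMod 2) (Sum.inl ⟨N', c⟩) =
      if ∃ h : N' = N, h ▸ c ∈ S then 1 else 0 := by
  refine if_congr ?_ rfl rfl
  rw [Sum.inl_injective.mem_set_image]
  constructor
  · rintro ⟨c', hc', e⟩
    cases e
    exact ⟨rfl, hc'⟩
  · rintro ⟨rfl, h⟩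
    exact ⟨c, h, rfl⟩

/-- A simplex joined to τ has the colors complementary to N, so it occurs in the register of N only,
and N may be dropped from the label. -/
theorem ind_toric_x (hk : k + 2 ≤ d) (hcol : IsColoring L col) (N : ColorChoice d k)
    (τ : {τ : Simplex L (d - 2 - k) // τ.1.image col = N.1}) :
    (ind (Sum.inl '' (Sigma.mk N '' {σ | (shrunk L col k N.1).IsFace σ.1 (Sum.inr τ)})) :
      QubitTC L col k → ZMod 2) = vecTC (joinVec L τ.1.1) := by
  have hτc : τ.1.1.card = d - 1 - k := by rw [τ.1.2.2]; omega
  funext q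
  rcases q with ⟨N', ⟨σ | τ', hdim⟩⟩ | a
  · rw [ind_image_sigma]
    change σ.1.card - 1 = k + 1 at hdim
    have hc : σ.1.card = k + 2 := by omega
    refine if_congr ⟨?_, ?_⟩ rfl rfl
    · rintro ⟨rfl, ρ, hρ, hσρ⟩
      rw [mem_linkOf_iff hk hτc] at hρ
      obtain rfl := Finset.eq_of_subset_of_card_le hσρ (by omega)
      exact hρ.2
    · rintro ⟨h1, h2⟩
      obtain rfl : N' = N := by
        suffices h : N.1 ⊆ N'.1 from
          Subtype.ext (Finset.eq_of_subset_of_card_le h (N'.2.2.trans N.2.2.symm).le).symm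
        intro c hcN
        rw [← τ.2] at hcN
        obtain ⟨v, hv, rfl⟩ := Finset.mem_image.mp hcN
        have h3 : col v ∉ σ.1.image col :=
          hcol.col_notMem (Finset.union_comm σ.1 τ.1.1 ▸ h2) h1.symm hv
        rw [hcol.image_eq_compl hk N'.2.2 σ.2.1 hc σ.2.2.2] at h3
        simpa using h3
      exact ⟨rfl, σ.1, (mem_linkOf_iff hk hτc).mpr ⟨hc, h1, h2⟩, subset_rfl⟩
  · exact absurd (show k + 2 = k + 1 from hdim) (by omega)
  · simp [ind, vecTC]

theorem ind_toric_z (hk : k + 2 ≤ d) (hcol : IsColoring L col) (N : ColorChoice d k)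
    (ρ : {σ : Finset V // σ ∈ L.faces ∧ σ.card ≤ k + 2 ∧ ∀ v ∈ σ, col v ∉ N.1})
    (hρ : ρ.1.card = k + 1) :
    (ind (Sum.inl '' (Sigma.mk N '' {σ | (shrunk L col k N.1).IsFace (Sum.inl ρ) σ.1})) :
      QubitTC L col k → ZMod 2) = vecTC (inclOff col N.1 ρ.1) := by
  funext q
  rcases q with ⟨N', ⟨σ | τ', hdim⟩⟩ | a
  · rw [ind_image_sigma]
    change σ.1.card - 1 = k + 1 at hdim
    have hc : σ.1.card = k + 2 := by omega
    have himg := hcol.image_eq_compl hk N'.2.2 σ.2.1 hc σ.2.2.2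
    refine if_congr ⟨?_, ?_⟩ rfl rfl
    · rintro ⟨rfl, h⟩
      exact ⟨Finset.Subset.trans h.1 subset_rfl, himg⟩
    · rintro ⟨h1, h2⟩
      obtain rfl : N' = N := Subtype.ext (compl_injective (himg.symm.trans h2))
      refine ⟨rfl, ?_⟩
      change ρ.1 ⊂ σ.1
      exact h1.ssubset_of_ne fun e => by rw [e] at hρ; omega
  · exact absurd (show k + 2 = k + 1 from hdim) (by omega)
  · simp [ind, vecTC]

theorem mem_gensTC (hk : k + 2 ≤ d) (hcol : IsColoring L col) {g : QubitGroup (QubitTC L col k)} :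
    g ∈ (toricSide L col k).gens ↔
      (∃ τ : PlainFace L col (d - k - 2 + 1), g = opW (vecTC (joinVec L τ.1)) 0) ∨
      (∃ N : ColorChoice d k, ∃ ρ ∈ L.faces, ρ.card = k + 1 ∧ (∀ v ∈ ρ, col v ∉ N.1) ∧
        g = opW 0 (vecTC (inclOff col N.1 ρ))) ∨
      ∃ a, g = opW 0 (ind {Sum.inr a}) := by
  rw [CSSCode.mem_gens]
  constructor
  · rintro (⟨s, hs, rfl⟩ | ⟨s, hs, rfl⟩)
    · rcases hs with ⟨_, ⟨N, _, ⟨c, hc, rfl⟩, rfl⟩, rfl⟩ | ⟨_, h, -⟩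
      · rcases c with σ | τ
        · change σ.1.card - 1 = k + 1 + 1 at hc
          have := σ.2.2.1
          omega
        · refine Or.inl ⟨⟨τ.1.1, τ.1.2.1, by rw [τ.1.2.2]; omega, fun v hv hvc => N.2.1 ?_⟩, by
            rw [ind_toric_x hk hcol]⟩
          have := Finset.mem_image_of_mem col hv
          rwa [hvc, τ.2] at this
      · exact h.elim
    · rcases hs with ⟨_, ⟨N, _, ⟨c, hc, rfl⟩, rfl⟩, rfl⟩ | ⟨_, ⟨a, rfl⟩, rfl⟩
      · rcases c with ρ | τ
        · change ρ.1.card - 1 + 1 = k + 1 at hc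
          have := (face_nonempty ρ.2.1).card_pos
          have hρ : ρ.1.card = k + 1 := by omega
          exact Or.inr (Or.inl ⟨N, ρ.1, ρ.2.1, hρ, ρ.2.2.2, by rw [ind_toric_z hk hcol N ρ hρ]⟩)
        · change k + 2 + 1 = k + 1 at hc
          omega
      · exact Or.inr (Or.inr ⟨a, by rw [Set.image_singleton]⟩)
  · rintro (⟨τ, rfl⟩ | ⟨N, ρ, hρ, hc, hρN, rfl⟩ | ⟨a, rfl⟩)
    · let N : ColorChoice d k := ⟨τ.1.image col, fun h => by
        obtain ⟨v, hv, e⟩ := Finset.mem_image.mp h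
        exact τ.2.2.2 v hv e, by rw [hcol.card_image τ.2.1, τ.2.2.1]; omega⟩
      let t : {t : Simplex L (d - 2 - k) // t.1.image col = N.1} :=
        ⟨⟨τ.1, τ.2.1, by rw [τ.2.2.1]; omega⟩, rfl⟩
      exact Or.inl ⟨_, Or.inl ⟨_, ⟨N, _, ⟨Sum.inr t, rfl, rfl⟩, rfl⟩, rfl⟩, by
        rw [ind_toric_x hk hcol]⟩
    · refine Or.inr ⟨_, Or.inl ⟨_, ⟨N, _, ⟨Sum.inl ⟨ρ, hρ, by omega, hρN⟩, ?_, rfl⟩, rfl⟩, rfl⟩, by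
        rw [ind_toric_z hk hcol N _ hc]⟩
      change ρ.card - 1 + 1 = k + 1
      omega
    · exact Or.inr ⟨_, Or.inr ⟨_, ⟨a, rfl⟩, rfl⟩, by rw [Set.image_singleton]⟩

end ToricRegister

/-! ### Local and nonlocal generators of the toric codes. -/

section ToricGenerators

set_option linter.unusedSectionVars false

variable {V : Type*} {d k : ℕ} {L : AbstractSimplicialComplex V} {col : V → Fin (d + 1)} [Fintype V]

theorem ite_and_eq_mul (p q : Prop) [Decidable p] [Decidable q] [Decidable (p ∧ q)] (x : ZMod 2) :
    (if p ∧ q then x else 0) = (if p then x else 0) * if q then 1 else 0 := by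
  split_ifs <;> simp_all

theorem vecTC_congr (hk : k + 2 ≤ d) (hcol : IsColoring L col) {f g : Finset V → ZMod 2}
    (h : ∀ s, IsToricSimplex L col k s → f s = g s) :
    (vecTC f : QubitTC L col k → ZMod 2) = vecTC g := by
  funext q
  induction q using qubitTC_cases hk hcol with
  | simplex s hs => exact h s hs
  | ancilla a => rfl

/-- A toric simplex containing ρ has as colors those of ρ together with d, so the condition on N
holds automatically. -/
theorem vecTC_inclOff_of_plain (hk : k + 2 ≤ d) (hcol : IsColoring L col) (N : ColorChoice d k)
    (ρ : PlainFace L col (k + 1)) (hρN : ∀ v ∈ ρ.1, col v ∉ N.1) :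
    (vecTC (inclOff col N.1 ρ.1) : QubitTC L col k → ZMod 2) = vecTC (incl ρ.1) := by
  refine vecTC_congr hk hcol fun s hs => if_congr (and_iff_left_of_imp fun h => ?_) rfl rfl
  have hc : (insert (Fin.last d) (ρ.1.image col)).card = k + 2 := by
    rw [Finset.card_insert_of_notMem, hcol.card_image ρ.2.1, ρ.2.2.1]
    intro h
    obtain ⟨v, hv, e⟩ := Finset.mem_image.mp h
    exact ρ.2.2.2 v hv e
  have hNc := N.2.2
  have h1 : insert (Fin.last d) (ρ.1.image col) = s.image col := by
    refine Finset.eq_of_subset_of_card_le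
      (Finset.insert_subset hs.2.2.1 (Finset.image_subset_image h)) ?_
    rw [hcol.card_image hs.1, hs.2.1, hc]
  rw [← h1]
  refine Finset.eq_of_subset_of_card_le (fun c hcc => ?_) ?_
  · rw [Finset.mem_compl]
    rcases Finset.mem_insert.mp hcc with rfl | hcc
    · exact N.2.1
    · obtain ⟨v, hv, rfl⟩ := Finset.mem_image.mp hcc
      exact hρN v hv
  · rw [Finset.card_compl, Fintype.card_fin, hc]
    omega

/-- The sum is empty unless δ = w and τ has color N. In that case s ↦ s ∪ τ identifies the common
qubits with the top simplices over ρ ∪ τ, a set of d vertices, so their number is even. -/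
theorem sum_blockTC_joinVec_mul_inclOff (hk : k + 2 ≤ d) (hL : IsHomogeneousComplex L d)
    (hclosed : IsClosedHomologyManifold L d) (hcol : IsColoring L col) (δ : LastVertex col)
    (τ : PlainFace L col (d - k - 2 + 1)) (N : ColorChoice d k) {ρ : Finset V}
    (hρc : ρ.card = k + 1) (hρN : ∀ v ∈ ρ, col v ∉ N.1) {w : V} (hw : w ∈ ρ)
    (hwc : col w = Fin.last d) :
    ∑ q : {q // InBlockTC L col k δ q},
      vecTC (joinVec L τ.1) q.1 * vecTC (inclOff col N.1 ρ) q.1 = 0 := by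
  have hNc := N.2.2
  have hτc : τ.1.card = d - 1 - k := by rw [τ.2.2.1]; omega
  rw [sum_blockTC_mul_vecTC hk hcol]
  have h1 : ∀ s ∈ facetsOver L (k + 1) {δ.1},
      evalTC (vecTC (joinVec L τ.1) : QubitTC L col k → ZMod 2) s * inclOff col N.1 ρ s =
        if (Disjoint s τ.1 ∧ s ∪ τ.1 ∈ L.faces) ∧ ρ ⊆ s ∧ s.image col = N.1ᶜ then 1 else 0 := by
    intro s hs
    rw [evalTC_of_mem _ (isToricSimplex_of_mem hk hcol hs), vecTC_qubitTC, joinVec, inclOff]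
    exact (ite_and_eq_mul _ _ _).symm
  rw [Finset.sum_congr rfl h1, ← Finset.sum_filter]
  by_cases hδ : δ.1 = w
  swap
  · rw [Finset.filter_false_of_mem, Finset.sum_empty]
    rintro s hs ⟨-, hρs, -⟩
    have h := mem_facetsOver.mp hs
    exact hδ (hcol.injOn h.1 (Finset.singleton_subset_iff.mp h.2.2) (hρs hw)
      (δ.2.trans hwc.symm))
  by_cases hτN : τ.1.image col = N.1
  swap
  · rw [Finset.filter_false_of_mem, Finset.sum_empty]
    rintro s hs ⟨⟨hd, hf⟩, -, himg⟩
    refine hτN (Finset.eq_of_subset_of_card_le (fun c hc => ?_) ?_)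
    · obtain ⟨v, hv, rfl⟩ := Finset.mem_image.mp hc
      have h3 : col v ∉ s.image col :=
        hcol.col_notMem (Finset.union_comm s τ.1 ▸ hf) hd.symm hv
      rw [himg] at h3
      simpa using h3
    · rw [hcol.card_image τ.2.1, hτc, hNc]
  have hρτ : Disjoint ρ τ.1 := by
    rw [Finset.disjoint_left]
    exact fun v hv hvτ => hρN v hv (hτN ▸ Finset.mem_image_of_mem col hvτ)
  have h2 := card_facetsOver hL hclosed hcol (ρ := ρ ∪ τ.1) ⟨w, Finset.mem_union_left _ hw⟩
  rw [if_neg] at h2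
  · rw [Finset.sum_const, nsmul_eq_mul, mul_one, ← h2]
    congr 1
    refine Finset.card_bij (fun s _ => s ∪ τ.1) ?_ ?_ ?_
    · intro s hs
      obtain ⟨hs, ⟨hd, hf⟩, hρs, -⟩ := Finset.mem_filter.mp hs
      rw [mem_facetsOver, Finset.card_union_of_disjoint hd, (mem_facetsOver.mp hs).2.1]
      exact ⟨hf, by omega, Finset.union_subset_union_left hρs⟩
    · intro s hs s' hs' h
      obtain ⟨-, ⟨hd, -⟩, -⟩ := Finset.mem_filter.mp hs
      obtain ⟨-, ⟨hd', -⟩, -⟩ := Finset.mem_filter.mp hs'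
      rw [← Finset.union_sdiff_cancel_right hd, ← Finset.union_sdiff_cancel_right hd', h]
    · intro t ht
      obtain ⟨ht, htc, hsub⟩ := mem_facetsOver.mp ht
      have hτt : τ.1 ⊆ t := Finset.subset_union_right.trans hsub
      have hρt : ρ ⊆ t \ τ.1 :=
        Finset.subset_sdiff.mpr ⟨Finset.subset_union_left.trans hsub, hρτ⟩
      have hu : t \ τ.1 ∪ τ.1 = t := Finset.sdiff_union_of_subset hτt
      have hface : t \ τ.1 ∈ L.faces := face_of_subset ht Finset.sdiff_subset ⟨w, hρt hw⟩
      have hc : (t \ τ.1).card = k + 2 := by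
        rw [Finset.card_sdiff_of_subset hτt]; omega
      refine ⟨t \ τ.1, Finset.mem_filter.mpr ⟨mem_facetsOver.mpr ⟨hface, hc, ?_⟩,
        ⟨Finset.sdiff_disjoint, by rwa [hu]⟩, hρt, ?_⟩, hu⟩
      · rw [Finset.singleton_subset_iff, hδ]
        exact hρt hw
      · refine hcol.image_eq_compl hk hNc hface hc fun v hv => ?_
        rw [← hτN]
        exact hcol.col_notMem (by rwa [hu]) Finset.sdiff_disjoint hv
  · rintro ⟨-, h⟩
    rw [Finset.card_union_of_disjoint hρτ] at h
    omega

theorem gensTC_cases (hk : k + 2 ≤ d) (hL : IsHomogeneousComplex L d)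
    (hclosed : IsClosedHomologyManifold L d) (hcol : IsColoring L col)
    {g : QubitGroup (QubitTC L col k)} (hg : g ∈ (toricSide L col k).gens) :
    (∃ τ : PlainFace L col (d - k - 2 + 1), g = opW (vecTC (joinVec L τ.1)) 0) ∨
    (∃ ρ : PlainFace L col (k + 1), g = opW 0 (vecTC (incl ρ.1))) ∨
    ∃ w : QubitTC L col k → ZMod 2,
      (∀ δ (τ : PlainFace L col (d - k - 2 + 1)),
        ∑ q : {q // InBlockTC L col k δ q}, vecTC (joinVec L τ.1) q.1 * w q.1 = 0) ∧
      g = opW 0 w := by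
  rcases (mem_gensTC hk hcol).mp hg with ⟨τ, rfl⟩ | ⟨N, ρ, hρ, hc, hρN, rfl⟩ | ⟨a, rfl⟩
  · exact Or.inl ⟨τ, rfl⟩
  · by_cases h : ∀ v ∈ ρ, col v ≠ Fin.last d
    · exact Or.inr (Or.inl ⟨⟨ρ, hρ, hc, h⟩, by
        rw [vecTC_inclOff_of_plain hk hcol N ⟨ρ, hρ, hc, h⟩ hρN]⟩)
    · push Not at h
      obtain ⟨w, hw, hwc⟩ := h
      exact Or.inr (Or.inr ⟨_, fun δ τ =>
        sum_blockTC_joinVec_mul_inclOff hk hL hclosed hcol δ τ N hc hρN hw hwc, rfl⟩)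
  · exact Or.inr (Or.inr ⟨_, fun δ τ =>
      Finset.sum_eq_zero fun p _ => vecTC_mul_ancilla _ _ _, rfl⟩)

theorem opW_incl_mem_gensTC (hk : k + 2 ≤ d) (hcol : IsColoring L col)
    (ρ : PlainFace L col (k + 1)) :
    opW 0 (vecTC (incl ρ.1)) ∈ Subgroup.closure (toricSide L col k).gens := by
  have hlast : Fin.last d ∉ ρ.1.image col := by
    intro h
    obtain ⟨v, hv, e⟩ := Finset.mem_image.mp h
    exact ρ.2.2.2 v hv e
  let N : ColorChoice d k := ⟨(insert (Fin.last d) (ρ.1.image col))ᶜ, by simp, by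
    rw [Finset.card_compl, Fintype.card_fin, Finset.card_insert_of_notMem hlast,
      hcol.card_image ρ.2.1, ρ.2.2.1]
    omega⟩
  have hN : ∀ v ∈ ρ.1, col v ∉ N.1 := by
    intro v hv
    rw [Finset.mem_compl, not_not]
    exact Finset.mem_insert_of_mem (Finset.mem_image_of_mem col hv)
  rw [← vecTC_inclOff_of_plain hk hcol N ρ hN]
  exact Subgroup.subset_closure
    ((mem_gensTC hk hcol).mpr (Or.inr (Or.inl ⟨N, ρ.1, ρ.2.1, ρ.2.2.1, hN, rfl⟩)))

theorem IsColoring.image_sdiff_singleton (hcol : IsColoring L col) {s : Finset V}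
    (hs : s ∈ L.faces) {v : V} (hv : v ∈ s) :
    (s \ {v}).image col = (s.image col).erase (col v) := by
  ext c
  rw [Finset.mem_erase, Finset.mem_image, Finset.mem_image]
  constructor
  · rintro ⟨u, hu, rfl⟩
    rw [Finset.mem_sdiff, Finset.mem_singleton] at hu
    exact ⟨fun h => hu.2 (hcol.injOn hs hu.1 hv h), u, hu.1, rfl⟩
  · rintro ⟨h, u, hu, rfl⟩
    refine ⟨u, ?_, rfl⟩
    rw [Finset.mem_sdiff, Finset.mem_singleton]
    exact ⟨hu, fun e => h (e ▸ rfl)⟩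

theorem sum_erase_eq_sum_powersetCard {r : Finset V} (hr : r.card = k + 1)
    (b : Finset V → ZMod 2) : ∑ v ∈ r, b (r.erase v) = ∑ ν ∈ r.powersetCard k, b ν := by
  have h := sum_powersetCard_succ_erase r k fun _ ν => b ν
  rw [← hr, Finset.powersetCard_self, Finset.sum_singleton] at h
  rw [h]
  refine Finset.sum_congr rfl fun ν hν => ?_
  rw [Finset.mem_powersetCard] at hν
  rw [Finset.sum_const, Finset.card_sdiff_of_subset hν.1, hν.2, hr, Nat.add_sub_cancel_left,
    one_smul]

/-- In the link of δ, the colors outside N and different from d are complementary to N, and joins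
with τ become links of τ. Thus `exists_coboundary` applies to the restriction of w to the register
of N. -/
theorem exists_coboundary_of_sum_eq_zero (hk : k + 2 ≤ d) (hL : IsHomogeneousComplex L d)
    (hclosed : IsClosedHomologyManifold L d) (hcol : IsColoring L col) (δ : LastVertex col)
    (N : ColorChoice d k) (w : QubitTC L col k → ZMod 2)
    (hw : ∀ τ : PlainFace L col (d - k - 2 + 1),
      ∑ q : {q // InBlockTC L col k δ q}, vecTC (joinVec L τ.1) q.1 * w q.1 = 0) :
    ∃ b : Finset V → ZMod 2, ∀ s ∈ facetsOver L (k + 1) {δ.1}, s.image col = N.1ᶜ →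
      evalTC w s = ∑ ν ∈ (s \ {δ.1}).powersetCard k, b ν := by
  have hNc := N.2.2
  have hlast : Fin.last d ∈ N.1ᶜ := Finset.mem_compl.mpr N.2.1
  have himg : ({δ.1} : Finset V).image col = {Fin.last d} := by rw [Finset.image_singleton, δ.2]
  have hP : Disjoint (N.1ᶜ.erase (Fin.last d)) (({δ.1} : Finset V).image col) := by
    rw [himg, Finset.disjoint_singleton_right]
    exact Finset.notMem_erase _ _
  have hPN : (N.1ᶜ.erase (Fin.last d) ∪ ({δ.1} : Finset V).image col)ᶜ = N.1 := by
    rw [himg, Finset.union_comm, ← Finset.insert_eq, Finset.insert_erase hlast, compl_compl]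
  have hPc : (N.1ᶜ.erase (Fin.last d)).card = k + 1 := by
    rw [Finset.card_erase_of_mem hlast, Finset.card_compl, Fintype.card_fin, hNc]
    omega
  have hsd : ∀ s ∈ facetsOver L (k + 1) {δ.1}, s.image col = N.1ᶜ →
      (s \ {δ.1}).image col = N.1ᶜ.erase (Fin.last d) ∧ s \ {δ.1} ∪ {δ.1} = s := by
    intro s hs h
    have h' := mem_facetsOver.mp hs
    rw [hcol.image_sdiff_singleton h'.1 (Finset.singleton_subset_iff.mp h'.2.2), h, δ.2]
    exact ⟨rfl, Finset.sdiff_union_of_subset h'.2.2⟩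
  obtain ⟨b, hb⟩ := exists_coboundary hL hclosed hcol (L.singleton_mem δ.1) hP
    (fun r => evalTC w (r ∪ {δ.1})) (by
      intro τ hτ
      rw [hPN] at hτ
      by_cases hex : ∃ r : Finset V, r.image col = N.1ᶜ.erase (Fin.last d) ∧
          r ∪ τ ∪ {δ.1} ∈ L.faces
      swap
      · push Not at hex
        rw [Finset.filter_false_of_mem fun r _ h => hex r h.1 h.2, Finset.sum_empty]
      obtain ⟨r₀, -, hr₀⟩ := hex
      have hτsub : τ ⊆ r₀ ∪ τ ∪ {δ.1} :=
        Finset.subset_union_right.trans Finset.subset_union_left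
      have hτcard : τ.card = d - 1 - k := by
        rw [← hcol.card_image_of_subset hr₀ hτsub, hτ, hNc]
      have hτface : τ ∈ L.faces := face_of_subset hr₀ hτsub (Finset.card_pos.mp (by omega))
      have h0 := hw ⟨τ, hτface, by omega, fun v hv hvc =>
        N.2.1 (by rw [← hτ, ← hvc]; exact Finset.mem_image_of_mem col hv)⟩
      simp only [mul_comm (vecTC _ _)] at h0
      rw [sum_blockTC_mul_vecTC hk hcol] at h0
      simp only [joinVec, mul_ite, mul_one, mul_zero] at h0
      rw [← Finset.sum_filter] at h0
      rw [← h0]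
      have hδ : ∀ r : Finset V, r.image col = N.1ᶜ.erase (Fin.last d) → Disjoint r {δ.1} :=
        fun r hr => IsLinkChain.disjoint hP fun v hv => hr ▸ Finset.mem_image_of_mem col hv
      refine Finset.sum_bij (fun r _ => r ∪ {δ.1}) ?_ ?_ ?_ fun _ _ => rfl
      · intro r hr
        obtain ⟨-, hrP, hrf⟩ := Finset.mem_filter.mp hr
        have hrc : r.card = k + 1 := by
          rw [← hPc, ← hrP, hcol.card_image_of_subset hrf
            (Finset.subset_union_left.trans Finset.subset_union_left)]
        rw [Finset.union_right_comm] at hrf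
        refine Finset.mem_filter.mpr ⟨mem_facetsOver.mpr
          ⟨face_of_subset hrf Finset.subset_union_left (by simp), ?_,
            Finset.subset_union_right⟩, ?_, hrf⟩
        · rw [Finset.card_union_of_disjoint (hδ r hrP), hrc, Finset.card_singleton]
        · rw [Finset.disjoint_left]
          intro v hv hvτ
          have h1 : col v ∈ N.1 := hτ ▸ Finset.mem_image_of_mem col hvτ
          rcases Finset.mem_union.mp hv with hv | hv
          · have h2 : col v ∈ N.1ᶜ.erase (Fin.last d) := hrP ▸ Finset.mem_image_of_mem col hv
            exact Finset.mem_compl.mp (Finset.mem_of_mem_erase h2) h1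
          · rw [Finset.mem_singleton.mp hv, δ.2] at h1
            exact N.2.1 h1
      · intro r hr r' hr' h
        obtain ⟨-, hrP, -⟩ := Finset.mem_filter.mp hr
        obtain ⟨-, hrP', -⟩ := Finset.mem_filter.mp hr'
        rw [← Finset.union_sdiff_cancel_right (hδ r hrP),
          ← Finset.union_sdiff_cancel_right (hδ r' hrP'), h]
      · intro s hs
        obtain ⟨hs, hd, hf⟩ := Finset.mem_filter.mp hs
        have h' := mem_facetsOver.mp hs
        obtain ⟨h1, h2⟩ := hsd s hs (hcol.image_eq_compl hk hNc h'.1 h'.2.1 fun v hv => by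
          rw [← hτ]
          exact hcol.col_notMem hf hd hv)
        refine ⟨s \ {δ.1}, Finset.mem_filter.mpr ⟨Finset.mem_univ _, h1, ?_⟩, h2⟩
        rw [Finset.union_right_comm, h2]
        exact hf)
  refine ⟨b, fun s hs hsN => ?_⟩
  have h' := mem_facetsOver.mp hs
  obtain ⟨h1, h2⟩ := hsd s hs hsN
  have h3 := hb (s \ {δ.1}) h1 (by rw [h2]; exact h'.1)
  beta_reduce at h3
  rw [h2, sum_erase_eq_sum_powersetCard] at h3
  · exact h3
  · rw [Finset.card_sdiff_of_subset h'.2.2, h'.2.1, Finset.card_singleton]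
    rfl

/-- The primitives of the previous lemma express w as a product of Z-generators at the simplices {δ}
∪ ν of the various complexes. -/
theorem opW_right_mem_gensTC (hk : k + 2 ≤ d) (hL : IsHomogeneousComplex L d)
    (hclosed : IsClosedHomologyManifold L d) (hcol : IsColoring L col)
    (w : QubitTC L col k → ZMod 2)
    (hw : ∀ δ (τ : PlainFace L col (d - k - 2 + 1)),
      ∑ q : {q // InBlockTC L col k δ q}, vecTC (joinVec L τ.1) q.1 * w q.1 = 0) :
    opW 0 w ∈ Subgroup.closure (toricSide L col k).gens := by
  choose b hb using fun δ (N : ColorChoice d k) =>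
    exists_coboundary_of_sum_eq_zero hk hL hclosed hcol δ N w (hw δ)
  let S : Set (QubitTC L col k → ZMod 2) := {v | opW 0 v ∈ (toricSide L col k).gens}
  refine opW_right_mem_of_mem_span _ S (fun a ha => Subgroup.subset_closure ha) ?_
  rw [vecTC_evalTC_add hk hcol w]
  refine Submodule.add_mem _ ?_ (Submodule.sum_mem _ fun a _ => Submodule.smul_mem _ _
    (Submodule.subset_span ((mem_gensTC hk hcol).mpr (Or.inr (Or.inr ⟨a, rfl⟩)))))
  have key : (vecTC (evalTC w) : QubitTC L col k → ZMod 2) =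
      ∑ N : ColorChoice d k, ∑ δ : LastVertex col, ∑ ν ∈ (Finset.univ : Finset V).powersetCard k,
        (if δ.1 ∉ ν then b δ N ν else 0) • vecTC (inclOff col N.1 (insert δ.1 ν)) := by
    funext q
    simp only [Finset.sum_apply, Pi.smul_apply, smul_eq_mul]
    induction q using qubitTC_cases hk hcol with
    | simplex s hs =>
      simp only [vecTC_qubitTC]
      obtain ⟨δ, h1, h2⟩ := hcol.exists_last hs.1 hs.2.2.1
      let N : ColorChoice d k := ⟨(s.image col)ᶜ, by simpa using hs.2.2.1, hs.2.2.2⟩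
      have hsN : s.image col = N.1ᶜ := (compl_compl _).symm
      rw [Finset.sum_eq_single N _ (by simp), Finset.sum_eq_single δ _ (by simp)]
      · rw [hb δ N s (mem_facetsOver.mpr ⟨hs.1, hs.2.1, by simpa using h1⟩) hsN,
          sum_powersetCard_sdiff_eq]
        refine Finset.sum_congr rfl fun ν _ => ?_
        have h3 : inclOff col N.1 (insert δ.1 ν) s = if ν ⊆ s then 1 else 0 :=
          if_congr ⟨fun h => (Finset.subset_insert _ _).trans h.1,
            fun h => ⟨Finset.insert_subset h1 h, hsN⟩⟩ rfl rfl
        rw [h3, ite_and_eq_mul]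
      · intro δ' _ hδ'
        refine Finset.sum_eq_zero fun ν _ => ?_
        have h0 : inclOff col N.1 (insert δ'.1 ν) s = 0 :=
          if_neg fun h => hδ' (h2 δ' (h.1 (Finset.mem_insert_self _ _)))
        rw [h0, mul_zero]
      · intro N' _ hN'
        refine Finset.sum_eq_zero fun δ' _ => Finset.sum_eq_zero fun ν _ => ?_
        have h0 : inclOff col N'.1 (insert δ'.1 ν) s = 0 :=
          if_neg fun h => hN' (Subtype.ext (compl_injective (h.2.symm.trans hsN)))
        rw [h0, mul_zero]
    | ancilla a =>
      exact (Finset.sum_eq_zero fun N _ => Finset.sum_eq_zero fun δ _ =>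
        Finset.sum_eq_zero fun ν _ => mul_zero _).symm
  rw [key]
  refine Submodule.sum_mem _ fun N _ => Submodule.sum_mem _ fun δ _ =>
    Submodule.sum_mem _ fun ν hν => ?_
  by_cases h : δ.1 ∉ ν
  swap
  · rw [if_neg h, zero_smul]; exact Submodule.zero_mem _
  refine Submodule.smul_mem _ _ ?_
  -- If no toric simplex of the right colors contains {δ} ∪ ν, there may be no such cell, but then
  -- its vector is zero.
  by_cases hex : ∃ s, IsToricSimplex L col k s ∧ insert δ.1 ν ⊆ s ∧ s.image col = N.1ᶜ
  · obtain ⟨s, hs, hsub, hsN⟩ := hex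
    refine Submodule.subset_span ((mem_gensTC hk hcol).mpr (Or.inr (Or.inl ⟨N, _,
      face_of_subset hs.1 hsub (by simp), ?_, fun v hv => ?_, rfl⟩)))
    · rw [Finset.card_insert_of_notMem h, (Finset.mem_powersetCard.mp hν).2]
    · rw [← Finset.mem_compl, ← hsN]
      exact Finset.mem_image_of_mem col (hsub hv)
  · push Not at hex
    have : (vecTC (inclOff col N.1 (insert δ.1 ν)) : QubitTC L col k → ZMod 2) =
        vecTC fun _ => 0 :=
      vecTC_congr hk hcol fun s hs => if_neg fun h => hex s hs h.1 h.2
    rw [this]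
    convert Submodule.zero_mem _ using 1
    funext q
    induction q using qubitTC_cases hk hcol with
    | simplex s hs => rfl
    | ancilla a => rfl

/-! ## The unfolding unitary -/

theorem exists_unfolding_unitary (hk : k + 2 ≤ d) (hL : IsHomogeneousComplex L d)
    (hclosed : IsClosedHomologyManifold L d) (hcol : IsColoring L col) :
    ∃ U : ∀ δ : LastVertex col,
        Matrix (Config {q // InBlockTC L col k δ q}) (Config {p // InBlockCC L col k δ p}) ℂ,
      (∀ δ, IsClifford (U δ)) ∧
      IsClifford (tensorBlocks (InBlockCC L col k) (InBlockTC L col k) U) ∧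
      ConjEq (tensorBlocks (InBlockCC L col k) (InBlockTC L col k) U)
        (colorSide L col k).group (toricSide L col k).group := by
  -- `tensorBlocks` is definitionally the block tensor for the subtype inclusions, and both
  -- stabilizer groups are definitionally closures of their `gens`.
  exact exists_tensor_unitary
    (ι := fun δ (p : {p // InBlockCC L col k δ p}) => p.1)
    (κ := fun δ (q : {q // InBlockTC L col k δ q}) => q.1)
    (isPartition_subtype (existsUnique_inBlockCC hcol))
    (isPartition_subtype (existsUnique_inBlockTC hk hcol))
    (card_block_eq hk hcol)
    (fun τ : PlainFace L col (d - k - 2 + 1) => vecCC (incl τ.1))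
    (fun ρ : PlainFace L col (k + 1) => vecCC (incl ρ.1))
    (fun a => ind {Sum.inr a})
    (fun τ => vecTC (joinVec L τ.1)) (fun ρ => vecTC (incl ρ.1)) (fun a => ind {Sum.inr a})
    (fun δ τ ρ => (sum_blockCC_incl_mul_incl hL hclosed hcol δ τ.1 ρ.1).trans
      (sum_blockTC_joinVec_mul_incl hk hcol δ τ ρ).symm)
    (fun δ τ a => Finset.sum_eq_zero fun p _ => vecCC_mul_ancilla _ _ _)
    (fun δ τ a => Finset.sum_eq_zero fun p _ => vecTC_mul_ancilla _ _ _)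
    (fun δ u hu hu' => restrict_mem_span_plainStar hL hclosed hcol (Nat.succ_pos k) (by omega) δ u
      hu hu')
    (fun δ u hu hu' => eq_zero_of_sum_blockTC hk hcol δ u hu hu')
    (colorSide L col k).gens (toricSide L col k).gens
    (fun g hg => gensCC_cases hk hL hclosed hcol hg)
    (fun g hg => gensTC_cases hk hL hclosed hcol hg)
    (fun τ => Subgroup.subset_closure
      (mem_gensCC.mpr (Or.inl ⟨⟨τ.1, τ.2.1, τ.2.2.1⟩, rfl⟩)))
    (fun ρ => Subgroup.subset_closure
      (mem_gensCC.mpr (Or.inr (Or.inl ⟨⟨ρ.1, ρ.2.1, ρ.2.2.1⟩, rfl⟩))))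
    (opW_left_mem_gensCC hk hL hclosed hcol)
    (opW_right_mem_gensCC hk hL hclosed hcol)
    (fun τ => Subgroup.subset_closure ((mem_gensTC hk hcol).mpr (Or.inl ⟨τ, rfl⟩)))
    (opW_incl_mem_gensTC hk hcol)
    (opW_right_mem_gensTC hk hL hclosed hcol)

end ToricGenerators

end

end UnfoldingColorCode

open UnfoldingColorCode in
theorem mainTheorem2 {V : Type*} [Fintype V] (d k : ℕ) (hk : k + 2 ≤ d)
    (L : AbstractSimplicialComplex V) (hL : IsHomogeneousComplex L d)
    (hclosed : IsClosedHomologyManifold L d)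
    (col : V → Fin (d + 1)) (hcol : IsColoring L col) :
    Fintype.card (ColorChoice d k) = d.choose (k + 1) ∧
    (∀ N : ColorChoice d k,
      (shrunk L col k N.1).IsHomogeneous (k + 2) ∧ (shrunk L col k N.1).IsRegular) ∧
    ∃ U : ∀ δ : LastVertex col,
        Matrix (Config {q // InBlockTC L col k δ q}) (Config {p // InBlockCC L col k δ p}) ℂ,
      (∀ δ, IsClifford (U δ)) ∧
      IsClifford (tensorBlocks (InBlockCC L col k) (InBlockTC L col k) U) ∧
      ConjEq (tensorBlocks (InBlockCC L col k) (InBlockTC L col k) U)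
        (colorSide L col k).group (toricSide L col k).group :=
  ⟨card_colorChoice hk _,
    fun N => ⟨shrunk_isHomogeneous hk hL hcol N.2.2, shrunk_isRegular hk hL hclosed hcol⟩,
    exists_unfolding_unitary hk hL hclosed hcol⟩
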